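/- Let $G$ be a complex semisimple group with maximal torus $T$, a choice of positive roots with simple roots $\alpha_i$ $(i\in I)$ and simple coroots $\alpha_i^\vee$, Chevalley generators $e_i,f_i$ of $\mathfrak g=\operatorname{Lie}G$, and maximal unipotent subgroup $N$ with Lie algebra $\mathfrak n$ the sum of the positive root spaces. Let $P_+$ be the set of dominant weights of $G$. On the coordinate ring $\mathbb C[N]$ let $$(e_i\varphi)(g)=\tfrac{d}{dt}\varphi(g\exp(te_i))\big|_{t=0},\qquad (e_i^*\varphi)(g)=\tfrac{d}{dt}\varphi(\exp(te_i)g)\big|_{t=0},$$ and say that $\varphi$ has weight $\gamma$ if $\varphi(t^{-1}gt)=\gamma(t)\varphi(g)$ for all $t\in T$, $g\in N$. Let $M$ be a vector space with weight spaces and locally nilpotent operators $E_i$ $(i\in I)$, and put $\varepsilon_i(v)=\max\{n\in\mathbb N:E_i^nv\ne0\}$ for $v\neq 0$. A basis $B$ of $M$ is called *perfect* if it consists of weight vectors, if for all $i$ and $n$ the space $\ker E_i^n$ is spanned by $B\cap\ker E_i^n$, and if for all $i$ and all $b\in B$ either $E_ib=0$ or there is $b'\in B$ with $E_ib-\varepsilon_i(b)\,b'\in\ker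 E_i^{\varepsilon_i(b)-1}$. A basis $B$ of $\mathbb C[N]$ is called *biperfect* if $1\in B$ and $B$ is perfect both for the operators $e_i$ and for the operators $e_i^*$; write $\varepsilon_i$ and $\varepsilon_i^*$ for the corresponding functions on $B$. For $\lambda\in P_+$ let $V(\lambda)$ be the irreducible representation of $G$ of highest weight $\lambda$, $v_\lambda$ a highest weight vector, and $v_\lambda^*$ the linear form on $V(\lambda)$ that is $1$ at $v_\lambda$ and vanishes on all other weight spaces; let $\Psi_\lambda:V(\lambda)\to\mathbb C[N]$, $\Psi_\lambda(v)(g)=v_\lambda^*(gv)$. For $\lambda,\mu,\nu\in P_+$ let $C^\nu_{\lambda\mu}=\operatorname{Hom}_G(V(\nu),V(\lambda)\otimes V(\mu))$, and let $\kappa:C^\nu_{\lambda\mu}\to V(\lambda)$ be the linear map $\kappa(\phi)=(1\otimes v_\mu^*)(\phi(v_\nu))$. Let $B$ be a biperfect basis of $\mathbb C[N]$. Then: 1. For every $\lambda\in P_+$, each element $b$ of $\{b\in B:\varepsilon_i^*(b)\le\alpha_i^\vee(\lambda)\ \forall i\in I\}$ has a preimage $\beta_b\in V(\lambda)$ under $\Psi_\lambda$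 such that the $\beta_b$ form a basis of $V(\lambda)$, and this basis is perfect for the operators $e_i$ on $V(\lambda)$. 2. For all $\lambda,\mu,\nu\in P_+$, each element $b$ of $$\{b\in B:\ b\text{ has weight }\nu-\mu-\lambda,\ \ \varepsilon_i(b)\le\alpha_i^\vee(\mu)\ \text{and}\ \varepsilon_i^*(b)\le\alpha_i^\vee(\lambda)\ \ \forall i\in I\}$$ has a preimage $\beta_b\in C^\nu_{\lambda\mu}$ under $\Psi_\lambda\circ\kappa$ such that the $\beta_b$ form a basis of $C^\nu_{\lambda\mu}$. -/

import Mathlib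

universe u v

open Module LieAlgebra LieAlgebra.IsKilling

noncomputable section

/-! ### Perfect bases -/

/-- `ε(v) = max {n : E^n v ≠ 0}`, the nilpotence degree of an operator `E` on a vector `v`.
(It is used for locally nilpotent `E`; it is `0` at `v = 0`.) -/
def nilpotenceDegree {M : Type*} [AddCommGroup M] [Module ℂ M] (E : Module.End ℂ M) (v : M) : ℕ :=
  sSup {n : ℕ | (E ^ n) v ≠ 0}

/-- `B` is a perfect basis of the vector space `M`, which is equipped with a family of weight
spaces `wt γ` and with raising operators `E i`: it is a basis of weight vectors, it is compatible
with the kernels of all powers of all `E i`, and each `E i` permutes it up to the scalar `ε_i(b)`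
and up to terms of lower nilpotence degree. -/
structure IsPerfectBasis {ι Γ M : Type*} [AddCommGroup M] [Module ℂ M]
    (wt : Γ → Submodule ℂ M) (E : ι → Module.End ℂ M) (B : Set M) : Prop where
  linearIndependent : LinearIndependent ℂ (fun b : B => (b : M))
  span_eq_top : Submodule.span ℂ B = ⊤
  exists_weight : ∀ b ∈ B, ∃ γ, b ∈ wt γ
  compatible : ∀ (i : ι) (n : ℕ),
    LinearMap.ker (E i ^ n) = Submodule.span ℂ (B ∩ LinearMap.ker (E i ^ n))
  perfect : ∀ (i : ι), ∀ b ∈ B, E i b = 0 ∨ ∃ b' ∈ B,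
    E i b - (nilpotenceDegree (E i) b : ℂ) • b' ∈
      LinearMap.ker (E i ^ (nilpotenceDegree (E i) b - 1))

/-! ### Representations and weights -/

section Reps

attribute [local instance] LieRing.ofAssociativeRing

variable {L : Type u} [LieRing L] [LieAlgebra ℂ L]

/-- All weights of the Lie algebra representation `V`, with respect to `H`, lie in `X`. -/
def WeightsIn (H : LieSubalgebra ℂ L) (X : AddSubgroup (Dual ℂ H)) (V : Type*) [AddCommGroup V]
    [Module ℂ V] [LieRingModule L V] [LieModule ℂ L V] : Prop :=
  ∀ (χ : Dual ℂ H) (w : V), w ≠ 0 → (∀ h : H, ⁅(h : L), w⁆ = χ h • w) → χ ∈ X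

/-- Finite-dimensional representations on coordinate spaces, all of whose weights lie in `X`.
(Every finite-dimensional representation with weights in `X` is isomorphic to one of these.) -/
structure MatrixRep (H : LieSubalgebra ℂ L) (X : AddSubgroup (Dual ℂ H)) where
  dim : ℕ
  hom : L →ₗ⁅ℂ⁆ Matrix (Fin dim) (Fin dim) ℂ
  weights_mem : ∀ (χ : Dual ℂ H) (w : Fin dim → ℂ), w ≠ 0 →
    (∀ h : H, (hom h).mulVec w = χ h • w) → χ ∈ X

variable {H : LieSubalgebra ℂ L} {X : AddSubgroup (Dual ℂ H)}

/-- The matrix form of a finite-dimensional representation in a basis (the choice of the basis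
is irrelevant for what follows). -/
def toMatrixRep {V : Type*} [AddCommGroup V] [Module ℂ V] [FiniteDimensional ℂ V]
    [LieRingModule L V] [LieModule ℂ L V] (hV : WeightsIn H X V) : MatrixRep H X where
  dim := finrank ℂ V
  hom := (LinearMap.toMatrixAlgEquiv (finBasis ℂ V)).toAlgHom.toLieHom.comp
    (LieModule.toEnd ℂ L V)
  weights_mem := by
    intro χ w hw h
    have key : ∀ x : L, (finBasis ℂ V).equivFun.symm
        ((LinearMap.toMatrix (finBasis ℂ V) (finBasis ℂ V) (LieModule.toEnd ℂ L V x)).mulVec w)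
          = ⁅x, (finBasis ℂ V).equivFun.symm w⁆ := by
      intro x
      rw [LinearEquiv.symm_apply_eq]
      have := LinearMap.toMatrix_mulVec_repr (finBasis ℂ V) (finBasis ℂ V)
        (LieModule.toEnd ℂ L V x) ((finBasis ℂ V).equivFun.symm w)
      rw [← Basis.equivFun_apply, LinearEquiv.apply_symm_apply] at this
      rw [this]; rfl
    refine hV χ ((finBasis ℂ V).equivFun.symm w)
      ((LinearEquiv.map_ne_zero_iff _).2 hw) fun y => ?_
    rw [← key, ← map_smul]
    exact congrArg _ (h y)

/-- The ambient group in which the complex points of a semisimple group live: the product of the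
general linear groups of all its representations. -/
abbrev Ambient (H : LieSubalgebra ℂ L) (X : AddSubgroup (Dual ℂ H)) : Type u :=
  ∀ ρ : MatrixRep H X, (Matrix (Fin ρ.dim) (Fin ρ.dim) ℂ)ˣ

/-- The exponential map of the group: `exp x` acts as `exp (ρ x)` in every representation `ρ`. -/
def expG (X : AddSubgroup (Dual ℂ H)) (x : L) : Ambient H X := fun ρ =>
  (Matrix.isUnit_exp (ρ.hom x)).unit

lemma expG_val (x : L) (ρ : MatrixRep H X) :
    ((expG X x ρ : (Matrix (Fin ρ.dim) (Fin ρ.dim) ℂ)ˣ) : Matrix (Fin ρ.dim) (Fin ρ.dim) ℂ) =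
      NormedSpace.exp (ρ.hom x) := rfl

/-! Auxiliary facts on the matrix exponential. -/

open scoped Matrix.Norms.Operator in
lemma matrix_exp_entry_aux {d : ℕ} (A : Matrix (Fin d) (Fin d) ℂ) (i j : Fin d) :
    HasDerivAt (fun t : ℂ => (NormedSpace.exp (t • A)) i j) (A i j) 0 := by
  have h := hasDerivAt_exp_smul_const (𝕂 := ℂ) A (0 : ℂ)
  rw [zero_smul, NormedSpace.exp_zero, one_mul] at h
  have h2 := ((Matrix.entryLinearMap ℂ ℂ i j).toContinuousLinearMap).hasFDerivAt.comp_hasDerivAt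
    (0 : ℂ) h
  exact h2

lemma matrix_exp_entry {d : ℕ} (A : Matrix (Fin d) (Fin d) ℂ) (i j : Fin d) :
    HasDerivAt (fun t : ℂ => (NormedSpace.exp (t • A)) i j) (A i j) 0 :=
  matrix_exp_entry_aux A i j

open scoped Matrix.Norms.Operator in
lemma matrix_exp_semiconj {d : ℕ} (A B C : Matrix (Fin d) (Fin d) ℂ) (h : SemiconjBy A B C) :
    A * NormedSpace.exp B = NormedSpace.exp C * A := h.exp_right

lemma matrix_exp_eigen {d : ℕ} (a : ℂ) (A B : Matrix (Fin d) (Fin d) ℂ)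
    (h : B * A - A * B = a • A) :
    A * NormedSpace.exp B = Complex.exp (-a) • (NormedSpace.exp B * A) := by
  have h1 : SemiconjBy A B (B + (-a) • 1) := by
    simp only [SemiconjBy, add_mul, smul_mul_assoc, one_mul, neg_smul, neg_mul, ← h]; abel
  have h2 : A * NormedSpace.exp B = NormedSpace.exp (B + (-a) • 1) * A :=
    matrix_exp_semiconj _ _ _ h1
  have h3 : NormedSpace.exp (B + (-a) • 1) =
      NormedSpace.exp B * NormedSpace.exp ((-a) • (1 : Matrix (Fin d) (Fin d) ℂ)) :=
    Matrix.exp_add_of_commute B ((-a) • 1) (by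
      rw [← Algebra.algebraMap_eq_smul_one]; exact (Algebra.commutes _ _).symm)
  have h4 : NormedSpace.exp ((-a) • (1 : Matrix (Fin d) (Fin d) ℂ)) = Complex.exp (-a) • 1 := by
    rw [← Matrix.diagonal_one, ← Matrix.diagonal_smul, Matrix.exp_diagonal,
      ← Matrix.diagonal_smul]
    congr 1; funext i
    rw [Pi.coe_exp]
    simp [Complex.exp_eq_exp_ℂ]
  rw [h2, h3, h4]; simp

lemma expG_zero : expG X (0 : L) = 1 := by
  funext ρ
  apply Units.ext
  rw [expG_val, map_zero, NormedSpace.exp_zero]; rfl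

end Reps

/-! ### Semisimple groups -/

/-- A complex semisimple group `G` with its Lie algebra `L` and a maximal torus `T` with Lie
algebra `H`. The group is given by the Lie algebra and by the lattice `X` of characters of `T`
(written as linear forms on `H`), which lies between the root lattice and the weight lattice. A
base of the root system and Chevalley generators `e i`, `f i`, `α_i^∨` of `L` are chosen. -/
structure SemisimpleGroup {L : Type u} [LieRing L] [LieAlgebra ℂ L] [FiniteDimensional ℂ L]
    [LieAlgebra.IsSemisimple ℂ L] (H : LieSubalgebra ℂ L) [H.IsCartanSubalgebra] where
  X : AddSubgroup (Dual ℂ H)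
  root_mem : ∀ α : H.root, (rootSystem H).root α ∈ X
  integral : ∀ χ ∈ X, ∀ α : H.root, ∃ z : ℤ, χ ((rootSystem H).coroot α) = z
  base : (rootSystem H).Base
  e : base.support → L
  f : base.support → L
  e_mem : ∀ i : base.support, e i ∈ rootSpace H (i : H.root).1
  f_mem : ∀ i : base.support, f i ∈ rootSpace H (-(i : H.root).1)
  lie_e_f : ∀ i : base.support, ⁅e i, f i⁆ = ((rootSystem H).coroot (i : H.root) : L)

namespace SemisimpleGroup

variable {L : Type u} [LieRing L] [LieAlgebra ℂ L] [FiniteDimensional ℂ L]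
  [LieAlgebra.IsSemisimple ℂ L] {H : LieSubalgebra ℂ L} [H.IsCartanSubalgebra]
  (D : SemisimpleGroup H)

/-- The index set of the simple roots. -/
abbrev I : Type u := D.base.support

/-- The simple coroots. -/
abbrev simpleCoroot (i : D.I) : H := (rootSystem H).coroot (i : H.root)

/-- The nilpotent Lie algebra `𝔫`: the sum of the positive root spaces. -/
def n : Submodule ℂ L :=
  ⨆ (α : H.root) (_ : D.base.IsPos α), (rootSpace H α.1).toSubmodule

lemma e_mem_n (i : D.I) : D.e i ∈ D.n :=
  (le_iSup₂_of_le (f := fun (α : H.root) (_ : D.base.IsPos α) => (rootSpace H α.1).toSubmodule)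
    (i : H.root) (RootPairing.Base.isPos_of_mem_support i.2) le_rfl) (D.e_mem i)

/-- The Chevalley generators `e i` as elements of `𝔫`. -/
def eN (i : D.I) : D.n := ⟨D.e i, D.e_mem_n i⟩

/-- The maximal unipotent subgroup `N`: it is generated by the exponentials of the elements
of `𝔫`. (Similarly `G` is generated by all exponentials.) -/
def N : Subgroup (Ambient H D.X) := Subgroup.closure (expG D.X '' D.n)

/-- The exponential map `𝔫 → N`. -/
def expN (x : D.n) : D.N := ⟨expG D.X x, Subgroup.subset_closure ⟨x, x.2, rfl⟩⟩

/-! #### Conjugation by the torus -/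

section

attribute [local instance] LieRing.ofAssociativeRing

lemma exists_conj (h : H) {x : L} (hx : x ∈ D.n) :
    ∃ y ∈ D.n, (expG D.X (h : L))⁻¹ * expG D.X x * expG D.X (h : L) = expG D.X y := by
  have key : ∃ y ∈ D.n, ∀ ρ : MatrixRep H D.X,
      ρ.hom x * NormedSpace.exp (ρ.hom h) = NormedSpace.exp (ρ.hom h) * ρ.hom y := by
    unfold n at hx ⊢
    induction hx using Submodule.iSup_induction' with
    | mem α x hx =>
      by_cases hα : D.base.IsPos α
      · simp only [hα, iSup_pos] at hx
        refine ⟨Complex.exp (-(α.1 h)) • x, Submodule.smul_mem _ _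
          ((le_iSup₂_of_le (f := fun (α : H.root) (_ : D.base.IsPos α) =>
            (rootSpace H α.1).toSubmodule) α hα le_rfl) hx), fun ρ => ?_⟩
        have hb : ⁅(h : L), x⁆ = α.1 h • x := lie_eq_smul_of_mem_rootSpace hx h
        have := congrArg ρ.hom hb
        rw [LieHom.map_lie, map_smul] at this
        rw [matrix_exp_eigen _ _ _ this, map_smul, mul_smul_comm]
      · simp only [hα, iSup_neg, not_false_eq_true, Submodule.mem_bot] at hx
        exact ⟨0, zero_mem _, fun ρ => by simp [hx]⟩
    | zero => exact ⟨0, zero_mem _, fun ρ => by simp⟩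
    | add x y _ _ hx hy =>
      obtain ⟨x', hx', hx⟩ := hx
      obtain ⟨y', hy', hy⟩ := hy
      exact ⟨x' + y', add_mem hx' hy', fun ρ => by simp [add_mul, mul_add, hx, hy]⟩
  obtain ⟨y, hy, key⟩ := key
  refine ⟨y, hy, funext fun ρ => ?_⟩
  apply Units.ext
  simp only [Pi.mul_apply, Pi.inv_apply, Units.val_mul]
  rw [mul_assoc, Units.inv_mul_eq_iff_eq_mul]
  have h1 := matrix_exp_semiconj (NormedSpace.exp (ρ.hom h)) (ρ.hom y) (ρ.hom x) (key ρ).symm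
  exact h1.symm

end

lemma conj_mem (h : H) (g : D.N) :
    (expG D.X (h : L))⁻¹ * (g : Ambient H D.X) * expG D.X (h : L) ∈ D.N := by
  obtain ⟨g, hg⟩ := g
  have hle : D.N ≤ D.N.comap (MulAut.conj (expG D.X (h : L))⁻¹).toMonoidHom := by
    conv_lhs => unfold N
    rw [Subgroup.closure_le]
    rintro _ ⟨x, hx, rfl⟩
    obtain ⟨y, hy, hxy⟩ := D.exists_conj h hx
    simp only [SetLike.mem_coe, Subgroup.mem_comap, MulEquiv.coe_toMonoidHom,
      MulAut.conj_apply, inv_inv]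
    rw [hxy]
    exact Subgroup.subset_closure ⟨y, hy, rfl⟩
  simpa using hle hg

/-- The conjugate `t⁻¹ g t` of `g ∈ N` by the element `t = exp h` of the torus `T`. -/
def torusConj (h : H) (g : D.N) : D.N :=
  ⟨(expG D.X (h : L))⁻¹ * (g : Ambient H D.X) * expG D.X (h : L), D.conj_mem h g⟩

/-! #### The coordinate ring of `N` -/

/-- The matrix coordinate functions on `N`. -/
def coord (ρ : MatrixRep H D.X) (i j : Fin ρ.dim) : D.N → ℂ := fun g =>
  ((g : Ambient H D.X) ρ : Matrix (Fin ρ.dim) (Fin ρ.dim) ℂ) i j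

/-- The coordinate ring `ℂ[N]`: the algebra of functions on `N` that is generated by the matrix
coordinates in the representations of `G`. (Inverses of determinants need not be added, because
all determinants are `1` on `N`.) -/
def coordRing : Subalgebra ℂ (D.N → ℂ) :=
  Algebra.adjoin ℂ {φ | ∃ (ρ : MatrixRep H D.X) (i j : Fin ρ.dim), φ = D.coord ρ i j}

/-- `ℂ[N]`. -/
abbrev CN : Type u := D.coordRing

lemma coord_mem (ρ : MatrixRep H D.X) (i j : Fin ρ.dim) : D.coord ρ i j ∈ D.coordRing :=
  Algebra.subset_adjoin ⟨ρ, i, j, rfl⟩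

lemma coord_mul (ρ : MatrixRep H D.X) (i j : Fin ρ.dim) (g g' : D.N) :
    D.coord ρ i j (g * g') = ∑ k, D.coord ρ i k g * D.coord ρ k j g' := by
  simp [coord, Matrix.mul_apply]

lemma coord_expN (ρ : MatrixRep H D.X) (i j : Fin ρ.dim) (x : D.n) :
    HasDerivAt (fun t : ℂ => D.coord ρ i j (D.expN (t • x))) (ρ.hom (x : L) i j) 0 := by
  have h := matrix_exp_entry (ρ.hom (x : L)) i j
  simpa [coord, expN, expG_val] using h

lemma expN_zero_smul (x : D.n) : D.expN ((0 : ℂ) • x) = 1 := by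
  apply Subtype.ext
  simp [expN, expG_zero]

/-- A derivative of regular functions along a family of curves is again a regular function. -/
lemma exists_deriv (c : D.N → ℂ → D.N) (hc0 : ∀ g, c g 0 = g)
    (hc : ∀ (ρ : MatrixRep H D.X) (i j : Fin ρ.dim), ∃ ψ ∈ D.coordRing,
      ∀ g, HasDerivAt (fun t : ℂ => D.coord ρ i j (c g t)) (ψ g) 0)
    (φ : D.N → ℂ) (hφ : φ ∈ D.coordRing) :
    ∃ ψ ∈ D.coordRing, ∀ g, HasDerivAt (fun t : ℂ => φ (c g t)) (ψ g) 0 := by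
  induction hφ using Algebra.adjoin_induction with
  | mem φ hφ =>
    obtain ⟨ρ, i, j, rfl⟩ := hφ
    exact hc ρ i j
  | algebraMap r =>
    exact ⟨0, zero_mem _, fun g => by simpa using hasDerivAt_const (0 : ℂ) r⟩
  | add φ φ' _ _ h h' =>
    obtain ⟨ψ, hψ, h⟩ := h
    obtain ⟨ψ', hψ', h'⟩ := h'
    exact ⟨ψ + ψ', add_mem hψ hψ', fun g => (h g).add (h' g)⟩
  | mul φ φ' hφ hφ' h h' =>
    obtain ⟨ψ, hψ, h⟩ := h
    obtain ⟨ψ', hψ', h'⟩ := h'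
    refine ⟨ψ * φ' + φ * ψ', add_mem (mul_mem hψ hφ') (mul_mem hφ hψ'), fun g => ?_⟩
    have := (h g).mul (h' g)
    rw [hc0] at this
    exact this

lemma exists_leftDeriv (x : D.n) (φ : D.CN) : ∃ ψ ∈ D.coordRing,
    ∀ g, HasDerivAt (fun t : ℂ => φ.1 (g * D.expN (t • x))) (ψ g) 0 := by
  refine D.exists_deriv (fun g t => g * D.expN (t • x))
    (fun g => by simp only [expN_zero_smul, mul_one]) (fun ρ i j => ?_) φ.1 φ.2
  refine ⟨∑ k, (ρ.hom (x : L) k j) • D.coord ρ i k,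
    sum_mem fun k _ => Subalgebra.smul_mem _ (D.coord_mem ρ i k) _, fun g => ?_⟩
  simp only [coord_mul]
  have := HasDerivAt.fun_sum (u := Finset.univ) fun k _ =>
    (D.coord_expN ρ k j x).const_mul (D.coord ρ i k g)
  convert! this using 1
  simp [mul_comm]

lemma exists_rightDeriv (x : D.n) (φ : D.CN) : ∃ ψ ∈ D.coordRing,
    ∀ g, HasDerivAt (fun t : ℂ => φ.1 (D.expN (t • x) * g)) (ψ g) 0 := by
  refine D.exists_deriv (fun g t => D.expN (t • x) * g)
    (fun g => by simp only [expN_zero_smul, one_mul]) (fun ρ i j => ?_) φ.1 φ.2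
  refine ⟨∑ k, (ρ.hom (x : L) i k) • D.coord ρ k j,
    sum_mem fun k _ => Subalgebra.smul_mem _ (D.coord_mem ρ k j) _, fun g => ?_⟩
  simp only [coord_mul]
  have := HasDerivAt.fun_sum (u := Finset.univ) fun k _ =>
    (D.coord_expN ρ i k x).mul_const (D.coord ρ k j g)
  convert! this using 1
  simp

/-- The left action of `x ∈ 𝔫` on `ℂ[N]`: `(x φ)(g) = d/dt φ(g exp(t x))` at `t = 0`, the
differential of the left action `(n φ)(g) = φ(g n)` of `N`. -/
def leftAct (x : D.n) : Module.End ℂ D.CN where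
  toFun φ := ⟨fun g => deriv (fun t : ℂ => φ.1 (g * D.expN (t • x))) 0, by
    obtain ⟨ψ, hψ, h⟩ := D.exists_leftDeriv x φ
    rwa [show (fun g => deriv (fun t : ℂ => φ.1 (g * D.expN (t • x))) 0) = ψ from
      funext fun g => (h g).deriv]⟩
  map_add' φ φ' := by
    obtain ⟨ψ, -, h⟩ := D.exists_leftDeriv x φ
    obtain ⟨ψ', -, h'⟩ := D.exists_leftDeriv x φ'
    apply Subtype.ext
    funext g
    exact ((h g).add (h' g)).deriv.trans (congrArg₂ _ (h g).deriv (h' g).deriv).symm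
  map_smul' r φ := by
    obtain ⟨ψ, -, h⟩ := D.exists_leftDeriv x φ
    apply Subtype.ext
    funext g
    exact ((h g).const_mul r).deriv.trans (congrArg (r * ·) (h g).deriv).symm

/-- The right action of `x ∈ 𝔫` on `ℂ[N]`: `(φ x)(g) = d/dt φ(exp(t x) g)` at `t = 0`, the
differential of the right action `(φ n)(g) = φ(n g)` of `N`. -/
def rightAct (x : D.n) : Module.End ℂ D.CN where
  toFun φ := ⟨fun g => deriv (fun t : ℂ => φ.1 (D.expN (t • x) * g)) 0, by
    obtain ⟨ψ, hψ, h⟩ := D.exists_rightDeriv x φ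
    rwa [show (fun g => deriv (fun t : ℂ => φ.1 (D.expN (t • x) * g)) 0) = ψ from
      funext fun g => (h g).deriv]⟩
  map_add' φ φ' := by
    obtain ⟨ψ, -, h⟩ := D.exists_rightDeriv x φ
    obtain ⟨ψ', -, h'⟩ := D.exists_rightDeriv x φ'
    apply Subtype.ext
    funext g
    exact ((h g).add (h' g)).deriv.trans (congrArg₂ _ (h g).deriv (h' g).deriv).symm
  map_smul' r φ := by
    obtain ⟨ψ, -, h⟩ := D.exists_rightDeriv x φ
    apply Subtype.ext
    funext g
    exact ((h g).const_mul r).deriv.trans (congrArg (r * ·) (h g).deriv).symm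

/-- The operators `e_i` on `ℂ[N]`. -/
def eLeft (i : D.I) : Module.End ℂ D.CN := D.leftAct (D.eN i)

/-- The operators `e_i^*` on `ℂ[N]`. -/
def eRight (i : D.I) : Module.End ℂ D.CN := D.rightAct (D.eN i)

/-- The weight spaces of `ℂ[N]` for the action `(t φ)(g) = φ(t⁻¹ g t)` of the torus: `φ` has
weight `γ` if `(t φ) = e^{γ(h)} φ` for all `t = exp h`. -/
def weightCN (γ : Dual ℂ H) : Submodule ℂ D.CN where
  carrier := {φ | ∀ (h : H) (g : D.N), φ.1 (D.torusConj h g) = Complex.exp (γ h) * φ.1 g}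
  zero_mem' := fun h g => by simp
  add_mem' := fun {φ ψ} hφ hψ h g => by
    have := congrArg₂ (· + ·) (hφ h g) (hψ h g)
    simpa [mul_add] using this
  smul_mem' := fun r φ hφ h g => by
    have := congrArg (r * ·) (hφ h g)
    simpa [mul_left_comm] using this

/-- A biperfect basis of `ℂ[N]`: it contains `1` and is perfect for the left and for the right
action of `𝔫`. -/
structure IsBiperfect (B : Set D.CN) : Prop where
  one_mem : 1 ∈ B
  left : IsPerfectBasis D.weightCN D.eLeft B
  right : IsPerfectBasis D.weightCN D.eRight B

/-- `ε_i(b)`. -/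
def eps (i : D.I) (b : D.CN) : ℕ := nilpotenceDegree (D.eLeft i) b

/-- `ε_i^*(b)`. -/
def epsStar (i : D.I) (b : D.CN) : ℕ := nilpotenceDegree (D.eRight i) b

/-! #### Dominant weights and irreducible representations -/

/-- Elements of `P_+`: the characters `λ` of the torus for which all `α_i^∨(λ)` are natural
numbers. The number `α_i^∨(λ)` is `label i`. -/
structure DominantWeight where
  weight : Dual ℂ H
  mem : weight ∈ D.X
  label : D.I → ℕ
  weight_simpleCoroot : ∀ i : D.I, weight (D.simpleCoroot i) = label i

section V

variable (V : Type v) [AddCommGroup V] [Module ℂ V] [FiniteDimensional ℂ V]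
  [LieRingModule L V] [LieModule ℂ L V]

/-- The operators `e_i` on a representation. -/
def eRep (i : D.I) : Module.End ℂ V := LieModule.toEnd ℂ L V (D.e i)

/-- The weight spaces of a representation. -/
def weightRep (_ : SemisimpleGroup H) (V : Type v) [AddCommGroup V] [Module ℂ V]
    [LieRingModule L V] [LieModule ℂ L V] (γ : Dual ℂ H) : Submodule ℂ V :=
  (LieModule.weightSpace V (γ : H → ℂ)).toSubmodule

/-- `V` is the irreducible representation `V(λ)` of `G`, with a chosen highest weight vector
`v_λ` and the dual linear form `v_λ^*`, which is `1` at `v_λ` and vanishes on all other weight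
spaces. -/
structure HighestWeightRep (Λ : D.DominantWeight) where
  weightsIn : WeightsIn H D.X V
  irreducible : LieModule.IsIrreducible ℂ L V
  vec : V
  vec_ne_zero : vec ≠ 0
  vec_mem : vec ∈ D.weightRep V Λ.weight
  eRep_vec : ∀ i : D.I, D.eRep V i vec = 0
  form : Dual ℂ V
  form_vec : form vec = 1
  form_eq_zero : ∀ γ : Dual ℂ H, γ ≠ Λ.weight → ∀ w ∈ D.weightRep V γ, form w = 0

variable {V}

/-- The action of `g ∈ N` on a representation of `G`. -/
def act (hV : WeightsIn H D.X V) (g : D.N) : Module.End ℂ V :=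
  Matrix.toLin (finBasis ℂ V) (finBasis ℂ V)
    (Units.val ((g : Ambient H D.X) (toMatrixRep hV)))

lemma matrixCoeff_mem (hV : WeightsIn H D.X V) (ξ : Dual ℂ V) (w : V) :
    (fun g => ξ (D.act hV g w)) ∈ D.coordRing := by
  have : (fun g => ξ (D.act hV g w)) = ∑ i : Fin (finrank ℂ V), ∑ j : Fin (finrank ℂ V),
      (((finBasis ℂ V).repr w j) * ξ (finBasis ℂ V i)) • D.coord (toMatrixRep hV) i j := by
    funext g
    simp only [act, Matrix.toLin_apply, map_sum, map_smul, Matrix.mulVec, dotProduct,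
      Finset.sum_apply, Pi.smul_apply, smul_eq_mul, Finset.sum_mul]
    refine Finset.sum_congr rfl fun i _ => Finset.sum_congr rfl fun j _ => ?_
    simp only [coord]
    ring
  rw [this]
  exact sum_mem fun i _ => sum_mem fun j _ => Subalgebra.smul_mem _ (D.coord_mem _ _ _) _

variable {D}

/-- The map `Ψ_λ : V(λ) → ℂ[N]`, `Ψ_λ(w)(g) = v_λ^*(g w)`. -/
def HighestWeightRep.psi {Λ : D.DominantWeight} (R : D.HighestWeightRep V Λ) : V →ₗ[ℂ] D.CN where
  toFun w := ⟨fun g => R.form (D.act R.weightsIn g w), D.matrixCoeff_mem R.weightsIn R.form w⟩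
  map_add' w w' := by
    apply Subtype.ext
    funext g
    simp
  map_smul' r w := by
    apply Subtype.ext
    funext g
    simp

end V

open scoped TensorProduct in
/-- The canonical map `Hom_G(V(ν), V(λ) ⊗ V(μ)) → V(λ)` that sends `φ` to the contraction
`(1 ⊗ v_μ^*)(φ(v_ν))`. -/
def contraction {D : SemisimpleGroup H} {U V W : Type v}
    [AddCommGroup U] [Module ℂ U] [FiniteDimensional ℂ U] [LieRingModule L U] [LieModule ℂ L U]
    [AddCommGroup V] [Module ℂ V] [FiniteDimensional ℂ V] [LieRingModule L V] [LieModule ℂ L V]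
    [AddCommGroup W] [Module ℂ W] [FiniteDimensional ℂ W] [LieRingModule L W] [LieModule ℂ L W]
    {mu nu : D.DominantWeight} (RV : D.HighestWeightRep V mu) (RW : D.HighestWeightRep W nu) :
    (W →ₗ⁅ℂ, L⁆ U ⊗[ℂ] V) →ₗ[ℂ] U where
  toFun φ := TensorProduct.rid ℂ U (LinearMap.lTensor U RV.form (φ RW.vec))
  map_add' φ ψ := by simp
  map_smul' r φ := by simp

end SemisimpleGroup

end

noncomputable section

set_option linter.unusedSectionVars false

/-! Everything reduces to computing two images in `ℂ[N]`. The image of `Ψ_λ` consists of the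
functions killed by `(e_i^*)^(α_i^∨(λ)+1)` for all `i` (`mem_range_psi`). The image of `Ψ_λ ∘ κ` is
cut out of it by the weight `ν-μ-λ` and the equations `e_i^(α_i^∨(μ)+1) φ = 0`
(`mem_range_psi_comp_contraction`). Both maps are injective. A biperfect basis is compatible with
kernels of powers of `e_i` and `e_i^*` and with weight spaces: a function lies in such a subspace
exactly when all basis elements in its expansion do. This property passes to intersections, so each
image is spanned by the basis elements that it contains. Perfectness transfers because the `b'`
attached to `b` and `i` occurs in the expansion of `e_i b`, hence lies in the same image.

To find the image of `Ψ_λ`, the left action of `𝔫` on `ℂ[N]` is extended to a twisted action of the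
whole Lie algebra for which `Ψ_λ` is equivariant (`twistedAct_lie`, `psi_lie`). Dually, evaluation
at `1` is a lowest weight vector `q` of weight `-λ`, and the transpose of `Ψ_λ` sends `q` to
`v_λ^*`. The vectors `e_i^(α_i^∨(λ)+1) q` are singular. Modulo the submodule `K` that they generate,
the module generated by `q` is integrable, hence irreducible (`eq_bot_or_eq_lieSpan`, by the Casimir
operator), so the transpose has no kernel there beyond `K` (`lieSpan_inf_ker_le`). If `φ` satisfies
the equations, `K` vanishes at `φ`. Then evaluation at `φ` descends to `V(λ)^*`, that is, it is
given by a vector `w`. The functions `φ` and `Ψ_λ(w)` have the same iterated left derivatives at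
`1`, and a regular function on `N` is determined by these (`eq_zero_of_stable`).

For `κ`, a homomorphism from `V(ν)` is the same as a highest weight vector `t` of weight `ν` in
`V(λ) ⊗ V(μ)`. Such a tensor is an `𝔫`-equivariant map `V(μ)^* → V(λ)`, and it is determined by its
value `a` at the generator `v_μ^*`. Necessarily `a` has weight `ν-μ` and `e_i^(α_i^∨(μ)+1) a = 0`.
Conversely, for such `a` the matrix coefficients of `V(λ)^*` against `a` lie in the image of `Ψ_μ`,
which gives an equivariant map `V(λ)^* → V(μ)` whose transpose is the required one
(`exists_equivariant`). -/

/-- A submodule that is stable under a family of operators contains the components of each of its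
vectors with respect to distinct systems of simultaneous eigenvalues. -/
lemma mem_of_sum_mem_of_eigen {ι Γ M : Type*} [AddCommGroup M] [Module ℂ M]
    (T : ι → Module.End ℂ M) (c : Γ → ι → ℂ) (hc : Function.Injective c)
    (K : Submodule ℂ M) (hK : ∀ i, ∀ m ∈ K, T i m ∈ K) (s : Finset Γ) (w : Γ → M)
    (hw : ∀ γ ∈ s, ∀ i, T i (w γ) = c γ i • w γ) (hs : ∑ γ ∈ s, w γ ∈ K) :
    ∀ γ ∈ s, w γ ∈ K := by
  classical
  induction s using Finset.induction_on generalizing w with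
  | empty => simp
  | insert a s ha ih =>
    rw [Finset.sum_insert ha] at hs
    have key : ∀ γ ∈ s, w γ ∈ K := by
      intro γ hγ
      have hne : c γ ≠ c a := fun h => ha (hc h ▸ hγ)
      obtain ⟨i, hi⟩ := Function.ne_iff.1 hne
      -- The operator `T i - c a i` removes the `a`-component and multiplies `w γ` by the scalar `c
      -- γ i - c a i`, which is nonzero for the chosen `i`.
      have := ih (fun γ => (c γ i - c a i) • w γ)
        (fun δ hδ j => by
          rw [map_smul, hw δ (Finset.mem_insert_of_mem hδ), smul_comm]) (by
          have h1 := K.sub_mem (hK i _ hs) (K.smul_mem (c a i) hs)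
          rw [map_add, hw a (Finset.mem_insert_self _ _), map_sum,
            Finset.sum_congr rfl fun δ hδ => hw δ (Finset.mem_insert_of_mem hδ) i] at h1
          convert! h1 using 1
          simp only [sub_smul, Finset.sum_sub_distrib, smul_add, Finset.smul_sum]
          abel) γ hγ
      exact (K.smul_mem_iff (sub_ne_zero.2 hi)).1 this
    intro γ hγ
    rcases Finset.mem_insert.1 hγ with rfl | h
    · simpa using K.sub_mem hs (K.sum_mem key)
    · exact key γ h

/-! ### Opposite bases and the root space decomposition. -/

section RootSystem

variable {L : Type u} [LieRing L] [LieAlgebra ℂ L] [FiniteDimensional ℂ L]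
  [LieAlgebra.IsSemisimple ℂ L] {H : LieSubalgebra ℂ L} [H.IsCartanSubalgebra]

/-- The negative of a root. -/
def negRoot (α : H.root) : H.root :=
  ⟨-α.1, by
    have h := (Finset.mem_filter.1 α.2).2
    simpa using h⟩

@[simp] lemma coe_negRoot (α : H.root) : ((negRoot α : H.root) : LieModule.Weight ℂ H L) = -α.1 :=
  rfl

@[simp] lemma negRoot_negRoot (α : H.root) : negRoot (negRoot α) = α := by
  ext; simp

lemma root_negRoot (α : H.root) :
    (rootSystem H).root (negRoot α) = -(rootSystem H).root α := rfl

lemma negRoot_injective : Function.Injective (negRoot (H := H)) :=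
  Function.LeftInverse.injective negRoot_negRoot

lemma reflectionPerm_self_eq_negRoot (α : H.root) :
    (rootSystem H).reflectionPerm α α = negRoot α := by
  apply (rootSystem H).root.injective
  rw [RootPairing.root_reflectionPerm, RootPairing.reflection_apply_self, root_negRoot]

lemma isPos_negRoot (b : (rootSystem H).Base) (α : H.root) :
    b.IsPos (negRoot α) ↔ ¬ b.IsPos α := by
  rw [← reflectionPerm_self_eq_negRoot]
  exact RootPairing.Base.IsPos.neg_iff_not b α

/-- The base consisting of the negatives of the simple roots. -/
def oppBase (b : (rootSystem H).Base) : (rootSystem H).Base :=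
  RootPairing.Base.mk' (rootSystem H) (negRoot '' (b.support : Set H.root))
    (by
      have h1 : LinearIndependent ℂ fun i : b.support => (rootSystem H).root i :=
        b.linearIndepOn_root
      have h2 := h1.units_smul fun _ => (-1 : ℂˣ)
      rw [LinearIndepOn]
      let e : b.support ≃ (negRoot '' (b.support : Set H.root)) :=
        Equiv.Set.image _ _ negRoot_injective
      rw [← linearIndependent_equiv e]
      convert! h2 using 1
      funext i
      change (rootSystem H).root (negRoot i.1) = (-1 : ℂˣ) • (rootSystem H).root i.1
      rw [root_negRoot, Units.smul_def]
      simp)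
    (by
      intro i
      have key : ∀ x ∈ AddSubmonoid.closure ((rootSystem H).root '' b.support),
          -x ∈ AddSubmonoid.closure
            ((rootSystem H).root '' (negRoot '' (b.support : Set H.root))) := by
        intro x hx
        induction hx using AddSubmonoid.closure_induction with
        | mem x hx =>
          obtain ⟨j, hj, rfl⟩ := hx
          exact AddSubmonoid.subset_closure ⟨negRoot j, ⟨j, hj, rfl⟩, root_negRoot j⟩
        | zero => simp
        | add x y _ _ hx hy => rw [neg_add]; exact add_mem hx hy
      rcases b.root_mem_or_neg_mem i with h | h
      · exact Or.inr (key _ h)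
      · exact Or.inl (by simpa using key _ h))

lemma mem_oppBase_support (b : (rootSystem H).Base) (α : H.root) :
    α ∈ (oppBase b).support ↔ negRoot α ∈ b.support := by
  have : α ∈ (oppBase b).support ↔ α ∈ negRoot '' (b.support : Set H.root) := by
    simp [oppBase, RootPairing.Base.mk']
  rw [this]
  constructor
  · rintro ⟨j, hj, rfl⟩
    simpa using hj
  · intro h
    exact ⟨_, h, by simp⟩

/-- Positive roots are combinations of the simple roots. -/
lemma exists_nat_of_isPos (b : (rootSystem H).Base) {α : H.root} (hα : b.IsPos α) :
    ∃ f : b.support → ℕ, (rootSystem H).root α = ∑ j, f j • (rootSystem H).root (j : H.root) := by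
  obtain ⟨f, hf, h | h⟩ := b.exists_root_eq_sum_nat_or_neg α
  · refine ⟨fun j => f j, h.trans ?_⟩
    exact (Finset.sum_coe_sort b.support (fun j => f j • (rootSystem H).root j)).symm
  · exfalso
    have h1 : (rootSystem H).root α = ∑ j ∈ b.support, (-(f j : ℤ)) • (rootSystem H).root j := by
      rw [h]; simp
    have h2 := RootPairing.Base.height_eq_sum h1
    rw [RootPairing.Base.isPos_iff, h2] at hα
    have : ∑ j ∈ b.support, -(f j : ℤ) ≤ 0 := Finset.sum_nonpos fun j _ => by simp
    lia

/-- Passing to the negated base turns nonnegative coefficients into nonpositive ones, so the height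
changes sign. With this base, lowest weight vectors are treated as highest weight vectors and one
theory serves both. -/
lemma isPos_oppBase (b : (rootSystem H).Base) (α : H.root) :
    (oppBase b).IsPos α ↔ ¬ b.IsPos α := by
  have key : ∀ α : H.root, b.IsPos α → ¬ (oppBase b).IsPos α := by
    intro α hα
    obtain ⟨f, hf⟩ := exists_nat_of_isPos b hα
    classical
    have h1 : (rootSystem H).root α = ∑ j ∈ (oppBase b).support,
        (if h : negRoot j ∈ b.support then -(f ⟨negRoot j, h⟩ : ℤ) else 0) •
          (rootSystem H).root j := by
      rw [hf]
      refine Finset.sum_bij (fun j _ => negRoot j.1) (fun j _ => ?_) (fun i _ j _ h => ?_)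
        (fun j hj => ?_) fun j _ => ?_
      · rw [mem_oppBase_support, negRoot_negRoot]; exact j.2
      · exact Subtype.ext (negRoot_injective h)
      · rw [mem_oppBase_support] at hj
        exact ⟨⟨_, hj⟩, Finset.mem_univ _, negRoot_negRoot j⟩
      · simp only [negRoot_negRoot, j.2, dite_true, root_negRoot]
        simp
    rw [RootPairing.Base.isPos_iff, RootPairing.Base.height_eq_sum h1, not_lt]
    refine Finset.sum_nonpos fun j _ => ?_
    split_ifs <;> simp
  constructor
  · exact fun h h' => key α h' h
  · intro h
    have h1 := key _ ((isPos_negRoot b α).2 h)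
    rw [isPos_negRoot, not_not] at h1
    exact h1

/-- The Lie algebra is spanned by the Cartan subalgebra and the root spaces. -/
lemma eq_top_of_cartan_le_of_rootSpace_le (b : (rootSystem H).Base) (S : Submodule ℂ L)
    (h0 : H.toSubmodule ≤ S)
    (hpos : ∀ α : H.root, b.IsPos α → (rootSpace H α.1).toSubmodule ≤ S)
    (hneg : ∀ α : H.root, b.IsPos α → (rootSpace H (-α.1)).toSubmodule ≤ S) : S = ⊤ := by
  have h1 := LieModule.iSup_genWeightSpace_eq_top' ℂ H L
  have h2 := congrArg LieSubmodule.toSubmodule h1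
  rw [LieSubmodule.iSup_toSubmodule, LieSubmodule.top_toSubmodule] at h2
  rw [eq_top_iff, ← h2]
  refine iSup_le fun χ => ?_
  by_cases hχ : χ.IsZero
  · have : (χ : H → ℂ) = 0 := hχ
    rw [this]
    exact (le_of_eq (congrArg LieSubmodule.toSubmodule (rootSpace_zero_eq ℂ L H))).trans h0
  · let α : H.root := ⟨χ, by simpa using hχ⟩
    by_cases hα : b.IsPos α
    · exact hpos α hα
    · have := hneg (negRoot α) ((isPos_negRoot b α).2 hα)
      simpa [α] using this

end RootSystem

/-! ### The Casimir operator -/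

section Casimir

variable {L : Type u} [LieRing L] [LieAlgebra ℂ L] [FiniteDimensional ℂ L]
  [LieAlgebra.IsSemisimple ℂ L]

lemma killingForm_comm (x y : L) : killingForm ℂ L x y = killingForm ℂ L y x :=
  LieModule.traceForm_comm ℂ L L x y

lemma killingForm_lie_apply (x y z : L) :
    killingForm ℂ L ⁅x, y⁆ z = -killingForm ℂ L y ⁅x, z⁆ := by
  rw [← lie_skew, map_neg, LinearMap.neg_apply]
  exact congrArg _ (LieModule.traceForm_apply_lie_apply ℂ L L y x z)

lemma killingForm_ext {x y : L} (h : ∀ z, killingForm ℂ L x z = killingForm ℂ L y z) : x = y := by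
  rw [← sub_eq_zero, ← Submodule.mem_bot (R := ℂ), ← IsKilling.ker_killingForm_eq_bot ℂ L,
    LinearMap.mem_ker]
  ext z
  simp [h z]

/-- Families that are dual to each other for the Killing form are so on both sides. -/
lemma dual_family_symm {ι : Type*} [Fintype ι] {u v : ι → L}
    (h : ∀ x, x = ∑ k, killingForm ℂ L x (v k) • u k) (x : L) :
    x = ∑ k, killingForm ℂ L x (u k) • v k := by
  apply killingForm_ext
  intro z
  conv_lhs => rw [killingForm_comm, h z]
  simp only [map_sum, map_smul, LinearMap.sum_apply, LinearMap.smul_apply, smul_eq_mul]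
  refine Finset.sum_congr rfl fun k _ => ?_
  rw [mul_comm, killingForm_comm (u k) x, killingForm_comm z]

variable {M : Type*} [AddCommGroup M] [Module ℂ M] [LieRingModule L M] [LieModule ℂ L M]

/-- The Casimir operator commutes with the action of the Lie algebra. -/
lemma casimir_comm {ι : Type*} [Fintype ι] {u v : ι → L}
    (h : ∀ x, x = ∑ k, killingForm ℂ L x (v k) • u k) (x : L) (m : M) :
    ⁅x, ∑ k, ⁅u k, ⁅v k, m⁆⁆⁆ = ∑ k, ⁅u k, ⁅v k, ⁅x, m⁆⁆⁆ := by
  have h' := dual_family_symm h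
  have h1 : ∀ k, ⁅x, ⁅u k, ⁅v k, m⁆⁆⁆ =
      ⁅u k, ⁅v k, ⁅x, m⁆⁆⁆ + (⁅⁅x, u k⁆, ⁅v k, m⁆⁆ + ⁅u k, ⁅⁅x, v k⁆, m⁆⁆) := by
    intro k
    rw [leibniz_lie x (u k), leibniz_lie x (v k), lie_add]
    abel
  rw [lie_sum, Finset.sum_congr rfl fun k _ => h1 k, Finset.sum_add_distrib, add_eq_left,
    Finset.sum_add_distrib]
  have h2 : ∑ k, ⁅⁅x, u k⁆, ⁅v k, m⁆⁆ =
      ∑ k, ∑ l, killingForm ℂ L ⁅x, u k⁆ (v l) • ⁅u l, ⁅v k, m⁆⁆ := by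
    refine Finset.sum_congr rfl fun k _ => ?_
    conv_lhs => rw [h ⁅x, u k⁆]
    rw [sum_lie]; simp only [smul_lie]
  have h3 : ∑ k, ⁅u k, ⁅⁅x, v k⁆, m⁆⁆ =
      ∑ k, ∑ l, killingForm ℂ L ⁅x, v k⁆ (u l) • ⁅u k, ⁅v l, m⁆⁆ := by
    refine Finset.sum_congr rfl fun k _ => ?_
    conv_lhs => rw [h' ⁅x, v k⁆]
    rw [sum_lie, lie_sum]; simp only [smul_lie, lie_smul]
  -- The two coefficients of `⁅u l, ⁅v k, m⁆⁆` cancel by invariance of the Killing form.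
  rw [h2, h3, Finset.sum_comm, ← Finset.sum_add_distrib]
  refine Finset.sum_eq_zero fun l _ => ?_
  rw [← Finset.sum_add_distrib]
  refine Finset.sum_eq_zero fun k _ => ?_
  rw [← add_smul, killingForm_lie_apply, killingForm_comm (u k)]
  simp

variable {H : LieSubalgebra ℂ L} [H.IsCartanSubalgebra]

/-- The element of the Cartan subalgebra that corresponds to a weight. -/
abbrev dualElt (χ : Dual ℂ H) : H := (cartanEquivDual H).symm χ

lemma killingForm_dualElt (χ : Dual ℂ H) (h : H) :
    killingForm ℂ L (dualElt χ : L) (h : L) = χ h := by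
  have : cartanEquivDual H ((cartanEquivDual H).symm χ) h = χ h := by
    rw [LinearEquiv.apply_symm_apply]
  exact this

lemma apply_dualElt_comm (χ ψ : Dual ℂ H) : χ (dualElt ψ) = ψ (dualElt χ) := by
  rw [← killingForm_dualElt, ← killingForm_dualElt, killingForm_comm]

lemma killingForm_rootSpace_eq_zero {α β : H → ℂ} {x y : L} (hx : x ∈ rootSpace H α)
    (hy : y ∈ rootSpace H β) (h : α + β ≠ 0) : killingForm ℂ L x y = 0 :=
  killingForm_apply_eq_zero_of_mem_rootSpace_of_add_ne_zero ℂ L H hx hy h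

lemma mem_rootSpace_zero (h : H) : (h : L) ∈ rootSpace H (0 : H → ℂ) := by
  rw [rootSpace_zero_eq]; exact h.2

lemma root_ne_zero (α : H.root) : (α.1 : H → ℂ) ≠ 0 := by
  have h := (Finset.mem_filter.1 α.2).2
  exact h

/-- Root vectors that are dual for the Killing form. -/
lemma exists_dual_rootVectors (α : H.root) : ∃ e ∈ rootSpace H α.1, ∃ f ∈ rootSpace H (-α.1),
    killingForm ℂ L e f = 1 ∧ (∀ x ∈ rootSpace H α.1, x = killingForm ℂ L x f • e) ∧
    ∀ y ∈ rootSpace H (-α.1), y = killingForm ℂ L y e • f := by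
  have hα : α.1.IsNonZero := (Finset.mem_filter.1 α.2).2
  obtain ⟨e, he, he0⟩ := α.1.exists_ne_zero
  obtain ⟨f', hf', hf⟩ : ∃ f ∈ rootSpace H (-α.1), killingForm ℂ L e f ≠ 0 := by
    by_contra! h
    apply he0
    simpa using mem_ker_killingForm_of_mem_rootSpace_of_forall_rootSpace_neg ℂ L H he h
  have hf0 : f' ≠ 0 := by rintro rfl; simp at hf
  have key : ∀ β : LieModule.Weight ℂ H L, β.IsNonZero → ∀ e ∈ rootSpace H β, e ≠ 0 →
      ∀ x ∈ rootSpace H β, ∃ c : ℂ, x = c • e := by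
    intro β hβ e he he0 x hx
    have h1 := finrank_rootSpace_eq_one β hβ
    obtain ⟨c, hc⟩ := (finrank_eq_one_iff_of_nonzero' (⟨e, he⟩ : rootSpace H β)
      (fun h => he0 (congrArg Subtype.val h))).1 h1 ⟨x, hx⟩
    exact ⟨c, (congrArg Subtype.val hc).symm⟩
  refine ⟨e, he, (killingForm ℂ L e f')⁻¹ • f', (rootSpace H _).smul_mem _ hf', ?_, ?_, ?_⟩
  · simp [hf]
  · intro x hx
    obtain ⟨c, rfl⟩ := key α.1 hα e he he0 x hx
    congr 1
    simp only [map_smul, LinearMap.smul_apply, smul_eq_mul]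
    field_simp
  · intro y hy
    obtain ⟨c, rfl⟩ := key (-α.1) hα.neg f' (by simpa using hf') hf0 y (by simpa using hy)
    simp [killingForm_comm f' e, smul_smul, hf]

open Classical in
/-- The value of the Casimir operator on a highest weight vector of weight `χ`. -/
def casimirScalar (b : (rootSystem H).Base) (χ : Dual ℂ H) : ℂ :=
  χ (dualElt χ) + ∑ α : {α : H.root // b.IsPos α}, χ (dualElt ((rootSystem H).root α.1))

/-- There is an operator commuting with the action of the Lie algebra that is known on all highest
weight vectors. -/
lemma exists_casimir (b : (rootSystem H).Base) : ∃ Ω : Module.End ℂ M,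
    (∀ (x : L) (m : M), Ω ⁅x, m⁆ = ⁅x, Ω m⁆) ∧
    ∀ (χ : Dual ℂ H) (m : M), (∀ h : H, ⁅(h : L), m⁆ = χ h • m) →
      (∀ α : H.root, b.IsPos α → ∀ x ∈ rootSpace H α.1, ⁅x, m⁆ = 0) →
      Ω m = casimirScalar b χ • m := by
  classical
  choose e he f hf hef hxe hyf using exists_dual_rootVectors (H := H)
  let B := finBasis ℂ H
  have hB : (LieModule.traceForm ℂ H L).Nondegenerate := traceForm_cartan_nondegenerate ℂ L H
  let B' := LinearMap.BilinForm.dualBasis (LieModule.traceForm ℂ H L) hB B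
  have hBB' : ∀ h : H, h = ∑ j, killingForm ℂ L (h : L) (B' j : L) • B j := by
    intro h
    have h1 : LinearMap.BilinForm.dualBasis (LieModule.traceForm ℂ H L) hB B' = B :=
      LinearMap.BilinForm.dualBasis_dualBasis hB ⟨LieModule.traceForm_comm ℂ H L⟩ B
    conv_lhs => rw [← B.sum_repr h]
    refine Finset.sum_congr rfl fun j _ => ?_
    congr 1
    rw [← h1, LinearMap.BilinForm.dualBasis_repr_apply]
    rfl
  have hBB'' : ∀ h : H, h = ∑ j, killingForm ℂ L (h : L) (B j : L) • B' j := by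
    intro h
    conv_lhs => rw [← B'.sum_repr h]
    refine Finset.sum_congr rfl fun j _ => ?_
    congr 1
    rw [LinearMap.BilinForm.dualBasis_repr_apply]
    rfl
  let P := {α : H.root // b.IsPos α}
  let u : Fin (finrank ℂ H) ⊕ (P ⊕ P) → L :=
    Sum.elim (fun j => (B j : L)) (Sum.elim (fun α => e α.1) (fun α => f α.1))
  let v : Fin (finrank ℂ H) ⊕ (P ⊕ P) → L :=
    Sum.elim (fun j => (B' j : L)) (Sum.elim (fun α => f α.1) (fun α => e α.1))
  -- The identity is linear in `x`, so it suffices to check it on `H` and on the root spaces. Root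
  -- spaces that are not opposite are orthogonal, and this leaves only the `H`-part or a single
  -- term.
  have huv : ∀ x, x = ∑ k, killingForm ℂ L x (v k) • u k := by
    let Φ : Module.End ℂ L := ∑ k, ((killingForm ℂ L).flip (v k)).smulRight (u k)
    have hΦ : ∀ x, Φ x = ∑ k, killingForm ℂ L x (v k) • u k := fun x => by simp [Φ]
    have h0 : ∀ (h : H) (β : H.root) (x : L), x ∈ rootSpace H β.1 →
        killingForm ℂ L (h : L) x = 0 := fun h β x hx =>
      killingForm_rootSpace_eq_zero (mem_rootSpace_zero h) hx (by simp)
    have h0' : ∀ (h : H) (β : H.root) (x : L), x ∈ rootSpace H (-β.1) →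
        killingForm ℂ L (h : L) x = 0 := fun h β x hx =>
      killingForm_rootSpace_eq_zero (mem_rootSpace_zero h) hx (by simp)
    have hpp : ∀ (α β : P) (x y : L), x ∈ rootSpace H α.1.1 → y ∈ rootSpace H β.1.1 →
        killingForm ℂ L x y = 0 := by
      intro α β x y hx hy
      refine killingForm_rootSpace_eq_zero hx hy fun h => ?_
      have h1 : β.1 = negRoot α.1 := by
        apply Subtype.ext
        apply DFunLike.coe_injective
        exact eq_neg_of_add_eq_zero_right h
      exact (isPos_negRoot b α.1).1 (h1 ▸ β.2) α.2
    have hnn : ∀ (α β : P) (x y : L), x ∈ rootSpace H (-α.1.1) → y ∈ rootSpace H (-β.1.1) →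
        killingForm ℂ L x y = 0 := by
      intro α β x y hx hy
      refine killingForm_rootSpace_eq_zero hx hy fun h => ?_
      have h1 : β.1 = negRoot α.1 := by
        apply Subtype.ext
        apply DFunLike.coe_injective
        have : (α.1.1 : H → ℂ) + β.1.1 = 0 := by rw [← neg_eq_zero, ← h]; abel
        exact eq_neg_of_add_eq_zero_right this
      exact (isPos_negRoot b α.1).1 (h1 ▸ β.2) α.2
    have hpn : ∀ (α β : P) (x y : L), α ≠ β → x ∈ rootSpace H α.1.1 → y ∈ rootSpace H (-β.1.1) →
        killingForm ℂ L x y = 0 := by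
      intro α β x y hne hx hy
      refine killingForm_rootSpace_eq_zero hx hy fun h => hne ?_
      apply Subtype.ext
      apply Subtype.ext
      apply DFunLike.coe_injective
      exact add_neg_eq_zero.1 h
    have htop : LinearMap.ker (LinearMap.id - Φ) = ⊤ := by
      refine eq_top_of_cartan_le_of_rootSpace_le b _ ?_ ?_ ?_
      · intro x hx
        lift x to H using hx
        simp only [LinearMap.mem_ker, LinearMap.sub_apply, LinearMap.id_apply, hΦ, u, v,
          Fintype.sum_sum_type, Sum.elim_inl, Sum.elim_inr, h0 x _ _ (he _), h0' x _ _ (hf _)]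
        have := congrArg Subtype.val (hBB' x)
        simp only [zero_smul, Finset.sum_const_zero, add_zero]
        rw [sub_eq_zero]
        exact this.trans (by simp)
      · intro α hα x hx
        simp only [LinearMap.mem_ker, LinearMap.sub_apply, LinearMap.id_apply, hΦ, u, v,
          Fintype.sum_sum_type, Sum.elim_inl, Sum.elim_inr]
        have h1 : ∀ j, killingForm ℂ L x (B' j : L) = 0 := fun j => by
          rw [killingForm_comm]; exact h0 _ α _ hx
        have h2 : ∀ β : P, killingForm ℂ L x (e β.1) = 0 := fun β =>
          hpp ⟨α, hα⟩ β _ _ hx (he _)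
        rw [Finset.sum_eq_single_of_mem (⟨α, hα⟩ : P) (Finset.mem_univ _)
          fun β _ hβ => by rw [hpn ⟨α, hα⟩ β _ _ hβ.symm hx (hf _), zero_smul]]
        simp only [h1, h2, zero_smul, Finset.sum_const_zero, add_zero, zero_add]
        exact sub_eq_zero.2 (hxe α x hx)
      · intro α hα x hx
        simp only [LinearMap.mem_ker, LinearMap.sub_apply, LinearMap.id_apply, hΦ, u, v,
          Fintype.sum_sum_type, Sum.elim_inl, Sum.elim_inr]
        have h1 : ∀ j, killingForm ℂ L x (B' j : L) = 0 := fun j => by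
          rw [killingForm_comm]; exact h0' _ α _ hx
        have h2 : ∀ β : P, killingForm ℂ L x (f β.1) = 0 := fun β =>
          hnn ⟨α, hα⟩ β _ _ hx (hf _)
        rw [Finset.sum_eq_single_of_mem (s := Finset.univ) (f := fun β : P =>
            killingForm ℂ L x (e β.1) • f β.1) (⟨α, hα⟩ : P) (Finset.mem_univ _)
          fun β _ hβ => by
            rw [killingForm_comm, hpn β ⟨α, hα⟩ _ _ hβ (he _) hx, zero_smul]]
        simp only [h1, h2, zero_smul, Finset.sum_const_zero, zero_add]
        exact sub_eq_zero.2 (hyf α x hx)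
    intro x
    have hx : x ∈ LinearMap.ker (LinearMap.id - Φ) := htop ▸ Submodule.mem_top
    rw [LinearMap.mem_ker, LinearMap.sub_apply, sub_eq_zero] at hx
    exact hx.trans (hΦ x)
  refine ⟨∑ k, LieModule.toEnd ℂ L M (u k) * LieModule.toEnd ℂ L M (v k), fun x m => ?_,
    fun χ m hm hm' => ?_⟩
  · simpa using (casimir_comm huv x m).symm
  · simp only [u, v, Fintype.sum_sum_type, Sum.elim_inl, Sum.elim_inr]
    simp only [LinearMap.add_apply, LinearMap.sum_apply, Module.End.mul_apply,
      LieModule.toEnd_apply_apply, hm, lie_smul]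
    have h1 : ∀ α : P, ⁅f α.1, ⁅e α.1, m⁆⁆ = 0 := fun α => by
      rw [hm' α.1 α.2 _ (he _), lie_zero]
    -- Because `e` and `f` pair to `1`, their bracket is the element of `H` dual to the root, and it
    -- acts on `m` by a scalar.
    have h2 : ∀ α : P, ⁅e α.1, ⁅f α.1, m⁆⁆ = χ (dualElt ((rootSystem H).root α.1)) • m := by
      intro α
      rw [leibniz_lie, hm' α.1 α.2 _ (he _), lie_zero, add_zero,
        lie_eq_killingForm_smul_of_mem_rootSpace_of_mem_rootSpace_neg (he _) (hf _), hef, one_smul]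
      exact hm _
    simp only [h1, h2, Finset.sum_const_zero, add_zero, smul_smul, ← Finset.sum_smul, ← add_smul]
    congr 1
    rw [casimirScalar]
    congr 1
    conv_rhs => rw [hBB' (dualElt χ)]
    simp only [map_sum, map_smul, smul_eq_mul, killingForm_dualElt]

end Casimir

/-! ### Positivity of the Killing form on coroots and separation of dominant weights by the Casimir
scalar. -/

section Positivity

variable {L : Type u} [LieRing L] [LieAlgebra ℂ L] [FiniteDimensional ℂ L]
  [LieAlgebra.IsSemisimple ℂ L] {H : LieSubalgebra ℂ L} [H.IsCartanSubalgebra]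

/-- The element of `H` dual to a root is a positive multiple of the coroot. -/
lemma exists_dualElt_root_eq (α : H.root) : ∃ r : ℝ, 0 < r ∧
    dualElt ((rootSystem H).root α) = (r : ℂ) • (rootSystem H).coroot α := by
  have hα : α.1.IsNonZero := (Finset.mem_filter.1 α.2).2
  set a : ℂ := α.1 (dualElt ((rootSystem H).root α)) with ha
  have ha0 : a ≠ 0 := root_apply_cartanEquivDual_symm_ne_zero hα
  have h1 : (rootSystem H).coroot α = (2 * a⁻¹) • dualElt ((rootSystem H).root α) := by
    change 2 • a⁻¹ • dualElt ((rootSystem H).root α) = _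
    rw [mul_smul, two_smul, two_smul]
  have h2 : LieModule.traceForm ℂ H L (coroot α.1) (coroot α.1) = 4 * a⁻¹ := by
    rw [traceForm_coroot, root_apply_coroot hα]
    change 2 • a⁻¹ • (2 : ℂ) = _
    simp only [nsmul_eq_mul, smul_eq_mul]
    push_cast
    ring
  -- The Killing form at a coroot is the sum of the squares of its integral pairings with the roots.
  -- This forces the nonzero number `a` to be real and positive.
  have h3 : ∃ s : ℝ, 0 ≤ s ∧ LieModule.traceForm ℂ H L (coroot α.1) (coroot α.1) = s := by
    have h4 := LinearMap.congr_fun₂ (restrict_killingForm_eq_sum (K := ℂ) (H := H))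
      (coroot α.1) (coroot α.1)
    rw [restrict_killingForm] at h4
    rw [h4]
    refine ⟨∑ β ∈ H.root, ((LieModule.chainBotCoeff α.1 β - LieModule.chainTopCoeff α.1 β : ℤ) : ℝ) ^ 2,
      Finset.sum_nonneg fun _ _ => sq_nonneg _, ?_⟩
    rw [LinearMap.sum_apply, LinearMap.sum_apply, Complex.ofReal_sum]
    refine Finset.sum_congr rfl fun β _ => ?_
    have h5 := apply_coroot_eq_cast α.1 β
    rw [LinearMap.smulRight_apply, LinearMap.smul_apply, smul_eq_mul]
    change β (coroot α.1) * β (coroot α.1) = _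
    rw [h5]
    push_cast
    ring
  obtain ⟨s, hs, h3⟩ := h3
  have hs0 : s ≠ 0 := by
    rintro rfl
    rw [h2] at h3
    simp [ha0] at h3
  refine ⟨2 / s, by positivity, ?_⟩
  rw [h1, smul_smul]
  have hsC : (s : ℂ) = 4 * a⁻¹ := by rw [← h3, h2]
  push_cast
  rw [hsC]
  have : (2 / (4 * a⁻¹) * (2 * a⁻¹) : ℂ) = 1 := by field_simp; norm_num
  rw [this, one_smul]

open Classical in
/-- The sum of the positive roots takes the value `2` on each simple coroot. -/
lemma sum_pos_root_apply_coroot (b : (rootSystem H).Base) (i : H.root) (hi : i ∈ b.support) :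
    ∑ α : {α : H.root // b.IsPos α}, (rootSystem H).root α.1 ((rootSystem H).coroot i) = 2 := by
  let F : H.root → ℂ := fun α => (rootSystem H).root α ((rootSystem H).coroot i)
  have hii : F i = 2 := root_apply_coroot (Finset.mem_filter.1 i.2).2
  have h1 : ∑ α : {α : H.root // b.IsPos α}, F α.1 = ∑ α with b.IsPos α, F α :=
    (Finset.sum_subtype _ (by simp) F).symm
  have hmem : i ∈ Finset.univ.filter (fun α => b.IsPos α) := by
    simpa using RootPairing.Base.isPos_of_mem_support hi
  have hrefl : ∀ α, F ((rootSystem H).reflectionPerm i α) = -F α := by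
    intro α
    simp only [F]
    rw [RootPairing.root_reflectionPerm, RootPairing.reflection_apply]
    have : ((rootSystem H).root i) ((rootSystem H).coroot i) = 2 := hii
    simp only [LinearMap.sub_apply, LinearMap.smul_apply, smul_eq_mul, this]
    change _ - (rootSystem H).root α ((rootSystem H).coroot i) * 2 = _
    ring
  -- The reflection at the simple root `i` permutes the other positive roots and reverses the sign
  -- of their pairing with the coroot of `i`, so those pairings add up to zero.
  have h2 : ∑ α ∈ (Finset.univ.filter (fun α => b.IsPos α)).erase i, F α =
      ∑ α ∈ (Finset.univ.filter (fun α => b.IsPos α)).erase i, -F α := by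
    refine Finset.sum_bij' (fun α _ => (rootSystem H).reflectionPerm i α)
      (fun α _ => (rootSystem H).reflectionPerm i α) ?_ ?_ ?_ ?_ ?_
    · intro α hα
      simp only [Finset.mem_erase, Finset.mem_filter, Finset.mem_univ, true_and] at hα ⊢
      have hpos := hα.2.reflectionPerm hi hα.1
      refine ⟨fun h => ?_, hpos⟩
      have h3 := congrArg ((rootSystem H).reflectionPerm i) h
      rw [RootPairing.reflectionPerm_self, reflectionPerm_self_eq_negRoot] at h3
      rw [h3, isPos_negRoot] at hα
      exact hα.2 (RootPairing.Base.isPos_of_mem_support hi)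
    · intro α hα
      simp only [Finset.mem_erase, Finset.mem_filter, Finset.mem_univ, true_and] at hα ⊢
      have hpos := hα.2.reflectionPerm hi hα.1
      refine ⟨fun h => ?_, hpos⟩
      have h3 := congrArg ((rootSystem H).reflectionPerm i) h
      rw [RootPairing.reflectionPerm_self, reflectionPerm_self_eq_negRoot] at h3
      rw [h3, isPos_negRoot] at hα
      exact hα.2 (RootPairing.Base.isPos_of_mem_support hi)
    · intro α _; exact RootPairing.reflectionPerm_self _ _ _
    · intro α _; exact RootPairing.reflectionPerm_self _ _ _
    · intro α _; rw [hrefl, neg_neg]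
  rw [h1, ← Finset.add_sum_erase _ _ hmem, hii]
  rw [Finset.sum_neg_distrib, self_eq_neg] at h2
  rw [h2, add_zero]

/-- The Casimir scalars separate a dominant weight from the dominant weights below it. -/
lemma eq_zero_of_casimirScalar_eq (b : (rootSystem H).Base) {χ ψ : Dual ℂ H}
    (n : b.support → ℕ) (hn : χ = ψ + ∑ j, n j • (rootSystem H).root (j : H.root))
    (hχ : ∀ i : b.support, ∃ k : ℕ, χ ((rootSystem H).coroot (i : H.root)) = k)
    (hψ : ∀ i : b.support, ∃ k : ℕ, ψ ((rootSystem H).coroot (i : H.root)) = k)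
    (h : casimirScalar b χ = casimirScalar b ψ) : n = 0 := by
  classical
  choose r hr0 hr using exists_dualElt_root_eq (H := H)
  choose k hk using hχ
  choose l hl using hψ
  set β : Dual ℂ H := ∑ j, n j • (rootSystem H).root (j : H.root) with hβ
  have hβt : dualElt β = ∑ j, ((n j : ℂ) * r j) • (rootSystem H).coroot (j : H.root) := by
    simp only [hβ, dualElt, map_sum, map_nsmul]
    refine Finset.sum_congr rfl fun j _ => ?_
    rw [mul_smul, ← hr, Nat.cast_smul_eq_nsmul]
  -- This is `(χ+ρ, χ+ρ) - (ψ+ρ, ψ+ρ) = (χ+ψ+2ρ, χ-ψ)`, with `2ρ` the sum of the positive roots.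
  have h1 : casimirScalar b χ - casimirScalar b ψ =
      (χ + ψ + ∑ α : {α : H.root // b.IsPos α}, (rootSystem H).root α.1) (dualElt β) := by
    have e1 : ∀ ξ : Dual ℂ H, casimirScalar b ξ = ξ (dualElt ξ) +
        (∑ α : {α : H.root // b.IsPos α}, (rootSystem H).root α.1) (dualElt ξ) := by
      intro ξ
      rw [casimirScalar, LinearMap.sum_apply]
      congr 1
      exact Finset.sum_congr rfl fun α _ => apply_dualElt_comm _ _
    have e2 : dualElt χ = dualElt ψ + dualElt β := by rw [hn]; exact map_add _ _ _
    have e3 : χ (dualElt ψ) = ψ (dualElt χ) := apply_dualElt_comm _ _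
    have e4 : dualElt β = dualElt χ - dualElt ψ := by rw [e2]; abel
    rw [e1, e1, e4]
    simp only [LinearMap.add_apply, map_sub, e3]
    ring
  -- Each summand is real and nonnegative. The constant `2` from `2ρ` keeps the last factor positive
  -- even where both weights vanish on the coroot, so every `n j` must vanish.
  have h2 : (0 : ℂ) = ∑ j, ((n j * r j * (k j + l j + 2) : ℝ) : ℂ) := by
    rw [← sub_eq_zero.2 h, h1, hβt, map_sum]
    refine Finset.sum_congr rfl fun j _ => ?_
    rw [map_smul, LinearMap.add_apply, LinearMap.add_apply, hk, hl, LinearMap.sum_apply,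
      sum_pos_root_apply_coroot b j j.2]
    push_cast
    rfl
  rw [← Complex.ofReal_sum, eq_comm, Complex.ofReal_eq_zero, Finset.sum_eq_zero_iff_of_nonneg
    (fun j _ => mul_nonneg (mul_nonneg (Nat.cast_nonneg _) (hr0 _).le) (by positivity))] at h2
  funext j
  have h3 := h2 j (Finset.mem_univ _)
  have h4 : (0 : ℝ) < k j + l j + 2 := by positivity
  have h5 : r j ≠ 0 := (hr0 _).ne'
  simpa [h4.ne', h5] using h3

end Positivity

/-! ### Highest weight modules -/

section HighestWeight

attribute [local instance] LieRing.ofAssociativeRing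

variable {L : Type u} [LieRing L] [LieAlgebra ℂ L] [FiniteDimensional ℂ L]
  [LieAlgebra.IsSemisimple ℂ L] {H : LieSubalgebra ℂ L} [H.IsCartanSubalgebra]
  {M : Type*} [AddCommGroup M] [Module ℂ M] [LieRingModule L M] [LieModule ℂ L M]

/-- The simultaneous eigenspaces of the Cartan subalgebra. -/
def eigenWeightSpace (H : LieSubalgebra ℂ L) (M : Type*) [AddCommGroup M] [Module ℂ M]
    [LieRingModule L M] [LieModule ℂ L M] (χ : Dual ℂ H) : Submodule ℂ M where
  carrier := {m | ∀ h : H, ⁅(h : L), m⁆ = χ h • m}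
  zero_mem' := by simp
  add_mem' := fun {m m'} hm hm' h => by rw [lie_add, hm h, hm' h, smul_add]
  smul_mem' := fun c m hm h => by rw [lie_smul, hm h, smul_comm]

lemma lie_mem_eigenWeightSpace {χ α : Dual ℂ H} {m : M} (hm : m ∈ eigenWeightSpace H M χ) {x : L}
    (hx : x ∈ rootSpace H (α : H → ℂ)) : ⁅x, m⁆ ∈ eigenWeightSpace H M (χ + α) := by
  intro h
  have h1 : ⁅(h : L), x⁆ = α h • x := lie_eq_smul_of_mem_rootSpace hx h
  rw [leibniz_lie, h1, hm h, smul_lie, lie_smul, ← add_smul, LinearMap.add_apply, add_comm]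

lemma eq_of_mem_eigenWeightSpace {χ ψ : Dual ℂ H} {m : M} (hm : m ≠ 0)
    (h1 : m ∈ eigenWeightSpace H M χ) (h2 : m ∈ eigenWeightSpace H M ψ) : χ = ψ := by
  ext h
  have := (h1 h).symm.trans (h2 h)
  exact smul_left_injective ℂ hm this

/-- A submodule that is stable under the Cartan subalgebra contains the weight components of its
elements. -/
lemma mem_of_sum_mem_of_eigenWeightSpace {Γ : Type*} (γ : Γ → Dual ℂ H)
    (hγ : Function.Injective γ) (K : Submodule ℂ M) (hK : ∀ h : H, ∀ m ∈ K, ⁅(h : L), m⁆ ∈ K)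
    (s : Finset Γ) (w : Γ → M) (hw : ∀ i ∈ s, w i ∈ eigenWeightSpace H M (γ i))
    (hs : ∑ i ∈ s, w i ∈ K) : ∀ i ∈ s, w i ∈ K :=
  mem_of_sum_mem_of_eigen (fun h : H => LieModule.toEnd ℂ L M (h : L)) (fun i h => γ i h)
    (fun _ _ h => hγ (LinearMap.ext fun x => congrFun h x)) K hK s w (fun i hi h => hw i hi h) hs

lemma exists_sl2Triple (α : H.root) : ∃ e ∈ rootSpace H α.1, ∃ f ∈ rootSpace H (-α.1),
    IsSl2Triple ((rootSystem H).coroot α : L) e f := by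
  have hα : α.1.IsNonZero := (Finset.mem_filter.1 α.2).2
  obtain ⟨h, e, f, t, he, hf⟩ := exists_isSl2Triple_of_weight_isNonZero hα
  have := t.h_eq_coroot hα he hf
  subst this
  exact ⟨e, he, f, hf, t⟩

/-- The eigenvalue of a primitive vector is a natural number if `f` is nilpotent on it. -/
lemma exists_nat_of_pow_toEnd_f_eq_zero {h e f : L} {t : IsSl2Triple h e f} {m : M} {μ : ℂ}
    (P : t.HasPrimitiveVectorWith m μ)
    (hk : ∃ k, (LieModule.toEnd ℂ L M f ^ k) m = 0) : ∃ n : ℕ, μ = n := by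
  obtain ⟨n, hn₁, hn₂⟩ := Nat.exists_not_and_succ_of_not_zero_of_exists
    (p := fun k => (LieModule.toEnd ℂ L M f ^ k) m = 0) (by simpa using P.ne_zero) hk
  refine ⟨n, ?_⟩
  -- In `e f^(n+1) m = (n+1)(μ-n) f^n m` the left side vanishes and `f^n m` does not. Only
  -- nilpotency on `m` is needed, not finite dimension.
  have := P.lie_e_pow_succ_toEnd_f n
  rw [hn₂, lie_zero, eq_comm, smul_eq_zero_iff_left hn₁, mul_eq_zero, sub_eq_zero] at this
  exact this.resolve_left <| Nat.cast_add_one_ne_zero n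

/-- A highest weight vector of weight `χ` for a base `b`. -/
structure IsHighestWeightVector (b : (rootSystem H).Base) (χ : Dual ℂ H) (q : M) : Prop where
  mem : q ∈ eigenWeightSpace H M χ
  lie_pos : ∀ α : H.root, b.IsPos α → ∀ x ∈ rootSpace H α.1, ⁅x, q⁆ = 0

/-- The vectors obtained from `q` by applying negative root vectors, with their depths. -/
inductive IsLoweringWord (b : (rootSystem H).Base) (q : M) : (b.support → ℕ) → M → Prop
  | base : IsLoweringWord b q 0 q
  | step {n : b.support → ℕ} {m : M} (f : b.support → ℕ) (α : H.root) (y : L) :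
      IsLoweringWord b q n m → b.IsPos α →
      (rootSystem H).root α = ∑ j, f j • (rootSystem H).root (j : H.root) →
      y ∈ rootSpace H (-α.1) → IsLoweringWord b q (n + f) ⁅y, m⁆

/-- The span of the vectors obtained from `q` by applying negative root vectors. -/
def loweringSpan (b : (rootSystem H).Base) (q : M) (n : b.support → ℕ) : Submodule ℂ M :=
  Submodule.span ℂ {m | IsLoweringWord b q n m}

variable {b : (rootSystem H).Base} {χ : Dual ℂ H} {q : M}

lemma lie_mem_iSup_loweringSpan {α : H.root} (hα : b.IsPos α) {y : L}
    (hy : y ∈ rootSpace H (-α.1)) {m : M} (hm : m ∈ ⨆ n, loweringSpan b q n) :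
    ⁅y, m⁆ ∈ ⨆ n, loweringSpan b q n := by
  induction hm using Submodule.iSup_induction' with
  | mem n m hm =>
    induction hm using Submodule.span_induction with
    | mem m hm =>
      obtain ⟨f, hf⟩ := exists_nat_of_isPos b hα
      exact Submodule.mem_iSup_of_mem (n + f)
        (Submodule.subset_span (IsLoweringWord.step f α y hm hα hf hy))
    | zero => simp
    | add m m' _ _ h h' => rw [lie_add]; exact add_mem h h'
    | smul c m _ h => rw [lie_smul]; exact Submodule.smul_mem _ c h
  | zero => simp
  | add m m' _ _ h h' => rw [lie_add]; exact add_mem h h'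

/-- A Lie algebra element is moved inwards past the outermost letter of the word by the Leibniz
rule. Quantifying over all `z` in the induction absorbs the commutators that arise, and the empty
word is handled by the root space decomposition. This stands in for the PBW theorem. -/
lemma IsHighestWeightVector.lie_mem_iSup_loweringSpan (hq : IsHighestWeightVector b χ q)
    {n : b.support → ℕ} {m : M} (hm : IsLoweringWord b q n m) (z : L) :
    ⁅z, m⁆ ∈ ⨆ n, loweringSpan b q n := by
  induction hm generalizing z with
  | base =>
    have hq0 : q ∈ ⨆ n, loweringSpan b q n :=
      Submodule.mem_iSup_of_mem 0 (Submodule.subset_span IsLoweringWord.base)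
    have h1 : (⨆ n, loweringSpan b q n).comap ((LieModule.toEnd ℂ L M).toLinearMap.flip q) = ⊤ := by
      refine eq_top_of_cartan_le_of_rootSpace_le b _ ?_ ?_ ?_
      · intro h hh
        have := hq.mem ⟨h, hh⟩
        change ⁅h, q⁆ ∈ ⨆ n, loweringSpan b q n
        rw [this]
        exact Submodule.smul_mem _ _ hq0
      · intro α hα x hx
        change ⁅x, q⁆ ∈ ⨆ n, loweringSpan b q n
        rw [hq.lie_pos α hα x hx]
        exact zero_mem _
      · intro α hα x hx
        exact _root_.lie_mem_iSup_loweringSpan hα hx hq0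
    have h2 : z ∈ (⨆ n, loweringSpan b q n).comap
      ((LieModule.toEnd ℂ L M).toLinearMap.flip q) := h1 ▸ Submodule.mem_top
    exact h2
  | step f α y hm hα hf hy ih =>
    rw [leibniz_lie]
    exact add_mem (ih _) (_root_.lie_mem_iSup_loweringSpan hα hy (ih _))

lemma IsHighestWeightVector.lieSpan_le (hq : IsHighestWeightVector b χ q) :
    (LieSubmodule.lieSpan ℂ L {q}).toSubmodule ≤ ⨆ n, loweringSpan b q n := by
  let S : LieSubmodule ℂ L M :=
    { toSubmodule := ⨆ n, loweringSpan b q n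
      lie_mem := by
        intro z m hm
        change m ∈ ⨆ n, loweringSpan b q n at hm
        change ⁅z, m⁆ ∈ ⨆ n, loweringSpan b q n
        induction hm using Submodule.iSup_induction' with
        | mem n m hm =>
          induction hm using Submodule.span_induction with
          | mem m hm => exact hq.lie_mem_iSup_loweringSpan hm z
          | zero => simp
          | add m m' _ _ h h' => rw [lie_add]; exact add_mem h h'
          | smul c m _ h => rw [lie_smul]; exact Submodule.smul_mem _ c h
        | zero => simp
        | add m m' _ _ h h' => rw [lie_add]; exact add_mem h h' }
  have : LieSubmodule.lieSpan ℂ L {q} ≤ S := by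
    rw [LieSubmodule.lieSpan_le, Set.singleton_subset_iff]
    exact Submodule.mem_iSup_of_mem 0 (Submodule.subset_span IsLoweringWord.base)
  exact this

lemma IsHighestWeightVector.loweringSpan_le (hq : IsHighestWeightVector b χ q)
    (n : b.support → ℕ) : loweringSpan b q n ≤
      eigenWeightSpace H M (χ - ∑ j, n j • (rootSystem H).root (j : H.root)) := by
  rw [loweringSpan, Submodule.span_le]
  intro m hm
  induction hm with
  | base => simpa using hq.mem
  | @step n m f α y hm hα hf hy ih =>
    have := lie_mem_eigenWeightSpace (α := -(rootSystem H).root α) ih (by simpa using hy)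
    have h1 : χ - ∑ j, (n + f) j • (rootSystem H).root (j : H.root) =
        χ - ∑ j, n j • (rootSystem H).root (j : H.root) + -(rootSystem H).root α := by
      rw [hf]
      simp only [Pi.add_apply, add_smul, Finset.sum_add_distrib]
      abel
    rw [h1]
    exact this

/-- Each letter of a word adds the coefficients of a root, which are not all zero, so only the empty
word has depth zero. Hence the top weight space of a highest weight module is a line. -/
lemma loweringSpan_zero : loweringSpan b q 0 = Submodule.span ℂ {q} := by
  refine le_antisymm (Submodule.span_mono ?_) (Submodule.span_mono ?_)
  · intro m hm
    generalize hn : (0 : b.support → ℕ) = n at hm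
    cases hm with
    | base => rfl
    | step f α y hm hα hf hy =>
      exfalso
      have h0 : f = 0 := by
        funext j
        have := congrFun hn j
        simp only [Pi.zero_apply, Pi.add_apply] at this ⊢
        omega
      exact (rootSystem H).ne_zero α (by rw [hf, h0]; simp)
  · rintro _ rfl
    exact IsLoweringWord.base

lemma sum_nsmul_root_injective (b : (rootSystem H).Base) :
    Function.Injective fun n : b.support → ℕ => ∑ j, n j • (rootSystem H).root (j : H.root) := by
  intro n n' h
  have h1 : LinearIndependent ℂ fun i : b.support => (rootSystem H).root i := b.linearIndepOn_root
  have h2 := Fintype.linearIndependent_iffₛ.1 h1 (fun j => (n j : ℂ)) (fun j => (n' j : ℂ))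
    (by simpa [Nat.cast_smul_eq_nsmul] using h)
  funext j
  exact_mod_cast h2 j

/-- Nilpotency of a root vector extends from a vector to the submodule that it generates. -/
lemma exists_pow_toEnd_eq_zero_of_mem_lieSpan {y : L} (hy : IsNilpotent (LieAlgebra.ad ℂ L y))
    (hq : ∃ k, (LieModule.toEnd ℂ L M y ^ k) q = 0) {m : M}
    (hm : m ∈ LieSubmodule.lieSpan ℂ L {q}) : ∃ k, (LieModule.toEnd ℂ L M y ^ k) m = 0 := by
  have key : ∀ m : M, (∃ k, (LieModule.toEnd ℂ L M y ^ k) m = 0) ↔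
      m ∈ (LieModule.toEnd ℂ L M y).maxGenEigenspace 0 := by
    intro m
    simp [Module.End.mem_maxGenEigenspace]
  -- The generalized eigenspace of `y` for `0` is a submodule because `ad y` is nilpotent, so each
  -- `z` lies in the corresponding generalized eigenspace of `L`.
  let N : LieSubmodule ℂ L M :=
    { toSubmodule := (LieModule.toEnd ℂ L M y).maxGenEigenspace 0
      lie_mem := by
        intro z m hm
        have hz : z ∈ (LieModule.toEnd ℂ L L y).maxGenEigenspace 0 := by
          obtain ⟨k, hk⟩ := hy
          rw [Module.End.mem_maxGenEigenspace]
          refine ⟨k, ?_⟩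
          rw [zero_smul, sub_zero]
          exact LinearMap.congr_fun hk z
        simpa using LieModule.lie_mem_maxGenEigenspace_toEnd hz hm }
  have : LieSubmodule.lieSpan ℂ L {q} ≤ N := by
    rw [LieSubmodule.lieSpan_le, Set.singleton_subset_iff]
    exact (key q).1 hq
  exact (key m).2 (this hm)

lemma isNilpotent_toEnd_of_mem_neg_rootSpace [FiniteDimensional ℂ M] {α : H.root} {y : L}
    (hy : y ∈ rootSpace H (-α.1)) : IsNilpotent (LieModule.toEnd ℂ L M y) :=
  LieModule.isNilpotent_toEnd_of_mem_rootSpace (M := M) H (χ := -α.1)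
    (by simp) hy

lemma IsHighestWeightVector.exists_nat (hq : IsHighestWeightVector b χ q) (hq0 : q ≠ 0)
    (i : b.support)
    (h : ∀ f ∈ rootSpace H (-(i : H.root).1), ∃ k, (LieModule.toEnd ℂ L M f ^ k) q = 0) :
    ∃ n : ℕ, χ ((rootSystem H).coroot (i : H.root)) = n := by
  obtain ⟨e, he, f, hf, t⟩ := exists_sl2Triple (i : H.root)
  exact exists_nat_of_pow_toEnd_f_eq_zero (t := t) (m := q)
    ⟨hq0, hq.mem _, hq.lie_pos _ (RootPairing.Base.isPos_of_mem_support i.2) e he⟩ (h f hf)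

/-- An integrable highest weight module is irreducible. -/
theorem IsHighestWeightVector.eq_bot_or_eq_lieSpan (hq : IsHighestWeightVector b χ q)
    (hint : ∀ i : b.support, ∀ f ∈ rootSpace H (-(i : H.root).1),
      ∃ k, (LieModule.toEnd ℂ L M f ^ k) q = 0)
    (K : LieSubmodule ℂ L M) (hK : K ≤ LieSubmodule.lieSpan ℂ L {q}) :
    K = ⊥ ∨ K = LieSubmodule.lieSpan ℂ L {q} := by
  classical
  rw [or_iff_not_imp_left]
  intro hK0
  let wtOf : (b.support → ℕ) → Dual ℂ H := fun n =>
    χ - ∑ j, n j • (rootSystem H).root (j : H.root)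
  have hwt : Function.Injective wtOf := fun n n' h =>
    sum_nsmul_root_injective b (sub_right_injective h)
  -- decomposition of the elements of `K`
  have hdec : ∀ k ∈ K, ∃ (s : Finset (b.support → ℕ)) (w : (b.support → ℕ) → M),
      (∀ n ∈ s, w n ∈ K ∧ w n ∈ loweringSpan b q n) ∧ ∑ n ∈ s, w n = k := by
    intro k hk
    obtain ⟨w, hw, hs⟩ := (Submodule.mem_iSup_iff_exists_finsupp _ _).1 (hq.lieSpan_le (hK hk))
    refine ⟨w.support, w, fun n hn => ⟨?_, hw n⟩, hs⟩
    exact mem_of_sum_mem_of_eigenWeightSpace wtOf hwt K.toSubmodule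
      (fun h m hm => K.lie_mem hm) w.support w (fun i _ => hq.loweringSpan_le i (hw i))
      (by change (w.sum fun _ x => x) ∈ _; rw [hs]; exact hk) n hn
  -- A homogeneous nonzero element of `K` of least total depth is chosen; it will turn out to be a
  -- multiple of `q`.
  let P : ℕ → Prop := fun d => ∃ (n : b.support → ℕ) (w : M), w ≠ 0 ∧ w ∈ K ∧
    w ∈ loweringSpan b q n ∧ ∑ j, n j = d
  have hex : ∃ d, P d := by
    obtain ⟨k, hk, hk0⟩ := Submodule.exists_mem_ne_zero_of_ne_bot (p := K.toSubmodule)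
      (by simpa using hK0)
    obtain ⟨s, w, hw, hs⟩ := hdec k hk
    obtain ⟨n, hn, hwn⟩ := Finset.exists_ne_zero_of_sum_ne_zero (hs ▸ hk0)
    exact ⟨_, n, w n, hwn, (hw n hn).1, (hw n hn).2, rfl⟩
  obtain ⟨n, w, hw0, hwK, hwn, hd⟩ := Nat.find_spec hex
  have hww : w ∈ eigenWeightSpace H M (wtOf n) := hq.loweringSpan_le n hwn
  have hwS : IsHighestWeightVector b (wtOf n) w := by
    refine ⟨hww, fun α hα x hx => ?_⟩
    by_contra hu0
    have huK : ⁅x, w⁆ ∈ K := K.lie_mem hwK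
    have huw := lie_mem_eigenWeightSpace (α := (rootSystem H).root α) hww hx
    obtain ⟨s, u, hu, hs⟩ := hdec _ huK
    obtain ⟨n', hn', hun'⟩ := Finset.exists_ne_zero_of_sum_ne_zero (hs ▸ hu0)
    have h1 : u n' ∈ eigenWeightSpace H M (wtOf n + (rootSystem H).root α) :=
      mem_of_sum_mem_of_eigenWeightSpace wtOf hwt _
        (fun h m hm => by rw [hm h]; exact Submodule.smul_mem _ _ hm) s u
        (fun i hi => hq.loweringSpan_le i (hu i hi).2) (by rw [hs]; exact huw) n' hn'
    have h2 := eq_of_mem_eigenWeightSpace hun' h1 (hq.loweringSpan_le n' (hu n' hn').2)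
    obtain ⟨f, hf⟩ := exists_nat_of_isPos b hα
    -- A nonzero image under a positive root vector would have a component in `K` of depth `n - f`,
    -- against minimality.
    have h3 : n = n' + f := by
      apply sum_nsmul_root_injective b
      simp only [Pi.add_apply, add_smul, Finset.sum_add_distrib, ← hf]
      simp only [wtOf] at h2
      rw [sub_add, sub_right_inj] at h2
      rw [← h2]; abel
    have hf0 : ∑ j, f j ≠ 0 := by
      intro h0
      have : f = 0 := by
        funext j
        exact (Finset.sum_eq_zero_iff.1 h0) j (Finset.mem_univ _)
      exact (rootSystem H).ne_zero α (by rw [hf, this]; simp)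
    have h4 := Nat.find_min' hex (m := ∑ j, n' j)
      ⟨n', u n', hun', (hu n' hn').1, (hu n' hn').2, rfl⟩
    rw [← hd, h3] at h4
    simp only [Pi.add_apply, Finset.sum_add_distrib] at h4
    omega
  have hq0 : q ≠ 0 := by
    rintro rfl
    have : w ∈ LieSubmodule.lieSpan ℂ L {(0 : M)} := hK hwK
    rw [(LieSubmodule.lieSpan_eq_bot_iff ℂ L M).2 (by simp)] at this
    exact hw0 (by simpa using this)
  have hn0 : n = 0 := by
    -- Both `q` and `w` are highest weight vectors with dominant weights, since integrability passes
    -- from `q` to `w`. The Casimir operator is one scalar on the module generated by `q`, so its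
    -- values at the two weights agree.
    refine eq_zero_of_casimirScalar_eq b (χ := χ) (ψ := wtOf n) n (by simp [wtOf])
      (fun i => hq.exists_nat hq0 i (hint i)) (fun i => hwS.exists_nat hw0 i fun f hf => ?_) ?_
    · exact exists_pow_toEnd_eq_zero_of_mem_lieSpan
        (isNilpotent_toEnd_of_mem_neg_rootSpace (M := L) hf) (hint i f hf) (hK hwK)
    · obtain ⟨Ω, hΩ, hΩ'⟩ := exists_casimir (M := M) b
      let E : LieSubmodule ℂ L M :=
        { toSubmodule := LinearMap.ker (Ω - casimirScalar b χ • 1)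
          lie_mem := by
            intro x m hm
            change Ω m - casimirScalar b χ • m = 0 at hm
            change Ω ⁅x, m⁆ - casimirScalar b χ • ⁅x, m⁆ = 0
            rw [hΩ, ← lie_smul, ← lie_sub, hm, lie_zero] }
      have hE : LieSubmodule.lieSpan ℂ L {q} ≤ E := by
        rw [LieSubmodule.lieSpan_le, Set.singleton_subset_iff]
        change Ω q - casimirScalar b χ • q = 0
        rw [hΩ' χ q hq.mem hq.lie_pos, sub_self]
      have h1 : Ω w - casimirScalar b χ • w = 0 := hE (hK hwK)
      rw [hΩ' _ w hwS.mem hwS.lie_pos, ← sub_smul, smul_eq_zero_iff_left hw0, sub_eq_zero] at h1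
      exact h1.symm
  rw [hn0, loweringSpan_zero, Submodule.mem_span_singleton] at hwn
  obtain ⟨c, rfl⟩ := hwn
  have hc : c ≠ 0 := by rintro rfl; simp at hw0
  refine le_antisymm hK ?_
  rw [LieSubmodule.lieSpan_le, Set.singleton_subset_iff]
  exact (K.toSubmodule.smul_mem_iff hc).1 hwK

end HighestWeight

/-! ### Root vectors and the simple root vectors -/

section Generation

attribute [local instance] LieRing.ofAssociativeRing

variable {L : Type u} [LieRing L] [LieAlgebra ℂ L] [FiniteDimensional ℂ L]
  [LieAlgebra.IsSemisimple ℂ L] {H : LieSubalgebra ℂ L} [H.IsCartanSubalgebra]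

lemma lie_mem_rootSpace_add {α β : H → ℂ} {x y : L} (hx : x ∈ rootSpace H α)
    (hy : y ∈ rootSpace H β) : ⁅x, y⁆ ∈ rootSpace H (α + β) :=
  LieAlgebra.lie_mem_genWeightSpace_of_mem_genWeightSpace hx hy

lemma mem_span_singleton_of_mem_rootSpace {α : H.root} {x y : L} (hx : x ∈ rootSpace H α.1)
    (hx0 : x ≠ 0) (hy : y ∈ rootSpace H α.1) : ∃ c : ℂ, c • x = y := by
  have h1 := finrank_rootSpace_eq_one α.1 (Finset.mem_filter.1 α.2).2
  obtain ⟨c, hc⟩ := (finrank_eq_one_iff_of_nonzero' (⟨x, hx⟩ : rootSpace H α.1)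
    (fun h => hx0 (congrArg Subtype.val h))).1 h1 ⟨y, hy⟩
  exact ⟨c, congrArg Subtype.val hc⟩

/-- If the sum of two roots is a root, the bracket of the root spaces does not vanish. -/
lemma exists_lie_ne_zero {α β γ : H.root}
    (h : (rootSystem H).root γ = (rootSystem H).root β + (rootSystem H).root α) :
    ∃ e ∈ rootSpace H α.1, ∃ y ∈ rootSpace H β.1, ⁅e, y⁆ ≠ 0 := by
  by_contra! hcon
  obtain ⟨e, he, f, hf, t⟩ := exists_sl2Triple α
  obtain ⟨x, hx, hx0⟩ := γ.1.exists_ne_zero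
  obtain ⟨y, hy, hy0⟩ := β.1.exists_ne_zero
  -- If all brackets vanish, `y` is a primitive vector, so its eigenvalue is some natural number
  -- `n`, and `x` has eigenvalue `n + 2`. The vanishing also gives `⁅e, ⁅f, x⁆⁆ = 0`, because `⁅f,
  -- x⁆` lies in the root space of `β`.
  have hP : t.HasPrimitiveVectorWith y (β.1 ((rootSystem H).coroot α)) :=
    ⟨hy0, lie_eq_smul_of_mem_rootSpace hy _, hcon e he y hy⟩
  obtain ⟨n, hn⟩ := hP.exists_nat
  have hγ : ∀ h' : H, γ.1 h' = β.1 h' + α.1 h' := fun h' => LinearMap.congr_fun h h'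
  have hαα : α.1 ((rootSystem H).coroot α) = 2 := root_apply_coroot (Finset.mem_filter.1 α.2).2
  have hfx : ⁅f, x⁆ ∈ rootSpace H β.1 := by
    have := lie_mem_rootSpace_add hf hx
    have h2 : -(α.1 : H → ℂ) + γ.1 = β.1 := by
      funext h'
      simp [hγ]
    rwa [h2] at this
  have hh : ∀ k : ℕ, ⁅((rootSystem H).coroot α : L), (LieModule.toEnd ℂ L L e ^ k) x⁆ =
      ((n : ℂ) + 2 + 2 * k) • (LieModule.toEnd ℂ L L e ^ k) x := by
    intro k
    induction k with
    | zero =>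
      have := lie_eq_smul_of_mem_rootSpace hx ((rootSystem H).coroot α)
      simp only [pow_zero, Module.End.one_apply, Nat.cast_zero, mul_zero, add_zero]
      rw [← hn, ← hαα, ← hγ]
      exact this
    | succ k ih =>
      rw [pow_succ', Module.End.mul_apply, LieModule.toEnd_apply_apply, leibniz_lie, ih,
        t.lie_h_e_smul ℂ, smul_lie, lie_smul, ← add_smul]
      congr 1
      push_cast
      ring
  -- These coefficients never vanish, so no power of `e` kills `x`, contradicting nilpotency of root
  -- vectors.
  have hf' : ∀ k : ℕ, ⁅f, (LieModule.toEnd ℂ L L e ^ (k + 1)) x⁆ =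
      (-((k + 1) * ((n : ℂ) + 2 + k))) • (LieModule.toEnd ℂ L L e ^ k) x := by
    intro k
    have hfe : ⁅f, e⁆ = -((rootSystem H).coroot α : L) := by rw [← lie_skew, t.lie_e_f]
    induction k with
    | zero =>
      have h0 := hh 0
      simp only [pow_zero, Module.End.one_apply, Nat.cast_zero, mul_zero, add_zero] at h0
      simp only [zero_add, pow_one, LieModule.toEnd_apply_apply, pow_zero, Module.End.one_apply,
        Nat.cast_zero, add_zero, one_mul]
      rw [leibniz_lie, hcon e he _ hfx, hfe, neg_lie, h0, neg_smul, add_zero]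
    | succ k ih =>
      rw [pow_succ', Module.End.mul_apply, LieModule.toEnd_apply_apply, leibniz_lie, ih, hfe,
        neg_lie, hh, lie_smul, ← neg_smul, ← LieModule.toEnd_apply_apply ℂ L L e,
        ← Module.End.mul_apply, ← pow_succ', ← add_smul]
      congr 1
      push_cast
      ring
  have hne : ∀ k : ℕ, (LieModule.toEnd ℂ L L e ^ k) x ≠ 0 := by
    intro k
    induction k with
    | zero => simpa using hx0
    | succ k ih =>
      intro h0
      have h1 := hf' k
      rw [h0, lie_zero, eq_comm, smul_eq_zero_iff_left ih, neg_eq_zero] at h1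
      have h2 : ((k + 1) * (n + 2 + k) : ℕ) = 0 := by exact_mod_cast h1
      simp at h2
  obtain ⟨k, hk⟩ := LieModule.isNilpotent_toEnd_of_mem_rootSpace (M := L) H (root_ne_zero α) he
  exact hne k (by rw [hk]; rfl)

/-- A Lie subalgebra that contains the simple root vectors contains all positive root vectors. -/
lemma rootSpace_le_of_forall_simple (b : (rootSystem H).Base) (S : LieSubalgebra ℂ L)
    (hS : ∀ i ∈ b.support, (rootSpace H i.1).toSubmodule ≤ S.toSubmodule) (α : H.root)
    (hα : b.IsPos α) : (rootSpace H α.1).toSubmodule ≤ S.toSubmodule := by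
  refine hα.induction_on_add (p := fun α => (rootSpace H α.1).toSubmodule ≤ S.toSubmodule) hS ?_
  intro i j k hk hi hj x hx
  obtain ⟨e, he, y, hy, h⟩ := exists_lie_ne_zero hk
  have h1 : ⁅e, y⁆ ∈ rootSpace H k.1 := by
    have := lie_mem_rootSpace_add he hy
    have h2 : (j.1 : H → ℂ) + i.1 = k.1 := by
      funext h'
      have := LinearMap.congr_fun hk h'
      rw [Pi.add_apply, add_comm]
      exact this.symm
    rwa [h2] at this
  obtain ⟨c, rfl⟩ := mem_span_singleton_of_mem_rootSpace h1 h hx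
  exact S.smul_mem c (S.lie_mem (hS j hj he) (hi hy))

/-- Vectors that are killed by the simple root vectors are killed by all positive root vectors. -/
lemma isHighestWeightVector_of_simple {M : Type*} [AddCommGroup M] [Module ℂ M]
    [LieRingModule L M] [LieModule ℂ L M] {b : (rootSystem H).Base} {χ : Dual ℂ H} {m : M}
    (hm : m ∈ eigenWeightSpace H M χ)
    (he : ∀ i ∈ b.support, ∀ x ∈ rootSpace H i.1, ⁅x, m⁆ = 0) : IsHighestWeightVector b χ m := by
  refine ⟨hm, fun α hα x hx => ?_⟩
  let S : LieSubalgebra ℂ L :=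
    { carrier := {x | ⁅x, m⁆ = 0}
      add_mem' := fun {x y} hx hy => by
        change ⁅x + y, m⁆ = 0
        rw [add_lie, hx, hy, add_zero]
      zero_mem' := zero_lie m
      smul_mem' := fun c x hx => by
        change ⁅c • x, m⁆ = 0
        rw [smul_lie, hx, smul_zero]
      lie_mem' := fun {x y} hx hy => by
        change ⁅⁅x, y⁆, m⁆ = 0
        rw [lie_lie, hx, hy, lie_zero, lie_zero, sub_zero] }
  exact rootSpace_le_of_forall_simple b S (fun i hi y hy => he i hi y hy) α hα hx

end Generation

/-! ### Highest weight representations of `G` and the linear form `v_λ^*`. -/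

namespace SemisimpleGroup

variable {L : Type u} [LieRing L] [LieAlgebra ℂ L] [FiniteDimensional ℂ L]
  [LieAlgebra.IsSemisimple ℂ L] {H : LieSubalgebra ℂ L} [H.IsCartanSubalgebra]
  {D : SemisimpleGroup H}

lemma sl2Triple (i : D.I) : IsSl2Triple (D.simpleCoroot i : L) (D.e i) (D.f i) where
  h_ne_zero := by simp
  lie_e_f := D.lie_e_f i
  lie_h_e_nsmul := by
    have h1 : ⁅(D.simpleCoroot i : L), D.e i⁆ = _ := lie_eq_smul_of_mem_rootSpace (D.e_mem i) _
    have hαα : (i : H.root).1 (D.simpleCoroot i) = 2 :=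
      root_apply_coroot (Finset.mem_filter.1 (i : H.root).2).2
    rw [h1, hαα, two_smul, two_smul]
  lie_h_f_nsmul := by
    have h1 : ⁅(D.simpleCoroot i : L), D.f i⁆ = _ := lie_eq_smul_of_mem_rootSpace (D.f_mem i) _
    have hαα : (i : H.root).1 (D.simpleCoroot i) = 2 :=
      root_apply_coroot (Finset.mem_filter.1 (i : H.root).2).2
    rw [h1, Pi.neg_apply, hαα, neg_smul, two_smul, two_smul]

lemma mem_span_e (i : D.I) {x : L} (hx : x ∈ rootSpace H (i : H.root).1) :
    ∃ c : ℂ, c • D.e i = x :=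
  mem_span_singleton_of_mem_rootSpace (D.e_mem i) (sl2Triple i).e_ne_zero hx

section Rep

variable {V : Type v} [AddCommGroup V] [Module ℂ V] [LieRingModule L V] [LieModule ℂ L V]

lemma weightRep_eq (χ : Dual ℂ H) : D.weightRep V χ = eigenWeightSpace H V χ := by
  ext m
  exact LieModule.mem_weightSpace (χ : H → ℂ) m

lemma isHighestWeightVector_of_eRep {χ : Dual ℂ H} {m : V} (hm : m ∈ eigenWeightSpace H V χ)
    (he : ∀ i, ⁅D.e i, m⁆ = 0) : IsHighestWeightVector D.base χ m := by
  refine isHighestWeightVector_of_simple hm fun i hi x hx => ?_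
  obtain ⟨c, rfl⟩ := mem_span_e (⟨i, hi⟩ : D.I) hx
  rw [smul_lie, he, smul_zero]

variable [FiniteDimensional ℂ V] {Λ : D.DominantWeight}

lemma HighestWeightRep.isHighestWeightVector (R : D.HighestWeightRep V Λ) :
    IsHighestWeightVector D.base Λ.weight R.vec :=
  isHighestWeightVector_of_eRep (by rw [← weightRep_eq]; exact R.vec_mem) R.eRep_vec

lemma HighestWeightRep.eq_bot_or_eq_top (R : D.HighestWeightRep V Λ) (K : LieSubmodule ℂ L V) :
    K = ⊥ ∨ K = ⊤ :=
  haveI := R.irreducible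
  IsSimpleOrder.eq_bot_or_eq_top K

lemma HighestWeightRep.lieSpan_vec (R : D.HighestWeightRep V Λ) :
    LieSubmodule.lieSpan ℂ L {R.vec} = ⊤ := by
  refine (R.eq_bot_or_eq_top _).resolve_left fun h => R.vec_ne_zero ?_
  exact (LieSubmodule.lieSpan_eq_bot_iff ℂ L V).1 h _ rfl

lemma HighestWeightRep.iSup_loweringSpan (R : D.HighestWeightRep V Λ) :
    ⨆ n, loweringSpan D.base R.vec n = ⊤ := by
  rw [eq_top_iff]
  refine le_trans ?_ R.isHighestWeightVector.lieSpan_le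
  rw [R.lieSpan_vec]; rfl

lemma HighestWeightRep.iSup_eigenWeightSpace (R : D.HighestWeightRep V Λ) :
    ⨆ χ, eigenWeightSpace H V χ = ⊤ := by
  rw [eq_top_iff, ← R.iSup_loweringSpan]
  exact iSup_le fun n => (R.isHighestWeightVector.loweringSpan_le n).trans (le_iSup _ _)

lemma HighestWeightRep.form_eq_zero' (R : D.HighestWeightRep V Λ)
    {χ : Dual ℂ H} (hχ : χ ≠ Λ.weight) {w : V}
    (hw : w ∈ eigenWeightSpace H V χ) : R.form w = 0 :=
  R.form_eq_zero χ hχ w (by rw [weightRep_eq]; exact hw)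

lemma HighestWeightRep.form_lie_cartan (R : D.HighestWeightRep V Λ) (h : H) (w : V) :
    R.form ⁅(h : L), w⁆ = Λ.weight h * R.form w := by
  have hw : w ∈ ⨆ χ, eigenWeightSpace H V χ := R.iSup_eigenWeightSpace ▸ Submodule.mem_top
  induction hw using Submodule.iSup_induction' with
  | mem χ w hw =>
    rw [hw h, map_smul, smul_eq_mul]
    by_cases hχ : χ = Λ.weight
    · rw [hχ]
    · rw [R.form_eq_zero' hχ hw, mul_zero, mul_zero]
  | zero => simp
  | add x y _ _ hx hy => rw [lie_add, map_add, hx, hy, map_add, mul_add]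

/-- All weights have the form `λ` minus a nonnegative combination of simple roots. After lowering by
a positive root the difference from `λ` is nonzero, and `v_λ^*` vanishes there. -/
lemma HighestWeightRep.form_lie_neg (R : D.HighestWeightRep V Λ)
    {α : H.root} (hα : D.base.IsPos α) {y : L}
    (hy : y ∈ rootSpace H (-α.1)) (w : V) : R.form ⁅y, w⁆ = 0 := by
  have hw : w ∈ ⨆ n, loweringSpan D.base R.vec n := R.iSup_loweringSpan ▸ Submodule.mem_top
  induction hw using Submodule.iSup_induction' with
  | mem n w hw =>
    have hw' := R.isHighestWeightVector.loweringSpan_le n hw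
    have h1 := lie_mem_eigenWeightSpace (α := -(rootSystem H).root α) hw' (by simpa using hy)
    refine R.form_eq_zero' (fun h => ?_) h1
    obtain ⟨f, hf⟩ := exists_nat_of_isPos D.base hα
    have h2 : n + f = 0 := by
      apply sum_nsmul_root_injective D.base
      simp only [Pi.add_apply, add_smul, Finset.sum_add_distrib, ← hf, Pi.zero_apply, zero_smul,
        Finset.sum_const_zero]
      rw [← sub_eq_add_neg, sub_sub, sub_eq_self] at h
      exact h
    have h0 : f = 0 := by
      funext j
      have := congrFun h2 j
      simp only [Pi.zero_apply, Pi.add_apply] at this ⊢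
      omega
    exact (rootSystem H).ne_zero α (by rw [hf, h0]; simp)
  | zero => simp
  | add x y _ _ hx hy => rw [lie_add, map_add, hx, hy, add_zero]

/-- The linear form `v_λ^*` is a lowest weight vector of the dual representation. -/
lemma HighestWeightRep.isHighestWeightVector_form (R : D.HighestWeightRep V Λ) :
    IsHighestWeightVector (oppBase D.base) (-Λ.weight) R.form := by
  refine ⟨fun h => ?_, fun α hα x hx => ?_⟩
  · ext w
    rw [Module.Dual.lie_apply, R.form_lie_cartan]
    simp
  · ext w
    rw [isPos_oppBase, ← isPos_negRoot] at hα
    rw [Module.Dual.lie_apply, R.form_lie_neg hα (by simpa using hx)]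
    simp

/-- The common zero space in `V` of the module generated by `v_λ^*` is a submodule that misses
`v_λ`, hence zero by irreducibility; duality in finite dimension then gives the claim. -/
lemma HighestWeightRep.lieSpan_form (R : D.HighestWeightRep V Λ) :
    LieSubmodule.lieSpan ℂ L {R.form} = ⊤ := by
  let K : LieSubmodule ℂ L V :=
    { toSubmodule := (LieSubmodule.lieSpan ℂ L {R.form}).toSubmodule.dualCoannihilator
      lie_mem := by
        intro x m hm
        change m ∈ Submodule.dualCoannihilator _ at hm
        change ⁅x, m⁆ ∈ Submodule.dualCoannihilator _
        rw [Submodule.mem_dualCoannihilator] at hm ⊢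
        intro ζ hζ
        have := hm ⁅x, ζ⁆ (LieSubmodule.lie_mem _ hζ)
        rw [Module.Dual.lie_apply, neg_eq_zero] at this
        exact this }
  have hK : K = ⊥ := by
    refine (R.eq_bot_or_eq_top K).resolve_right fun h => ?_
    have h1 : R.vec ∈ K := h ▸ LieSubmodule.mem_top _
    have h2 := (Submodule.mem_dualCoannihilator R.vec).1 h1 R.form
      (LieSubmodule.subset_lieSpan rfl)
    rw [R.form_vec] at h2
    exact one_ne_zero h2
  have hK' : (LieSubmodule.lieSpan ℂ L {R.form}).toSubmodule.dualCoannihilator = ⊥ :=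
    congrArg LieSubmodule.toSubmodule hK
  have h3 := Subspace.dualCoannihilator_dualAnnihilator_eq
    (W := (LieSubmodule.lieSpan ℂ L {R.form}).toSubmodule)
  rw [hK', Submodule.dualAnnihilator_bot] at h3
  exact LieSubmodule.toSubmodule_injective h3.symm

end Rep

end SemisimpleGroup

/-! ### Differential calculus on the coordinate ring -/

namespace SemisimpleGroup

variable {L : Type u} [LieRing L] [LieAlgebra ℂ L] [FiniteDimensional ℂ L]
  [LieAlgebra.IsSemisimple ℂ L] {H : LieSubalgebra ℂ L} [H.IsCartanSubalgebra]
  {D : SemisimpleGroup H}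

@[ext] lemma CN.ext {φ ψ : D.CN} (h : ∀ g, φ.1 g = ψ.1 g) : φ = ψ := Subtype.ext (funext h)

lemma hasDerivAt_leftAct (x : D.n) (φ : D.CN) (g : D.N) :
    HasDerivAt (fun t : ℂ => φ.1 (g * D.expN (t • x))) ((D.leftAct x φ).1 g) 0 := by
  obtain ⟨ψ, -, h⟩ := D.exists_leftDeriv x φ
  have : (D.leftAct x φ).1 g = ψ g := (h g).deriv
  rw [this]; exact h g

lemma hasDerivAt_rightAct (x : D.n) (φ : D.CN) (g : D.N) :
    HasDerivAt (fun t : ℂ => φ.1 (D.expN (t • x) * g)) ((D.rightAct x φ).1 g) 0 := by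
  obtain ⟨ψ, -, h⟩ := D.exists_rightDeriv x φ
  have : (D.rightAct x φ).1 g = ψ g := (h g).deriv
  rw [this]; exact h g

lemma leftAct_mul (x : D.n) (φ ψ : D.CN) :
    D.leftAct x (φ * ψ) = φ * D.leftAct x ψ + ψ * D.leftAct x φ := by
  ext g
  have h := (hasDerivAt_leftAct x φ g).mul (hasDerivAt_leftAct x ψ g)
  refine ((hasDerivAt_leftAct x (φ * ψ) g).unique h).trans ?_
  simp only [expN_zero_smul, mul_one]
  change _ = φ.1 g * _ + ψ.1 g * _
  ring

lemma rightAct_mul (x : D.n) (φ ψ : D.CN) :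
    D.rightAct x (φ * ψ) = φ * D.rightAct x ψ + ψ * D.rightAct x φ := by
  ext g
  have h := (hasDerivAt_rightAct x φ g).mul (hasDerivAt_rightAct x ψ g)
  refine ((hasDerivAt_rightAct x (φ * ψ) g).unique h).trans ?_
  simp only [expN_zero_smul, one_mul]
  change _ = φ.1 g * _ + ψ.1 g * _
  ring

lemma leftAct_one (x : D.n) : D.leftAct x 1 = 0 := by
  have h := leftAct_mul x (1 : D.CN) 1
  simpa using h

lemma rightAct_one (x : D.n) : D.rightAct x 1 = 0 := by
  have h := rightAct_mul x (1 : D.CN) 1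
  simpa using h

/-- The left action as a derivation. -/
def leftDer (x : D.n) : Derivation ℂ D.CN D.CN where
  toLinearMap := D.leftAct x
  map_one_eq_zero' := leftAct_one x
  leibniz' := leftAct_mul x

/-- The right action as a derivation. -/
def rightDer (x : D.n) : Derivation ℂ D.CN D.CN where
  toLinearMap := D.rightAct x
  map_one_eq_zero' := rightAct_one x
  leibniz' := rightAct_mul x

lemma leftDer_apply (x : D.n) (φ : D.CN) : leftDer x φ = D.leftAct x φ := rfl

lemma rightDer_apply (x : D.n) (φ : D.CN) : rightDer x φ = D.rightAct x φ := rfl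

/-- The matrix coordinate functions as elements of `ℂ[N]`. -/
def coordCN (ρ : MatrixRep H D.X) (i j : Fin ρ.dim) : D.CN := ⟨D.coord ρ i j, D.coord_mem ρ i j⟩

lemma CN.induction {p : D.CN → Prop} (hc : ∀ ρ i j, p (coordCN ρ i j))
    (hr : ∀ r : ℂ, p (algebraMap ℂ D.CN r)) (ha : ∀ φ ψ, p φ → p ψ → p (φ + ψ))
    (hm : ∀ φ ψ, p φ → p ψ → p (φ * ψ)) (φ : D.CN) : p φ := by
  obtain ⟨φ, hφ⟩ := φ
  induction hφ using Algebra.adjoin_induction with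
  | mem φ hφ =>
    obtain ⟨ρ, i, j, rfl⟩ := hφ
    exact hc ρ i j
  | algebraMap r => exact hr r
  | add φ ψ hφ hψ h h' => exact ha _ _ h h'
  | mul φ ψ hφ hψ h h' => exact hm _ _ h h'

/-- The matrix coordinates generate `ℂ[N]`, so identities between the left and right actions reduce
to matrix multiplication. -/
lemma derivation_ext {d d' : Derivation ℂ D.CN D.CN}
    (h : ∀ ρ i j, d (coordCN ρ i j) = d' (coordCN ρ i j)) : d = d' := by
  ext1 φ
  induction φ using CN.induction with
  | hc ρ i j => exact h ρ i j
  | hr r => simp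
  | ha φ ψ h h' => rw [map_add, map_add, h, h']
  | hm φ ψ h h' => rw [Derivation.leibniz, Derivation.leibniz, h, h']

lemma CN.sum_apply {ι : Type*} (s : Finset ι) (f : ι → D.CN) (g : D.N) :
    (∑ k ∈ s, f k).1 g = ∑ k ∈ s, (f k).1 g := by
  rw [AddSubmonoidClass.coe_finsetSum, Finset.sum_apply]

lemma leftAct_coordCN (x : D.n) (ρ : MatrixRep H D.X) (i j : Fin ρ.dim) :
    D.leftAct x (coordCN ρ i j) = ∑ k, ρ.hom (x : L) k j • coordCN ρ i k := by
  ext g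
  refine (hasDerivAt_leftAct x _ g).unique ?_
  have := HasDerivAt.fun_sum (u := Finset.univ) fun k _ =>
    (D.coord_expN ρ k j x).const_mul (D.coord ρ i k g)
  have h2 : (fun t : ℂ => (coordCN ρ i j).1 (g * D.expN (t • x))) =
      fun t => ∑ k, D.coord ρ i k g * D.coord ρ k j (D.expN (t • x)) :=
    funext fun t => D.coord_mul ρ i j _ _
  rw [h2, CN.sum_apply]
  refine this.congr_deriv (Finset.sum_congr rfl fun k _ => mul_comm _ _)

lemma rightAct_coordCN (x : D.n) (ρ : MatrixRep H D.X) (i j : Fin ρ.dim) :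
    D.rightAct x (coordCN ρ i j) = ∑ k, ρ.hom (x : L) i k • coordCN ρ k j := by
  ext g
  refine (hasDerivAt_rightAct x _ g).unique ?_
  have := HasDerivAt.fun_sum (u := Finset.univ) fun k _ =>
    (D.coord_expN ρ i k x).mul_const (D.coord ρ k j g)
  have h2 : (fun t : ℂ => (coordCN ρ i j).1 (D.expN (t • x) * g)) =
      fun t => ∑ k, D.coord ρ i k (D.expN (t • x)) * D.coord ρ k j g :=
    funext fun t => D.coord_mul ρ i j _ _
  rw [h2, CN.sum_apply]
  exact this

attribute [local instance] LieRing.ofAssociativeRing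

lemma rightDer_add (x y : D.n) : rightDer (x + y) = rightDer x + rightDer y := by
  refine derivation_ext fun ρ i j => ?_
  rw [Derivation.add_apply]
  simp only [rightDer_apply, rightAct_coordCN, ← Finset.sum_add_distrib, ← add_smul]
  simp

lemma rightDer_smul (c : ℂ) (x : D.n) : rightDer (c • x) = c • rightDer x := by
  refine derivation_ext fun ρ i j => ?_
  rw [Derivation.smul_apply]
  simp only [rightDer_apply, rightAct_coordCN, Finset.smul_sum, smul_smul]
  simp

/-- The right action, linear in the element of `𝔫`. -/
def rightLin (D : SemisimpleGroup H) : D.n →ₗ[ℂ] Module.End ℂ D.CN where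
  toFun := D.rightAct
  map_add' x y := LinearMap.ext fun φ => DFunLike.congr_fun (rightDer_add x y) φ
  map_smul' c x := LinearMap.ext fun φ => DFunLike.congr_fun (rightDer_smul c x) φ

lemma rightLin_apply (x : D.n) : D.rightLin x = D.rightAct x := rfl

/-- The order is reversed because `φ(n g)` defines a right action of `N`, so its differential is an
antihomomorphism. -/
lemma rightAct_lie {x y z : D.n} (h : (z : L) = ⁅(x : L), (y : L)⁆) (φ : D.CN) :
    D.rightAct z φ = D.rightAct y (D.rightAct x φ) - D.rightAct x (D.rightAct y φ) := by
  have : rightDer z = ⁅rightDer y, rightDer x⁆ := by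
    refine derivation_ext fun ρ i j => ?_
    rw [Derivation.commutator_apply]
    simp only [rightDer_apply, rightAct_coordCN, map_sum, map_smul, h, LieHom.map_lie,
      Ring.lie_def, Matrix.sub_apply, Matrix.mul_apply, sub_smul, Finset.sum_smul,
      Finset.sum_sub_distrib, Finset.smul_sum, smul_smul]
    congr 1
    · exact Finset.sum_comm
    · exact Finset.sum_comm
  exact DFunLike.congr_fun this φ

/-- Left and right multiplication on `N` commute; on coordinates this is associativity of the matrix
product. -/
lemma leftAct_rightAct_comm (x y : D.n) (φ : D.CN) :
    D.leftAct x (D.rightAct y φ) = D.rightAct y (D.leftAct x φ) := by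
  have : ⁅leftDer x, rightDer y⁆ = 0 := by
    refine derivation_ext fun ρ i j => ?_
    rw [Derivation.commutator_apply]
    simp only [rightDer_apply, leftDer_apply, rightAct_coordCN, leftAct_coordCN, map_sum, map_smul,
      Finset.smul_sum, smul_smul]
    rw [Finset.sum_comm]
    simp [mul_comm]
  have := DFunLike.congr_fun this φ
  rw [Derivation.commutator_apply] at this
  exact sub_eq_zero.1 this

/-! #### Functions are determined by their derivatives at the identity -/

lemma expN_add_smul (s t : ℂ) (x : D.n) :
    D.expN ((s + t) • x) = D.expN (s • x) * D.expN (t • x) := by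
  apply Subtype.ext
  funext ρ
  apply Units.ext
  simp only [expN, Subgroup.coe_mul, Pi.mul_apply, Units.val_mul, expG_val]
  rw [← Matrix.exp_add_of_commute]
  · simp [add_smul]
  · simp only [Submodule.coe_smul, map_smul]
    exact ((Commute.refl (ρ.hom (x : L))).smul_left s).smul_right t

lemma hasDerivAt_leftAct' (x : D.n) (φ : D.CN) (g : D.N) (t : ℂ) :
    HasDerivAt (fun t : ℂ => φ.1 (g * D.expN (t • x)))
      ((D.leftAct x φ).1 (g * D.expN (t • x))) t := by
  have h := hasDerivAt_leftAct x φ (g * D.expN (t • x))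
  have h1 : HasDerivAt (fun s : ℂ => φ.1 (g * D.expN (t • x) * D.expN ((s - t) • x)))
      ((D.leftAct x φ).1 (g * D.expN (t • x))) t := by
    have := HasDerivAt.comp_sub_const t t (by rw [sub_self]; exact h)
    exact this
  have h2 : (fun s : ℂ => φ.1 (g * D.expN (s • x))) =
      fun s => φ.1 (g * D.expN (t • x) * D.expN ((s - t) • x)) := by
    funext s
    rw [mul_assoc, ← expN_add_smul, add_sub_cancel]
  rw [h2]
  exact h1

lemma iteratedDeriv_leftAct (x : D.n) (φ : D.CN) (g : D.N) (k : ℕ) :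
    iteratedDeriv k (fun t : ℂ => φ.1 (g * D.expN (t • x))) =
      fun t => ((D.leftAct x ^ k) φ).1 (g * D.expN (t • x)) := by
  induction k with
  | zero => simp
  | succ k ih =>
    rw [iteratedDeriv_succ, ih]
    funext t
    rw [pow_succ']
    exact (hasDerivAt_leftAct' x _ g t).deriv

/-- The function `t ↦ φ(g exp(t x))` is entire, and its derivatives at `0` are the values at `g` of
the iterated left derivatives of `φ`. So its Taylor series vanishes at `t = 1` too. -/
lemma apply_mul_expN_eq_zero (x : D.n) (φ : D.CN) (g : D.N)
    (h : ∀ k, ((D.leftAct x ^ k) φ).1 g = 0) : φ.1 (g * D.expN x) = 0 := by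
  have hd : Differentiable ℂ fun t : ℂ => φ.1 (g * D.expN (t • x)) := fun t =>
    (hasDerivAt_leftAct' x φ g t).differentiableAt
  have h1 := Complex.taylorSeries_eq_of_entire' 0 1 hd
  simp only [iteratedDeriv_leftAct, expN_zero_smul, mul_one, h, mul_zero, zero_mul, tsum_zero,
    one_smul] at h1
  exact h1.symm

lemma inv_expN (x : D.n) : (D.expN x)⁻¹ = D.expN (-x) := by
  rw [inv_eq_iff_mul_eq_one]
  have h := expN_add_smul 1 (-1) x
  rw [add_neg_cancel, expN_zero_smul] at h
  rw [one_smul, neg_one_smul] at h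
  exact h.symm

lemma N.induction {p : D.N → Prop} (h1 : p 1) (hx : ∀ g x, p g → p (g * D.expN x)) (g : D.N) :
    p g := by
  obtain ⟨g, hg⟩ := g
  refine Subgroup.closure_induction_right (s := expG D.X '' D.n) (p := fun g hg => p ⟨g, hg⟩) h1
    ?_ ?_ hg
  · rintro g hg _ ⟨x, hx', rfl⟩ ih
    exact hx ⟨g, hg⟩ ⟨x, hx'⟩ ih
  · rintro g hg _ ⟨x, hx', rfl⟩ ih
    have := hx ⟨g, hg⟩ (-⟨x, hx'⟩) ih
    rw [← inv_expN] at this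
    exact this

/-- A space of functions that is stable under the left action and vanishes at the identity is
zero. -/
lemma eq_zero_of_stable (I : Submodule ℂ D.CN) (hI : ∀ x : D.n, ∀ φ ∈ I, D.leftAct x φ ∈ I)
    (h1 : ∀ φ ∈ I, φ.1 1 = 0) {φ : D.CN} (hφ : φ ∈ I) : φ = 0 := by
  -- Elements of `N` are products of exponentials, and the vanishing of all of `I` at `g` is carried
  -- to `g exp x` by the Taylor series, since iterated derivatives stay in `I`.
  have key : ∀ g : D.N, ∀ φ ∈ I, φ.1 g = 0 := by
    intro g
    induction g using N.induction with
    | h1 => exact h1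
    | hx g x ih =>
      intro φ hφ
      refine apply_mul_expN_eq_zero x φ g fun k => ih _ ?_
      induction k with
      | zero => exact hφ
      | succ k ihk => rw [pow_succ']; exact hI x _ ihk
  ext g
  exact key g φ hφ

end SemisimpleGroup

/-! ### Matrix coefficients -/

namespace SemisimpleGroup

attribute [local instance] LieRing.ofAssociativeRing

variable {L : Type u} [LieRing L] [LieAlgebra ℂ L] [FiniteDimensional ℂ L]
  [LieAlgebra.IsSemisimple ℂ L] {H : LieSubalgebra ℂ L} [H.IsCartanSubalgebra]
  {D : SemisimpleGroup H}

section Coeff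

variable {V : Type v} [AddCommGroup V] [Module ℂ V] [FiniteDimensional ℂ V]
  [LieRingModule L V] [LieModule ℂ L V] (hV : WeightsIn H D.X V)

lemma act_one : D.act hV 1 = 1 := by
  change Matrix.toLin _ _ (1 : Matrix _ _ ℂ) = 1
  exact Matrix.toLin_one _

lemma act_mul (g g' : D.N) : D.act hV (g * g') = D.act hV g * D.act hV g' := by
  change Matrix.toLin _ _ (_ * _ : Matrix _ _ ℂ) = _
  exact Matrix.toLin_mul _ _ _ _ _

/-- The matrix coefficient `g ↦ ξ(g w)`. -/
def coeff (ξ : Dual ℂ V) (w : V) : D.CN := ⟨fun g => ξ (D.act hV g w), D.matrixCoeff_mem hV ξ w⟩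

lemma coeff_apply (ξ : Dual ℂ V) (w : V) (g : D.N) : (coeff hV ξ w).1 g = ξ (D.act hV g w) := rfl

lemma coeff_apply_one (ξ : Dual ℂ V) (w : V) : (coeff hV ξ w).1 1 = ξ w := by
  rw [coeff_apply, act_one]; rfl

/-- The matrix coefficients, linear in the vector. -/
def coeffLin (ξ : Dual ℂ V) : V →ₗ[ℂ] D.CN where
  toFun := coeff hV ξ
  map_add' w w' := by ext g; exact (congrArg ξ (map_add (D.act hV g) w w')).trans (map_add ξ _ _)
  map_smul' c w := by ext g; exact (congrArg ξ (map_smul (D.act hV g) c w)).trans (map_smul ξ _ _)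

lemma coeff_add (ξ : Dual ℂ V) (w w' : V) : coeff hV ξ (w + w') = coeff hV ξ w + coeff hV ξ w' :=
  map_add (coeffLin hV ξ) w w'

lemma coeff_eq_sum (ξ : Dual ℂ V) (w : V) : coeff hV ξ w =
    ∑ i : Fin (finrank ℂ V), ∑ j : Fin (finrank ℂ V),
      (((finBasis ℂ V).repr w j) * ξ (finBasis ℂ V i)) • coordCN (toMatrixRep hV) i j := by
  ext g
  simp only [CN.sum_apply, coeff_apply]
  simp only [act, Matrix.toLin_apply, map_sum, map_smul, Matrix.mulVec, dotProduct, smul_eq_mul,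
    Finset.sum_mul]
  refine Finset.sum_congr rfl fun i _ => Finset.sum_congr rfl fun j _ => ?_
  change _ = _ * D.coord _ _ _ _
  simp only [coord]
  ring

lemma toMatrixRep_hom_apply (x : L) (i j : Fin (finrank ℂ V)) :
    (toMatrixRep hV).hom x i j = (finBasis ℂ V).repr ⁅x, finBasis ℂ V j⁆ i := by
  change LinearMap.toMatrix (finBasis ℂ V) (finBasis ℂ V) (LieModule.toEnd ℂ L V x) i j = _
  rw [LinearMap.toMatrix_apply]; rfl

lemma hasDerivAt_act_expN (ξ : Dual ℂ V) (w : V) (x : D.n) :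
    HasDerivAt (fun t : ℂ => ξ (D.act hV (D.expN (t • x)) w)) (ξ ⁅(x : L), w⁆) 0 := by
  have h1 : (fun t : ℂ => ξ (D.act hV (D.expN (t • x)) w)) = fun t : ℂ =>
      ∑ i : Fin (finrank ℂ V), ∑ j : Fin (finrank ℂ V),
      (((finBasis ℂ V).repr w j) * ξ (finBasis ℂ V i)) *
        D.coord (toMatrixRep hV) i j (D.expN (t • x)) := by
    funext t
    rw [← coeff_apply, coeff_eq_sum]
    simp only [CN.sum_apply]
    rfl
  rw [h1]
  have h2 := HasDerivAt.fun_sum (u := Finset.univ) fun i _ =>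
    HasDerivAt.fun_sum (u := Finset.univ) fun j _ =>
      (D.coord_expN (toMatrixRep hV) i j x).const_mul
        (((finBasis ℂ V).repr w j) * ξ (finBasis ℂ V i))
  refine h2.congr_deriv ?_
  have h3 : ∑ i : Fin (finrank ℂ V), ∑ j : Fin (finrank ℂ V),
      (((finBasis ℂ V).repr w j) * ξ (finBasis ℂ V i)) *
        (finBasis ℂ V).repr ⁅(x : L), finBasis ℂ V j⁆ i = ξ ⁅(x : L), w⁆ := by
    conv_rhs => rw [← (finBasis ℂ V).sum_repr w, lie_sum, map_sum]
    rw [Finset.sum_comm]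
    refine Finset.sum_congr rfl fun j _ => ?_
    rw [lie_smul, map_smul]
    conv_rhs => rw [← (finBasis ℂ V).sum_repr ⁅(x : L), finBasis ℂ V j⁆, map_sum]
    rw [Finset.smul_sum]
    refine Finset.sum_congr rfl fun i _ => ?_
    rw [map_smul, smul_eq_mul, smul_eq_mul]
    ring
  exact (Finset.sum_congr rfl fun i _ => Finset.sum_congr rfl fun j _ =>
    congrArg _ (toMatrixRep_hom_apply hV (x : L) i j)).trans h3

lemma leftAct_coeff (x : D.n) (ξ : Dual ℂ V) (w : V) :
    D.leftAct x (coeff hV ξ w) = coeff hV ξ ⁅(x : L), w⁆ := by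
  ext g
  refine (hasDerivAt_leftAct x _ g).unique ?_
  have h := hasDerivAt_act_expN hV (ξ ∘ₗ D.act hV g) w x
  refine h.congr_of_eventuallyEq (Filter.Eventually.of_forall fun t => ?_)
  change ξ (D.act hV (g * D.expN (t • x)) w) = _
  rw [act_mul]; rfl

lemma rightAct_coeff (x : D.n) (ξ : Dual ℂ V) (w : V) :
    D.rightAct x (coeff hV ξ w) = coeff hV (ξ ∘ₗ LieModule.toEnd ℂ L V x) w := by
  ext g
  refine (hasDerivAt_rightAct x _ g).unique ?_
  have h := hasDerivAt_act_expN hV ξ (D.act hV g w) x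
  refine h.congr_of_eventuallyEq (Filter.Eventually.of_forall fun t => ?_)
  change ξ (D.act hV (D.expN (t • x) * g) w) = _
  rw [act_mul]; rfl

end Coeff

/-! #### The adjoint representation -/

lemma weightsIn_adjoint : WeightsIn H D.X L := by
  intro χ w hw h
  by_cases h0 : (χ : H → ℂ) = 0
  · have : χ = 0 := LinearMap.ext fun x => congrFun h0 x
    rw [this]; exact zero_mem _
  · have h1 : w ∈ rootSpace H (χ : H → ℂ) := by
      refine LieModule.weightSpace_le_genWeightSpace L _ ?_
      exact (LieModule.mem_weightSpace _ _).2 h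
    let α : LieModule.Weight ℂ H L := ⟨χ, fun h => hw (by
      have h2 : w ∈ LieModule.genWeightSpace L (χ : H → ℂ) := h1
      rw [h] at h2
      simpa using h2)⟩
    have hα : α ∈ H.root := Finset.mem_filter.2 ⟨Finset.mem_univ _, h0⟩
    have h2 := D.root_mem ⟨α, hα⟩
    have h3 : (rootSystem H).root ⟨α, hα⟩ = χ := LinearMap.ext fun _ => rfl
    rwa [h3] at h2

/-- The adjoint action of `N`. -/
abbrev Ad (D : SemisimpleGroup H) (g : D.N) : Module.End ℂ L := D.act (weightsIn_adjoint (D := D)) g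

/-- The coordinate functions of the adjoint representation. -/
def adCoeff (D : SemisimpleGroup H) (k : Fin (finrank ℂ L)) (x : L) : D.CN :=
  coeff weightsIn_adjoint ((finBasis ℂ L).coord k) x

lemma Ad_eq_sum (g : D.N) (x : L) : D.Ad g x = ∑ k, (D.adCoeff k x).1 g • finBasis ℂ L k :=
  ((finBasis ℂ L).sum_repr (D.Ad g x)).symm

lemma leftAct_adCoeff (z : D.n) (k : Fin (finrank ℂ L)) (x : L) :
    D.leftAct z (D.adCoeff k x) = D.adCoeff k ⁅(z : L), x⁆ :=
  leftAct_coeff _ _ _ _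

lemma rightAct_adCoeff_apply (z : D.n) (k : Fin (finrank ℂ L)) (x : L) (g : D.N) :
    (D.rightAct z (D.adCoeff k x)).1 g = (finBasis ℂ L).coord k ⁅(z : L), D.Ad g x⁆ := by
  rw [adCoeff, rightAct_coeff]; rfl

/-- The action map of a representation is `N`-equivariant. -/
lemma act_lie {V : Type v} [AddCommGroup V] [Module ℂ V] [FiniteDimensional ℂ V]
    [LieRingModule L V] [LieModule ℂ L V] (hV : WeightsIn H D.X V) (g : D.N) (x : L) (w : V) :
    D.act hV g ⁅x, w⁆ = ⁅D.Ad g x, D.act hV g w⁆ := by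
  -- The defect of equivariance is itself a regular function. By the Leibniz rule a left derivative
  -- of a defect is a sum of defects, and all of them vanish at `1`, so `eq_zero_of_stable` applies
  -- to their span.
  let F : Dual ℂ V → L → V → D.CN := fun ξ x w => coeff hV ξ ⁅x, w⁆ -
    ∑ k, D.adCoeff k x * coeff hV (ξ ∘ₗ LieModule.toEnd ℂ L V (finBasis ℂ L k)) w
  have hF : ∀ ξ x w (g : D.N), (F ξ x w).1 g =
      ξ (D.act hV g ⁅x, w⁆) - ξ ⁅D.Ad g x, D.act hV g w⁆ := by
    intro ξ x w g
    change (coeff hV ξ ⁅x, w⁆).1 g - (∑ k, D.adCoeff k x *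
      coeff hV (ξ ∘ₗ LieModule.toEnd ℂ L V (finBasis ℂ L k)) w).1 g = _
    rw [CN.sum_apply, coeff_apply, Ad_eq_sum, sum_lie, map_sum]
    congr 1
    refine Finset.sum_congr rfl fun k _ => ?_
    rw [smul_lie, map_smul]; rfl
  have hz : ∀ ξ x w, F ξ x w = 0 := by
    intro ξ x w
    refine eq_zero_of_stable (Submodule.span ℂ (Set.range fun p : L × V => F ξ p.1 p.2)) ?_ ?_
      (Submodule.subset_span ⟨(x, w), rfl⟩)
    · intro z φ hφ
      induction hφ using Submodule.span_induction with
      | mem φ hφ =>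
        obtain ⟨⟨x, w⟩, rfl⟩ := hφ
        have : D.leftAct z (F ξ x w) = F ξ ⁅(z : L), x⁆ w + F ξ x ⁅(z : L), w⁆ := by
          simp only [F, map_sub, map_sum, leftAct_coeff, leftAct_mul, leftAct_adCoeff]
          rw [leibniz_lie, coeff_add, Finset.sum_add_distrib,
            Finset.sum_congr rfl fun k _ => mul_comm (coeff hV _ w) _]
          abel
        change D.leftAct z (F ξ x w) ∈ _
        rw [this]
        exact add_mem (Submodule.subset_span ⟨(⁅(z : L), x⁆, w), rfl⟩)
          (Submodule.subset_span ⟨(x, ⁅(z : L), w⁆), rfl⟩)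
      | zero => simp
      | add φ ψ _ _ h h' => rw [map_add]; exact add_mem h h'
      | smul c φ _ h => rw [map_smul]; exact Submodule.smul_mem _ c h
    · intro φ hφ
      induction hφ using Submodule.span_induction with
      | mem φ hφ =>
        obtain ⟨⟨x, w⟩, rfl⟩ := hφ
        change (F ξ x w).1 1 = 0
        rw [hF, Ad, act_one, act_one]
        simp
      | zero => rfl
      | add φ ψ _ _ h h' => change φ.1 1 + ψ.1 1 = 0; rw [h, h', add_zero]
      | smul c φ _ h => change c * φ.1 1 = 0; rw [h, mul_zero]
  rw [← sub_eq_zero, ← Module.forall_dual_apply_eq_zero_iff ℂ]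
  intro ξ
  rw [map_sub, ← hF, hz]
  rfl

/-! #### Local nilpotency -/

/-- Functions killed by some power of a derivation form a subalgebra: by Leibniz, `d^k φ = 0` and
`d^l ψ = 0` give `d^(k+l) (φ ψ) = 0`. So generators suffice. -/
lemma exists_pow_eq_zero_of_derivation (d : Derivation ℂ D.CN D.CN)
    (h : ∀ ρ i j, ∃ k, (d.toLinearMap ^ k) (coordCN ρ i j) = 0) (φ : D.CN) :
    ∃ k, (d.toLinearMap ^ k) φ = 0 := by
  have hmul : ∀ (m k l : ℕ) (φ ψ : D.CN), k + l = m → (d.toLinearMap ^ k) φ = 0 →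
      (d.toLinearMap ^ l) ψ = 0 → (d.toLinearMap ^ m) (φ * ψ) = 0 := by
    intro m
    induction m with
    | zero =>
      intro k l φ ψ hkl hφ hψ
      have hk : k = 0 := by omega
      subst hk
      have : φ = 0 := hφ
      simp [this]
    | succ m ih =>
      intro k l φ ψ hkl hφ hψ
      rcases k with _ | k
      · have : φ = 0 := hφ
        simp [this]
      rcases l with _ | l
      · have : ψ = 0 := hψ
        simp [this]
      have h1 : d.toLinearMap (φ * ψ) = φ * d.toLinearMap ψ + ψ * d.toLinearMap φ :=
        d.leibniz φ ψ
      rw [pow_succ, Module.End.mul_apply, h1, map_add, mul_comm ψ]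
      rw [ih (k + 1) l φ _ (by omega) hφ (by rwa [pow_succ] at hψ),
        ih k (l + 1) _ ψ (by omega) (by rwa [pow_succ] at hφ) hψ, add_zero]
  induction φ using CN.induction with
  | hc ρ i j => exact h ρ i j
  | hr r => exact ⟨1, by simp⟩
  | ha φ ψ h h' =>
    obtain ⟨k, hk⟩ := h
    obtain ⟨l, hl⟩ := h'
    refine ⟨k + l, ?_⟩
    rw [map_add, pow_add, Module.End.mul_apply, Module.End.mul_apply, hl, map_zero, add_zero,
      ← Module.End.mul_apply, ← pow_add, add_comm, pow_add, Module.End.mul_apply, hk, map_zero]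
  | hm φ ψ h h' =>
    obtain ⟨k, hk⟩ := h
    obtain ⟨l, hl⟩ := h'
    exact ⟨k + l, hmul _ k l φ ψ rfl hk hl⟩

lemma isNilpotent_hom (ρ : MatrixRep H D.X) {α : H.root} {x : L} (hx : x ∈ rootSpace H α.1) :
    IsNilpotent (ρ.hom x) := by
  let f : L →ₗ⁅ℂ⁆ Module.End ℂ (Fin ρ.dim → ℂ) :=
    (Matrix.toLinAlgEquiv' (R := ℂ) (n := Fin ρ.dim)).toAlgHom.toLieHom.comp ρ.hom
  let : LieRingModule L (Fin ρ.dim → ℂ) := LieRingModule.compLieHom _ f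
  have : LieModule ℂ L (Fin ρ.dim → ℂ) := LieModule.compLieHom _ f
  obtain ⟨k, hk⟩ := LieModule.isNilpotent_toEnd_of_mem_rootSpace (M := Fin ρ.dim → ℂ) H
    (root_ne_zero α) hx
  refine ⟨k, ?_⟩
  have h1 : LieModule.toEnd ℂ L (Fin ρ.dim → ℂ) x = Matrix.toLinAlgEquiv' (ρ.hom x) := rfl
  rw [h1, ← map_pow] at hk
  exact (map_eq_zero_iff _ (Matrix.toLinAlgEquiv' (R := ℂ) (n := Fin ρ.dim)).injective).1 hk

/-- On a row of matrix coordinates, powers of `e_i` are given by powers of the nilpotent matrix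
`ρ(e_i)`. Local nilpotency makes the supremum that defines `ε_i` meaningful. -/
lemma exists_eLeft_pow_eq_zero (i : D.I) (φ : D.CN) : ∃ k, (D.eLeft i ^ k) φ = 0 := by
  refine exists_pow_eq_zero_of_derivation (leftDer (D.eN i)) (fun ρ a b => ?_) φ
  obtain ⟨k, hk⟩ := isNilpotent_hom ρ (D.e_mem i)
  refine ⟨k, ?_⟩
  have h1 : ∀ k, ((leftDer (D.eN i)).toLinearMap ^ k) (coordCN ρ a b) =
      ∑ c, (ρ.hom (D.e i) ^ k) c b • coordCN ρ a c := by
    intro k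
    induction k with
    | zero => simp [Matrix.one_apply]
    | succ k ih =>
      rw [pow_succ', Module.End.mul_apply, ih, map_sum]
      simp only [map_smul]
      have : ∀ c, (leftDer (D.eN i)).toLinearMap (coordCN ρ a c) =
        ∑ l, ρ.hom (D.e i) l c • coordCN ρ a l := fun c => leftAct_coordCN (D.eN i) ρ a c
      simp only [this, Finset.smul_sum, smul_smul]
      rw [Finset.sum_comm]
      refine Finset.sum_congr rfl fun c _ => ?_
      rw [← Finset.sum_smul, pow_succ', Matrix.mul_apply]
      congr 1
      exact Finset.sum_congr rfl fun _ _ => mul_comm _ _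
  rw [h1, hk]
  simp

lemma exists_eRight_pow_eq_zero (i : D.I) (φ : D.CN) : ∃ k, (D.eRight i ^ k) φ = 0 := by
  refine exists_pow_eq_zero_of_derivation (rightDer (D.eN i)) (fun ρ a b => ?_) φ
  obtain ⟨k, hk⟩ := isNilpotent_hom ρ (D.e_mem i)
  refine ⟨k, ?_⟩
  have h1 : ∀ k, ((rightDer (D.eN i)).toLinearMap ^ k) (coordCN ρ a b) =
      ∑ c, (ρ.hom (D.e i) ^ k) a c • coordCN ρ c b := by
    intro k
    induction k with
    | zero => simp [Matrix.one_apply]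
    | succ k ih =>
      rw [pow_succ', Module.End.mul_apply, ih, map_sum]
      simp only [map_smul]
      have : ∀ c, (rightDer (D.eN i)).toLinearMap (coordCN ρ c b) =
        ∑ l, ρ.hom (D.e i) c l • coordCN ρ l b := fun c => rightAct_coordCN (D.eN i) ρ c b
      simp only [this, Finset.smul_sum, smul_smul]
      rw [Finset.sum_comm]
      refine Finset.sum_congr rfl fun c _ => ?_
      rw [← Finset.sum_smul, pow_succ, Matrix.mul_apply]
  rw [h1, hk]
  simp

end SemisimpleGroup

/-- The nilpotence degree is characterized by the vanishing of powers. -/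
lemma nilpotenceDegree_le_iff {M : Type*} [AddCommGroup M] [Module ℂ M] {E : Module.End ℂ M}
    {v : M} (hE : ∃ k, (E ^ k) v = 0) (n : ℕ) : nilpotenceDegree E v ≤ n ↔ (E ^ (n + 1)) v = 0 := by
  have hmono : ∀ k l, k ≤ l → (E ^ k) v = 0 → (E ^ l) v = 0 := fun k l h hk =>
    Module.End.pow_map_zero_of_le h hk
  obtain ⟨k, hk⟩ := hE
  have hb : BddAbove {n : ℕ | (E ^ n) v ≠ 0} :=
    ⟨k, fun n hn => le_of_not_gt fun h => hn (hmono k n h.le hk)⟩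
  constructor
  · intro h
    by_contra h1
    have := le_csSup hb h1
    change n + 1 ≤ nilpotenceDegree E v at this
    omega
  · intro h
    by_cases hne : {n : ℕ | (E ^ n) v ≠ 0}.Nonempty
    · refine csSup_le hne fun m hm => ?_
      by_contra h1
      exact hm (hmono (n + 1) m (by omega) h)
    -- This is the case `v = 0`, where the supremum of the empty set is `0`.
    · rw [Set.not_nonempty_iff_eq_empty] at hne
      simp [nilpotenceDegree, hne]

/-! ### The triangular decomposition -/

section Triangular

variable {L : Type u} [LieRing L] [LieAlgebra ℂ L] [FiniteDimensional ℂ L]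
  [LieAlgebra.IsSemisimple ℂ L] {H : LieSubalgebra ℂ L} [H.IsCartanSubalgebra]
  (b : (rootSystem H).Base)

/-- The sum of the positive root spaces. -/
def posRootSum : Submodule ℂ L :=
  ⨆ (α : H.root) (_ : b.IsPos α), (rootSpace H α.1).toSubmodule

variable {b}

lemma mem_posRootSum {α : H.root} (hα : b.IsPos α) {x : L} (hx : x ∈ rootSpace H α.1) :
    x ∈ posRootSum b :=
  (le_iSup₂_of_le (f := fun (α : H.root) (_ : b.IsPos α) => (rootSpace H α.1).toSubmodule)
    α hα le_rfl) hx

lemma posRootSum_induction {p : L → Prop}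
    (hr : ∀ α : H.root, b.IsPos α → ∀ x ∈ rootSpace H α.1, p x)
    (h0 : p 0) (ha : ∀ x y, p x → p y → p (x + y)) {x : L} (hx : x ∈ posRootSum b) : p x := by
  unfold posRootSum at hx
  induction hx using Submodule.iSup_induction' with
  | mem α x hx =>
    by_cases hα : b.IsPos α
    · simp only [hα, iSup_pos] at hx
      exact hr α hα x hx
    · simp only [hα, iSup_neg, not_false_eq_true, Submodule.mem_bot] at hx
      rw [hx]; exact h0
  | zero => exact h0
  | add x y _ _ hx hy => exact ha x y hx hy

lemma lie_mem_posRootSum {x y : L} (hx : x ∈ posRootSum b) (hy : y ∈ posRootSum b) :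
    ⁅x, y⁆ ∈ posRootSum b := by
  refine posRootSum_induction (p := fun x => ⁅x, y⁆ ∈ posRootSum b) (fun α hα x hx => ?_) (by simp)
    (fun x y hx hy => by rw [add_lie]; exact add_mem hx hy) hx
  refine posRootSum_induction (p := fun y => ⁅x, y⁆ ∈ posRootSum b) (fun β hβ y hy => ?_) (by simp)
    (fun x y hx hy => by rw [lie_add]; exact add_mem hx hy) hy
  have h1 := lie_mem_rootSpace_add hx hy
  by_cases h2 : ⁅x, y⁆ = 0
  · rw [h2]; exact zero_mem _
  by_cases h3 : (α.1 + β.1 : H → ℂ) = 0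
  · exfalso
    have h4 : α = negRoot β := by
      apply (rootSystem H).root.injective
      rw [root_negRoot]
      ext h
      exact eq_neg_of_add_eq_zero_left (congrFun h3 h)
    rw [h4, isPos_negRoot] at hα
    exact hα hβ
  · let γ : LieModule.Weight ℂ H L := ⟨α.1 + β.1, fun h => h2 (by
      rw [rootSpace, h] at h1
      simpa using h1)⟩
    have hγ : γ ∈ H.root := Finset.mem_filter.2 ⟨Finset.mem_univ _, h3⟩
    refine mem_posRootSum (α := ⟨γ, hγ⟩) (RootPairing.Base.IsPos.add hα hβ ?_) h1
    ext h
    rfl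

lemma cartan_lie_mem_posRootSum (h : H) {x : L} (hx : x ∈ posRootSum b) :
    ⁅(h : L), x⁆ ∈ posRootSum b := by
  refine posRootSum_induction (p := fun x => ⁅(h : L), x⁆ ∈ posRootSum b)
    (fun α hα x hx => ?_) (by simp)
    (fun x y hx hy => by rw [lie_add]; exact add_mem hx hy) hx
  have h1 : ⁅(h : L), x⁆ = α.1 h • x := lie_eq_smul_of_mem_rootSpace hx h
  rw [h1]
  exact Submodule.smul_mem _ _ (mem_posRootSum hα hx)

lemma killingForm_posRootSum_eq_zero {x y : L} (hx : x ∈ posRootSum b) (hy : y ∈ posRootSum b) :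
    killingForm ℂ L x y = 0 := by
  refine posRootSum_induction (p := fun x => killingForm ℂ L x y = 0)
    (fun α hα x hx => ?_) (by simp)
    (fun x y hx hy => by simp [hx, hy]) hx
  refine posRootSum_induction (p := fun y => killingForm ℂ L x y = 0)
    (fun β hβ y hy => ?_) (by simp)
    (fun x y hx hy => by simp [hx, hy]) hy
  refine killingForm_rootSpace_eq_zero hx hy fun h3 => ?_
  have h4 : α = negRoot β := by
    apply (rootSystem H).root.injective
    rw [root_negRoot]
    ext h
    exact eq_neg_of_add_eq_zero_left (congrFun h3 h)
  rw [h4, isPos_negRoot] at hα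
  exact hα hβ

lemma killingForm_cartan_posRootSum (h : H) {x : L} (hx : x ∈ posRootSum b) :
    killingForm ℂ L (h : L) x = 0 := by
  refine posRootSum_induction (p := fun x => killingForm ℂ L (h : L) x = 0) (fun α hα x hx => ?_)
    (by simp) (fun x y hx hy => by simp [hx, hy]) hx
  refine killingForm_rootSpace_eq_zero (mem_rootSpace_zero h) hx ?_
  rw [zero_add]
  exact root_ne_zero α

variable (b)

/-- The Borel subalgebra spanned by `H` and the negative root spaces. -/
def negBorel : Submodule ℂ L := H.toSubmodule ⊔ posRootSum (oppBase b)

variable {b}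

lemma rootSpace_neg_le (b : (rootSystem H).Base) {α : H.root} (hα : b.IsPos α) :
    (rootSpace H (-α.1)).toSubmodule ≤ posRootSum (oppBase b) := by
  intro x hx
  refine mem_posRootSum (α := negRoot α) ?_ hx
  rw [isPos_oppBase, isPos_negRoot]
  exact not_not.2 hα

/-- As `H` is abelian, commutators in the Borel subalgebra fall into its nilradical. A weight
extended by zero is therefore a character of the Borel subalgebra. -/
lemma lie_mem_posRootSum_oppBase {x y : L} (hx : x ∈ negBorel b) (hy : y ∈ negBorel b) :
    ⁅x, y⁆ ∈ posRootSum (oppBase b) := by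
  obtain ⟨h, hh, x', hx', rfl⟩ := Submodule.mem_sup.1 hx
  obtain ⟨k, hk, y', hy', rfl⟩ := Submodule.mem_sup.1 hy
  have h1 : ⁅h, k⁆ = 0 := by
    have := LieModule.IsTrivial.trivial (⟨h, hh⟩ : H) (⟨k, hk⟩ : H)
    exact congrArg Subtype.val this
  rw [add_lie, lie_add, lie_add, h1, zero_add]
  refine add_mem (cartan_lie_mem_posRootSum ⟨h, hh⟩ hy') (add_mem ?_ (lie_mem_posRootSum hx' hy'))
  rw [← lie_skew]
  exact neg_mem (cartan_lie_mem_posRootSum ⟨k, hk⟩ hx')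

lemma posRootSum_sup_negBorel (b : (rootSystem H).Base) : posRootSum b ⊔ negBorel b = ⊤ :=
  eq_top_of_cartan_le_of_rootSpace_le b _ (le_sup_left.trans le_sup_right)
    (fun _ hα _ hx => Submodule.mem_sup_left (mem_posRootSum hα hx))
    fun _ hα => (rootSpace_neg_le b hα).trans (le_sup_right.trans le_sup_right)

/-- A common element is Killing-orthogonal to `𝔫` and to `H` because it lies in `𝔫`, and to the
negative root spaces because it lies in the opposite Borel subalgebra. Nondegeneracy makes it zero.
-/
lemma isCompl_posRootSum_negBorel (b : (rootSystem H).Base) :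
    IsCompl (posRootSum b) (negBorel b) := by
  refine ⟨?_, codisjoint_iff.2 (posRootSum_sup_negBorel b)⟩
  rw [Submodule.disjoint_def]
  intro x hx hx'
  apply killingForm_ext
  intro z
  rw [map_zero, LinearMap.zero_apply]
  have hz : z ∈ posRootSum b ⊔ (H.toSubmodule ⊔ posRootSum (oppBase b)) := by
    have := posRootSum_sup_negBorel b
    rw [negBorel] at this
    rw [this]; trivial
  obtain ⟨p, hp, z', hz', rfl⟩ := Submodule.mem_sup.1 hz
  obtain ⟨h, hh, q, hq, rfl⟩ := Submodule.mem_sup.1 hz'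
  obtain ⟨k, hk, y, hy, rfl⟩ := Submodule.mem_sup.1 hx'
  have h1 := killingForm_posRootSum_eq_zero hx hp
  have h2 := (killingForm_comm _ _).trans (killingForm_cartan_posRootSum ⟨h, hh⟩ hx)
  have h3 := killingForm_cartan_posRootSum ⟨k, hk⟩ hq
  have h4 := killingForm_posRootSum_eq_zero hy hq
  change killingForm ℂ L (k + y) h = 0 at h2
  change killingForm ℂ L k q = 0 at h3
  simp only [map_add, LinearMap.add_apply] at h1 h2 ⊢
  linear_combination h1 + h2 + h3 + h4

end Triangular

/-! ### The twisted actions of the Lie algebra on the coordinate ring -/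

namespace SemisimpleGroup

attribute [local instance] LieRing.ofAssociativeRing

variable {L : Type u} [LieRing L] [LieAlgebra ℂ L] [FiniteDimensional ℂ L]
  [LieAlgebra.IsSemisimple ℂ L] {H : LieSubalgebra ℂ L} [H.IsCartanSubalgebra]
  {D : SemisimpleGroup H}

lemma isCompl_n_negBorel (D : SemisimpleGroup H) : IsCompl D.n (negBorel D.base) :=
  isCompl_posRootSum_negBorel D.base

/-- The projection of the Lie algebra to `𝔫`. -/
def projN (D : SemisimpleGroup H) : L →ₗ[ℂ] D.n :=
  Submodule.projectionOnto D.n (negBorel D.base) D.isCompl_n_negBorel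

lemma projN_of_mem (x : D.n) : D.projN x = x :=
  Submodule.projectionOnto_apply_left _ _

lemma projN_eq_zero {x : L} (hx : x ∈ negBorel D.base) : D.projN x = 0 :=
  (Submodule.projectionOnto_apply_eq_zero_iff _).2 hx

lemma sub_projN_mem (x : L) : x - D.projN x ∈ negBorel D.base := by
  rw [← Submodule.projectionOnto_apply_eq_zero_iff D.isCompl_n_negBorel]
  change D.projN _ = 0
  rw [map_sub, projN_of_mem, sub_self]

/-- A linear form on `H`, extended by zero to the root spaces. -/
def extendForm (χ : Dual ℂ H) : Dual ℂ L := killingForm ℂ L (dualElt χ : L)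

lemma extendForm_cartan (χ : Dual ℂ H) (h : H) : extendForm χ (h : L) = χ h :=
  killingForm_dualElt χ h

lemma extendForm_posRootSum {b : (rootSystem H).Base} (χ : Dual ℂ H) {x : L}
    (hx : x ∈ posRootSum b) :
    extendForm χ x = 0 :=
  killingForm_cartan_posRootSum _ hx

/-- The operator `φ ↦ R_{p(z)} φ + χ(z) φ`, where `p` is the projection to `𝔫`. -/
def borelOp (D : SemisimpleGroup H) (χ : Dual ℂ H) : L →ₗ[ℂ] Module.End ℂ D.CN :=
  D.rightLin ∘ₗ D.projN + (extendForm χ).smulRight 1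

lemma borelOp_apply (χ : Dual ℂ H) (z : L) (φ : D.CN) :
    D.borelOp χ z φ = D.rightAct (D.projN z) φ + extendForm χ z • φ := rfl

lemma borelOp_lie_negBorel (χ : Dual ℂ H) {x y : L} (hx : x ∈ negBorel D.base)
    (hy : y ∈ negBorel D.base) : D.borelOp χ ⁅x, y⁆ = 0 := by
  ext1 φ
  have h1 := lie_mem_posRootSum_oppBase hx hy
  rw [borelOp_apply, extendForm_posRootSum χ h1, projN_eq_zero (Submodule.mem_sup_right h1),
    ← rightLin_apply]
  simp

/-- The minus sign comes from the antihomomorphism `rightAct`; the scalar parts commute with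
everything and vanish on `⁅𝔫, 𝔫⁆`. -/
lemma borelOp_comm (χ : Dual ℂ H) (x y : L) (φ : D.CN) :
    D.borelOp χ x (D.borelOp χ y φ) - D.borelOp χ y (D.borelOp χ x φ) =
      -D.borelOp χ ⁅(D.projN x : L), (D.projN y : L)⁆ φ := by
  have h1 : ⁅(D.projN x : L), (D.projN y : L)⁆ ∈ D.n :=
    lie_mem_posRootSum (b := D.base) (D.projN x).2 (D.projN y).2
  have h2 : D.projN ⁅(D.projN x : L), (D.projN y : L)⁆ = ⟨_, h1⟩ := projN_of_mem (D := D) ⟨_, h1⟩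
  have h3 := rightAct_lie (z := ⟨_, h1⟩) rfl φ
  have h4 : extendForm χ ⁅(D.projN x : L), (D.projN y : L)⁆ = 0 :=
    extendForm_posRootSum (b := D.base) χ h1
  simp only [borelOp_apply, h2, h3, h4, map_add, map_smul, smul_add, zero_smul]
  rw [smul_comm (extendForm χ x)]
  abel

/-- The action of the Lie algebra on `ℂ[N]` for which `Ψ_λ` is equivariant, when `χ = λ`. -/
def twistedAct (D : SemisimpleGroup H) (χ : Dual ℂ H) (x : L) : Module.End ℂ D.CN :=
  ∑ k, LinearMap.mulLeft ℂ (D.adCoeff k x) ∘ₗ D.borelOp χ (finBasis ℂ L k)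

lemma twistedAct_eq (χ : Dual ℂ H) (x : L) (φ : D.CN) :
    D.twistedAct χ x φ = ∑ k, D.adCoeff k x * D.borelOp χ (finBasis ℂ L k) φ := by
  simp [twistedAct]

lemma linearMap_apply_Ad (F : L →ₗ[ℂ] D.CN) (g : D.N) (x : L) :
    (F (D.Ad g x)).1 g = ∑ k, (D.adCoeff k x).1 g * (F (finBasis ℂ L k)).1 g := by
  rw [Ad_eq_sum, map_sum, CN.sum_apply]
  refine Finset.sum_congr rfl fun k _ => ?_
  rw [map_smul]
  rfl

/-- This is the pointwise meaning of the twisted action: `x` is moved to the left of `g` as `Ad(g)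
x`, whose `𝔫`-part then differentiates while its Borel part acts through the character. -/
lemma twistedAct_apply (χ : Dual ℂ H) (x : L) (φ : D.CN) (g : D.N) :
    (D.twistedAct χ x φ).1 g = (D.borelOp χ (D.Ad g x) φ).1 g := by
  rw [twistedAct_eq, CN.sum_apply]
  exact (linearMap_apply_Ad ((D.borelOp χ).flip φ) g x).symm

/-- Differentiating along `exp(t z) g` hits both `Ad(g) x`, whose derivative is `⁅z, Ad(g) x⁆`, and
the function. -/
lemma rightAct_twistedAct_apply (χ : Dual ℂ H) (z : D.n) (x : L) (φ : D.CN) (g : D.N) :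
    (D.rightAct z (D.twistedAct χ x φ)).1 g = (D.borelOp χ ⁅(z : L), D.Ad g x⁆ φ).1 g +
      (D.rightAct z (D.borelOp χ (D.Ad g x) φ)).1 g := by
  have h1 := linearMap_apply_Ad (D.rightAct z ∘ₗ (D.borelOp χ).flip φ) g x
  have h2 : (D.borelOp χ ⁅(z : L), D.Ad g x⁆ φ).1 g =
      ∑ k, (D.rightAct z (D.adCoeff k x)).1 g * (D.borelOp χ (finBasis ℂ L k) φ).1 g := by
    conv_lhs => rw [← (finBasis ℂ L).sum_repr ⁅(z : L), D.Ad g x⁆]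
    rw [map_sum, LinearMap.sum_apply, CN.sum_apply]
    refine Finset.sum_congr rfl fun k _ => ?_
    rw [map_smul, rightAct_adCoeff_apply]
    rfl
  change (D.rightAct z (D.borelOp χ (D.Ad g x) φ)).1 g = _ at h1
  rw [h1, h2, twistedAct_eq, map_sum, CN.sum_apply, ← Finset.sum_add_distrib]
  refine Finset.sum_congr rfl fun k _ => ?_
  rw [rightAct_mul, add_comm, mul_comm (D.borelOp χ _ φ)]
  rfl

lemma borelOp_twistedAct_apply (χ : Dual ℂ H) (z x : L) (φ : D.CN) (g : D.N) :
    (D.borelOp χ z (D.twistedAct χ x φ)).1 g =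
      (D.borelOp χ ⁅(D.projN z : L), D.Ad g x⁆ φ).1 g +
      (D.borelOp χ z (D.borelOp χ (D.Ad g x) φ)).1 g := by
  rw [borelOp_apply χ z, borelOp_apply χ z]
  change _ + extendForm χ z * (D.twistedAct χ x φ).1 g = _ + (_ +
    extendForm χ z * (D.borelOp χ (D.Ad g x) φ).1 g)
  rw [rightAct_twistedAct_apply, twistedAct_apply, add_assoc]

/-- At a fixed `g` put `A = Ad(g) x` and `B = Ad(g) y`, and let `p` be the projection to `𝔫`. The
terms match by expanding `⁅A - pA, B - pB⁆`, a commutator in the Borel subalgebra, on which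
`borelOp` vanishes. -/
lemma twistedAct_lie (χ : Dual ℂ H) (x y : L) (φ : D.CN) :
    D.twistedAct χ ⁅x, y⁆ φ =
      D.twistedAct χ x (D.twistedAct χ y φ) - D.twistedAct χ y (D.twistedAct χ x φ) := by
  ext g
  change _ = (D.twistedAct χ x (D.twistedAct χ y φ)).1 g -
    (D.twistedAct χ y (D.twistedAct χ x φ)).1 g
  rw [twistedAct_apply, twistedAct_apply, twistedAct_apply, borelOp_twistedAct_apply,
    borelOp_twistedAct_apply, Ad, act_lie]
  change (D.borelOp χ ⁅D.Ad g x, D.Ad g y⁆ φ).1 g = _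
  generalize D.Ad g x = A
  generalize D.Ad g y = B
  have h1 := congrArg (fun φ : D.CN => φ.1 g) (borelOp_comm χ A B φ)
  change (D.borelOp χ A (D.borelOp χ B φ)).1 g - (D.borelOp χ B (D.borelOp χ A φ)).1 g =
    -(D.borelOp χ ⁅(D.projN A : L), (D.projN B : L)⁆ φ).1 g at h1
  have h2 := borelOp_lie_negBorel (D := D) χ (sub_projN_mem A) (sub_projN_mem B)
  have h3 : ⁅A - (D.projN A : L), B - (D.projN B : L)⁆ = ⁅A, B⁆ - (⁅(D.projN A : L), B⁆ -
      ⁅(D.projN B : L), A⁆ - ⁅(D.projN A : L), (D.projN B : L)⁆) := by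
    rw [sub_lie, lie_sub, lie_sub, ← lie_skew A (D.projN B : L)]
    abel
  rw [h3, map_sub, sub_eq_zero, map_sub, map_sub] at h2
  rw [h2]
  change (D.borelOp χ ⁅(D.projN A : L), B⁆ φ).1 g - (D.borelOp χ ⁅(D.projN B : L), A⁆ φ).1 g -
    (D.borelOp χ ⁅(D.projN A : L), (D.projN B : L)⁆ φ).1 g = _
  linear_combination -h1

lemma leftAct_lie {x y z : D.n} (h : (z : L) = ⁅(x : L), (y : L)⁆) (φ : D.CN) :
    D.leftAct z φ = D.leftAct x (D.leftAct y φ) - D.leftAct y (D.leftAct x φ) := by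
  have : leftDer z = ⁅leftDer x, leftDer y⁆ := by
    refine derivation_ext fun ρ i j => ?_
    rw [Derivation.commutator_apply]
    simp only [leftDer_apply, leftAct_coordCN, map_sum, map_smul, h, LieHom.map_lie,
      Ring.lie_def, Matrix.sub_apply, Matrix.mul_apply, sub_smul, Finset.sum_smul,
      Finset.sum_sub_distrib, Finset.smul_sum, smul_smul]
    congr 1
    · rw [Finset.sum_comm]
      exact Finset.sum_congr rfl fun _ _ => Finset.sum_congr rfl fun _ _ => by rw [mul_comm]
    · rw [Finset.sum_comm]
      exact Finset.sum_congr rfl fun _ _ => Finset.sum_congr rfl fun _ _ => by rw [mul_comm]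
  exact DFunLike.congr_fun this φ

lemma leftAct_borelOp (χ : Dual ℂ H) (y : D.n) (z : L) (φ : D.CN) :
    D.leftAct y (D.borelOp χ z φ) = D.borelOp χ z (D.leftAct y φ) := by
  rw [borelOp_apply, borelOp_apply, map_add, map_smul, leftAct_rightAct_comm]

lemma leftAct_twistedAct (χ : Dual ℂ H) (y : D.n) (x : L) (φ : D.CN) :
    D.leftAct y (D.twistedAct χ x φ) =
      D.twistedAct χ ⁅(y : L), x⁆ φ + D.twistedAct χ x (D.leftAct y φ) := by
  simp only [twistedAct_eq, map_sum, leftAct_mul, leftAct_adCoeff, leftAct_borelOp]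
  rw [Finset.sum_add_distrib, add_comm]
  congr 1
  exact Finset.sum_congr rfl fun _ _ => mul_comm _ _

/-- The twisted action extends the left action of `𝔫`. -/
lemma twistedAct_n (χ : Dual ℂ H) (z : D.n) (φ : D.CN) :
    D.twistedAct χ (z : L) φ = D.leftAct z φ := by
  let F : D.n → D.CN → D.CN := fun z φ => D.twistedAct χ (z : L) φ - D.leftAct z φ
  change D.twistedAct χ (z : L) φ = D.leftAct z φ
  rw [← sub_eq_zero]
  refine eq_zero_of_stable (Submodule.span ℂ (Set.range fun p : D.n × D.CN => F p.1 p.2)) ?_ ?_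
      (Submodule.subset_span ⟨(z, φ), rfl⟩)
  · intro y φ hφ
    induction hφ using Submodule.span_induction with
    | mem φ hφ =>
      obtain ⟨⟨z, φ⟩, rfl⟩ := hφ
      have hyz : ⁅(y : L), (z : L)⁆ ∈ D.n := lie_mem_posRootSum (b := D.base) y.2 z.2
      have : D.leftAct y (F z φ) = F ⟨_, hyz⟩ φ + F z (D.leftAct y φ) := by
        simp only [F, map_sub, leftAct_twistedAct]
        rw [leftAct_lie (x := y) (y := z) (z := ⟨_, hyz⟩) rfl]
        abel
      change D.leftAct y (F z φ) ∈ _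
      rw [this]
      exact add_mem (Submodule.subset_span ⟨(⟨_, hyz⟩, φ), rfl⟩)
        (Submodule.subset_span ⟨(z, D.leftAct y φ), rfl⟩)
    | zero => simp
    | add φ ψ _ _ h h' => rw [map_add]; exact add_mem h h'
    | smul c φ _ h => rw [map_smul]; exact Submodule.smul_mem _ c h
  · intro φ hφ
    induction hφ using Submodule.span_induction with
    | mem φ hφ =>
      obtain ⟨⟨z, φ⟩, rfl⟩ := hφ
      -- At the identity `Ad` is trivial and the left and right derivatives coincide.
      change (D.twistedAct χ (z : L) φ).1 1 - (D.leftAct z φ).1 1 = 0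
      rw [twistedAct_apply, Ad, act_one, Module.End.one_apply, borelOp_apply, projN_of_mem,
        extendForm_posRootSum (b := D.base) χ z.2, zero_smul, add_zero, sub_eq_zero]
      refine (hasDerivAt_rightAct z φ 1).unique ?_
      have h := hasDerivAt_leftAct z φ 1
      simp only [one_mul] at h
      simpa only [mul_one] using h
    | zero => rfl
    | add φ ψ _ _ h h' => change φ.1 1 + ψ.1 1 = 0; rw [h, h', add_zero]
    | smul c φ _ h => change c * φ.1 1 = 0; rw [h, mul_zero]

/-! ### Equivariance and injectivity of `Ψ_λ`. -/

section Psi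

variable {V : Type v} [AddCommGroup V] [Module ℂ V] [FiniteDimensional ℂ V]
  [LieRingModule L V] [LieModule ℂ L V] {Λ : D.DominantWeight} (R : D.HighestWeightRep V Λ)

lemma HighestWeightRep.psi_eq (w : V) : R.psi w = coeff R.weightsIn R.form w := rfl

lemma HighestWeightRep.form_lie_negBorel {y : L} (hy : y ∈ negBorel D.base) (w : V) :
    R.form ⁅y, w⁆ = extendForm Λ.weight y * R.form w := by
  obtain ⟨h, hh, y', hy', rfl⟩ := Submodule.mem_sup.1 hy
  have h1 : R.form ⁅y', w⁆ = 0 := by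
    refine posRootSum_induction (p := fun y => R.form ⁅y, w⁆ = 0) (fun α hα x hx => ?_) (by simp)
      (fun x y hx hy => by rw [add_lie, map_add, hx, hy, add_zero]) hy'
    rw [isPos_oppBase, ← isPos_negRoot] at hα
    refine R.form_lie_neg hα ?_ w
    have : (-(negRoot α).1 : H → ℂ) = α.1 := by
      funext h
      exact neg_neg (α.1 h)
    rwa [this]
  rw [add_lie, map_add, h1, map_add, extendForm_posRootSum _ hy', add_zero, add_zero]
  have h2 := R.form_lie_cartan ⟨h, hh⟩ w
  have h3 := extendForm_cartan Λ.weight ⟨h, hh⟩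
  change extendForm Λ.weight h = _ at h3
  rw [h3]
  exact h2

/-- In `v_λ^*(g x w) = v_λ^*((Ad(g) x) g w)` the Borel part of `Ad(g) x` acts on `v_λ^*` through the
character `λ`, and the `𝔫`-part is a right derivative. -/
lemma HighestWeightRep.psi_lie (x : L) (w : V) :
    R.psi ⁅x, w⁆ = D.twistedAct Λ.weight x (R.psi w) := by
  ext g
  rw [twistedAct_apply, borelOp_apply, psi_eq, psi_eq, coeff_apply, act_lie, rightAct_coeff]
  change R.form ⁅D.Ad g x, _⁆ = R.form ⁅(D.projN (D.Ad g x) : L), D.act R.weightsIn g w⁆ +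
    extendForm Λ.weight (D.Ad g x) * R.form (D.act R.weightsIn g w)
  generalize D.Ad g x = A
  have h1 := R.form_lie_negBorel (sub_projN_mem A) (D.act R.weightsIn g w)
  rw [sub_lie, map_sub, map_sub, extendForm_posRootSum (b := D.base) _ (D.projN A).2] at h1
  linear_combination h1

lemma HighestWeightRep.leftAct_psi (x : D.n) (w : V) :
    D.leftAct x (R.psi w) = R.psi ⁅(x : L), w⁆ := by
  rw [psi_eq, leftAct_coeff]; rfl

lemma HighestWeightRep.psi_apply_one (w : V) : (R.psi w).1 1 = R.form w := coeff_apply_one _ _ _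

/-- The kernel is a submodule by `psi_lie`, and it misses `v_λ` because `Ψ_λ(v_λ)` takes the value
`1` at the identity. -/
lemma HighestWeightRep.psi_injective : Function.Injective R.psi := by
  rw [← LinearMap.ker_eq_bot]
  let K : LieSubmodule ℂ L V :=
    { LinearMap.ker R.psi with
      lie_mem := fun {x w} hw => by
        change R.psi ⁅x, w⁆ = 0
        have hw : R.psi w = 0 := hw
        rw [psi_lie, hw, map_zero] }
  have hK : LinearMap.ker R.psi = K.toSubmodule := rfl
  rcases R.eq_bot_or_eq_top K with h | h
  · rw [hK, h]; rfl
  · exfalso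
    have h1 : R.vec ∈ K := by rw [h]; trivial
    have h2 : R.psi R.vec = 0 := h1
    have h3 := R.psi_apply_one R.vec
    rw [h2, R.form_vec] at h3
    exact zero_ne_one h3

end Psi

end SemisimpleGroup

/-! ### Singular vectors -/

section Singular

attribute [local instance] LieRing.ofAssociativeRing

variable {L : Type u} [LieRing L] [LieAlgebra ℂ L] [FiniteDimensional ℂ L]
  [LieAlgebra.IsSemisimple ℂ L] {H : LieSubalgebra ℂ L} [H.IsCartanSubalgebra]
  {M : Type*} [AddCommGroup M] [Module ℂ M] [LieRingModule L M] [LieModule ℂ L M]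
  {M' : Type*} [AddCommGroup M'] [Module ℂ M'] [LieRingModule L M'] [LieModule ℂ L M']
  {b : (rootSystem H).Base} {χ : Dual ℂ H} {q : M}

lemma map_toEnd_pow (T : M →ₗ⁅ℂ, L⁆ M') (x : L) (k : ℕ) (m : M) :
    T ((LieModule.toEnd ℂ L M x ^ k) m) = (LieModule.toEnd ℂ L M' x ^ k) (T m) := by
  induction k with
  | zero => rfl
  | succ k ih =>
    rw [pow_succ', pow_succ', Module.End.mul_apply, Module.End.mul_apply, ← ih,
      LieModule.toEnd_apply_apply, LieModule.toEnd_apply_apply, T.map_lie]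

/-- A difference of two distinct simple roots is neither a root nor zero. -/
lemma lie_eq_zero_of_simple_ne {i j : H.root} (hi : i ∈ b.support) (hj : j ∈ b.support)
    (hij : i ≠ j) {x y : L} (hx : x ∈ rootSpace H i.1) (hy : y ∈ rootSpace H (-j.1)) :
    ⁅x, y⁆ = 0 := by
  by_contra h2
  have h1 := lie_mem_rootSpace_add hx hy
  have h3 : (i.1 + -j.1 : H → ℂ) ≠ 0 := by
    intro h
    apply hij
    apply (rootSystem H).root.injective
    ext h'
    have := congrFun h h'
    exact add_neg_eq_zero.1 this
  let γ : LieModule.Weight ℂ H L := ⟨i.1 + -j.1, fun h => h2 (by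
    rw [rootSpace, h] at h1
    simpa using h1)⟩
  have hγ : γ ∈ H.root := Finset.mem_filter.2 ⟨Finset.mem_univ _, h3⟩
  refine b.sub_notMem_range_root hi hj ⟨⟨γ, hγ⟩, ?_⟩
  ext h'
  exact (sub_eq_add_neg _ _).symm

lemma IsHighestWeightVector.pow_mem (hq : IsHighestWeightVector b χ q) (i : b.support) {f : L}
    (hf : f ∈ rootSpace H (-(i : H.root).1)) (k : ℕ) : (LieModule.toEnd ℂ L M f ^ k) q ∈
      eigenWeightSpace H M (χ - k • (rootSystem H).root (i : H.root)) := by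
  induction k with
  | zero => simpa using hq.mem
  | succ k ih =>
    rw [pow_succ', Module.End.mul_apply]
    have := lie_mem_eigenWeightSpace (α := -(rootSystem H).root (i : H.root)) ih (by simpa using hf)
    rw [succ_nsmul, ← sub_sub, sub_eq_add_neg _ ((rootSystem H).root (i : H.root))]
    exact this

/-- The singular vectors `f_i^{m_i+1} q`. -/
lemma IsHighestWeightVector.singular (hq : IsHighestWeightVector b χ q) (i : b.support) {h e f : L}
    (t : IsSl2Triple h e f) (he : e ∈ rootSpace H (i : H.root).1)
    (hf : f ∈ rootSpace H (-(i : H.root).1)) (m : ℕ) (hm : ⁅h, q⁆ = (m : ℂ) • q) :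
    IsHighestWeightVector b (χ - (m + 1) • (rootSystem H).root (i : H.root))
      ((LieModule.toEnd ℂ L M f ^ (m + 1)) q) := by
  refine isHighestWeightVector_of_simple (hq.pow_mem i hf _) fun j hj x hx => ?_
  by_cases hq0 : q = 0
  · simp [hq0]
  by_cases hij : j = i
  · subst hij
    obtain ⟨c, rfl⟩ := mem_span_singleton_of_mem_rootSpace he t.e_ne_zero hx
    have P : t.HasPrimitiveVectorWith q (m : ℂ) :=
      ⟨hq0, hm, hq.lie_pos _ (RootPairing.Base.isPos_of_mem_support hj) e he⟩
    -- The exponent `m + 1` is the one for which the factor in the `sl₂` relation becomes `m - m`.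
    rw [smul_lie, P.lie_e_pow_succ_toEnd_f, sub_self, mul_zero, zero_smul, smul_zero]
  · have hxf := lie_eq_zero_of_simple_ne hj i.2 hij hx hf
    have : ∀ k, ⁅x, (LieModule.toEnd ℂ L M f ^ k) q⁆ = 0 := by
      intro k
      induction k with
      | zero => exact hq.lie_pos _ (RootPairing.Base.isPos_of_mem_support hj) x hx
      | succ k ih =>
        rw [pow_succ', Module.End.mul_apply, LieModule.toEnd_apply_apply, leibniz_lie, hxf, ih,
          zero_lie, lie_zero, add_zero]
    exact this _

/-- The kernel of a homomorphism from a highest weight module is contained in any submodule modulo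
which the module becomes integrable. -/
lemma IsHighestWeightVector.lieSpan_inf_ker_le (hq : IsHighestWeightVector b χ q)
    (T : M →ₗ⁅ℂ, L⁆ M') (hT : T q ≠ 0) (K : LieSubmodule ℂ L M) (hK : K ≤ T.ker)
    (hint : ∀ i : b.support, ∀ f ∈ rootSpace H (-(i : H.root).1),
      ∃ k, (LieModule.toEnd ℂ L M f ^ k) q ∈ K) :
    LieSubmodule.lieSpan ℂ L {q} ⊓ T.ker ≤ K := by
  let π := LieSubmodule.Quotient.mk' K
  have hπ : ∀ m, π m = 0 ↔ m ∈ K := fun m => LieSubmodule.Quotient.mk_eq_zero K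
  have h1 : IsHighestWeightVector b χ (π q) := by
    refine ⟨fun h => ?_, fun α hα x hx => ?_⟩
    · rw [← π.map_lie, hq.mem h, map_smul]
    · rw [← π.map_lie, hq.lie_pos α hα x hx, map_zero]
  have hS : LieSubmodule.map π (LieSubmodule.lieSpan ℂ L {q}) ≤
      LieSubmodule.lieSpan ℂ L {π q} := by
    rw [LieSubmodule.map_le_iff_le_comap, LieSubmodule.lieSpan_le, Set.singleton_subset_iff]
    exact LieSubmodule.subset_lieSpan rfl
  have h2 := h1.eq_bot_or_eq_lieSpan (fun i f hf => by
    obtain ⟨k, hk⟩ := hint i f hf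
    exact ⟨k, by rw [← map_toEnd_pow, hπ]; exact hk⟩)
    (LieSubmodule.map π (LieSubmodule.lieSpan ℂ L {q} ⊓ T.ker))
    ((LieSubmodule.map_mono inf_le_left).trans hS)
  rcases h2 with h2 | h2
  · rw [LieSubmodule.Quotient.map_mk'_eq_bot_le] at h2
    exact h2
  -- If the kernel filled the quotient by `K`, then `q` would be congruent modulo `K` to an element
  -- of the kernel, and so would itself lie in the kernel.
  · exfalso
    have h3 : π q ∈ LieSubmodule.lieSpan ℂ L {π q} := LieSubmodule.subset_lieSpan rfl
    rw [← h2] at h3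
    obtain ⟨a, ha, haq⟩ := (LieSubmodule.mem_map _).1 h3
    rw [← sub_eq_zero, ← map_sub, hπ] at haq
    have h4 : T (a - q) = 0 := hK haq
    have h5 : T a = 0 := ha.2
    rw [map_sub, h5, zero_sub, neg_eq_zero] at h4
    exact hT h4

end Singular

/-! ### The image of `Ψ_λ` -/

namespace SemisimpleGroup

attribute [local instance] LieRing.ofAssociativeRing

variable {L : Type u} [LieRing L] [LieAlgebra ℂ L] [FiniteDimensional ℂ L]
  [LieAlgebra.IsSemisimple ℂ L] {H : LieSubalgebra ℂ L} [H.IsCartanSubalgebra]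
  {D : SemisimpleGroup H}

/-- The coordinate ring with the twisted action of the Lie algebra. -/
def TwistedCN (D : SemisimpleGroup H) (_ : Dual ℂ H) : Type u := D.CN

instance (χ : Dual ℂ H) : AddCommGroup (TwistedCN D χ) := inferInstanceAs (AddCommGroup D.CN)

instance (χ : Dual ℂ H) : Module ℂ (TwistedCN D χ) := inferInstanceAs (Module ℂ D.CN)

lemma twistedAct_add (χ : Dual ℂ H) (x y : L) (φ : D.CN) :
    D.twistedAct χ (x + y) φ = D.twistedAct χ x φ + D.twistedAct χ y φ := by
  ext g
  change _ = (D.twistedAct χ x φ).1 g + (D.twistedAct χ y φ).1 g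
  rw [twistedAct_apply, twistedAct_apply, twistedAct_apply, map_add, map_add]
  rfl

lemma twistedAct_smul (χ : Dual ℂ H) (c : ℂ) (x : L) (φ : D.CN) :
    D.twistedAct χ (c • x) φ = c • D.twistedAct χ x φ := by
  ext g
  change _ = c * (D.twistedAct χ x φ).1 g
  rw [twistedAct_apply, twistedAct_apply, map_smul, map_smul]
  rfl

instance (χ : Dual ℂ H) : LieRingModule L (TwistedCN D χ) where
  bracket x φ := D.twistedAct χ x φ
  add_lie := twistedAct_add χ
  lie_add x φ ψ := map_add (D.twistedAct χ x) φ ψ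
  leibniz_lie x y φ := (sub_eq_iff_eq_add.1 (twistedAct_lie χ x y φ).symm)

instance (χ : Dual ℂ H) : LieModule ℂ L (TwistedCN D χ) where
  smul_lie := twistedAct_smul χ
  lie_smul c x φ := map_smul (D.twistedAct χ x) c φ

/-- The identity map to the coordinate ring with the twisted action. -/
def toTwisted (χ : Dual ℂ H) : D.CN →ₗ[ℂ] TwistedCN D χ := LinearMap.id

lemma lie_toTwisted (χ : Dual ℂ H) (x : L) (φ : D.CN) :
    ⁅x, toTwisted χ φ⁆ = toTwisted χ (D.twistedAct χ x φ) := rfl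

lemma lie_n_toTwisted (χ : Dual ℂ H) (x : D.n) (φ : D.CN) :
    ⁅(x : L), toTwisted χ φ⁆ = toTwisted χ (D.leftAct x φ) := by
  rw [lie_toTwisted, twistedAct_n]

/-- Evaluation at the identity. -/
def evalOne (D : SemisimpleGroup H) (χ : Dual ℂ H) : TwistedCN D χ →ₗ[ℂ] ℂ where
  toFun φ := (show D.CN from φ).1 1
  map_add' _ _ := rfl
  map_smul' _ _ := rfl

lemma evalOne_apply (χ : Dual ℂ H) (φ : D.CN) : D.evalOne χ (toTwisted χ φ) = φ.1 1 := rfl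

lemma lie_evalOne_apply (χ : Dual ℂ H) (x : L) (φ : D.CN) :
    ⁅x, D.evalOne χ⁆ (toTwisted χ φ) =
      -(D.rightAct (D.projN x) φ).1 1 - extendForm χ x * φ.1 1 := by
  rw [Module.Dual.lie_apply, lie_toTwisted, evalOne_apply, twistedAct_apply, Ad, act_one,
    Module.End.one_apply, borelOp_apply]
  exact neg_add' _ _

/-- At `g = 1` the twisted action of the Borel part is multiplication by the character, so
evaluation at `1` is an eigenvector for `H` and is killed by the negative root spaces. -/
lemma isHighestWeightVector_evalOne (χ : Dual ℂ H) :
    IsHighestWeightVector (oppBase D.base) (-χ) (D.evalOne χ) := by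
  refine ⟨fun h => LinearMap.ext fun φ => ?_, fun α hα x hx => LinearMap.ext fun φ => ?_⟩
  · refine (lie_evalOne_apply χ _ φ).trans ?_
    rw [projN_eq_zero (Submodule.mem_sup_left h.2), ← rightLin_apply, map_zero,
      extendForm_cartan]
    change -(0 : ℂ) - _ = (-χ) h * (show D.CN from φ).1 1
    rw [LinearMap.neg_apply]
    ring
  · refine (lie_evalOne_apply χ _ φ).trans ?_
    have h1 : x ∈ posRootSum (oppBase D.base) := mem_posRootSum hα hx
    rw [projN_eq_zero (Submodule.mem_sup_right h1), ← rightLin_apply, map_zero,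
      extendForm_posRootSum _ h1]
    change -(0 : ℂ) - 0 * _ = 0
    ring

/-- At the identity a single left derivative equals the right one; since the two actions commute,
factors can be exchanged one at a time. -/
lemma leftAct_pow_apply_one (x : D.n) (k : ℕ) (φ : D.CN) :
    ((D.leftAct x ^ k) φ).1 1 = ((D.rightAct x ^ k) φ).1 1 := by
  have h0 : ∀ φ : D.CN, (D.leftAct x φ).1 1 = (D.rightAct x φ).1 1 := by
    intro φ
    refine HasDerivAt.unique ?_ (hasDerivAt_rightAct x φ 1)
    have h := hasDerivAt_leftAct x φ 1
    simp only [one_mul] at h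
    simpa only [mul_one] using h
  have hc : ∀ (k : ℕ) (φ : D.CN), D.leftAct x ((D.rightAct x ^ k) φ) =
      (D.rightAct x ^ k) (D.leftAct x φ) := by
    intro k
    induction k with
    | zero => intro φ; rfl
    | succ k ih =>
      intro φ
      rw [pow_succ, Module.End.mul_apply, ih, leftAct_rightAct_comm, Module.End.mul_apply]
  induction k generalizing φ with
  | zero => rfl
  | succ k ih =>
    rw [pow_succ, Module.End.mul_apply, ih, ← hc, h0, pow_succ', Module.End.mul_apply]

/-- This is the link to the operators `e_i^*`: powers of `e_i` on the functional `q` compute right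
derivatives at `1`, up to the sign of the dual action. -/
lemma toEnd_pow_evalOne_apply (χ : Dual ℂ H) (x : D.n) (k : ℕ) (φ : D.CN) :
    (LieModule.toEnd ℂ L (TwistedCN D χ →ₗ[ℂ] ℂ) (x : L) ^ k) (D.evalOne χ) (toTwisted χ φ) =
      (-1) ^ k * ((D.rightAct x ^ k) φ).1 1 := by
  have key : ∀ (k : ℕ) (a : TwistedCN D χ →ₗ[ℂ] ℂ) (φ : D.CN),
      (LieModule.toEnd ℂ L (TwistedCN D χ →ₗ[ℂ] ℂ) (x : L) ^ k) a (toTwisted χ φ) =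
        (-1) ^ k * a (toTwisted χ ((D.leftAct x ^ k) φ)) := by
    intro k
    induction k with
    | zero => intro a φ; simp
    | succ k ih =>
      intro a φ
      rw [pow_succ, Module.End.mul_apply, ih, LieModule.toEnd_apply_apply, Module.Dual.lie_apply,
        lie_n_toTwisted, pow_succ' (D.leftAct x), Module.End.mul_apply]
      ring
  rw [key, evalOne_apply, leftAct_pow_apply_one]

section Range

variable {V : Type v} [AddCommGroup V] [Module ℂ V] [FiniteDimensional ℂ V]
  [LieRingModule L V] [LieModule ℂ L V] {Λ : D.DominantWeight} (R : D.HighestWeightRep V Λ)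

lemma mem_oppBase_of_I (i : D.I) : negRoot (i : H.root) ∈ (oppBase D.base).support := by
  rw [mem_oppBase_support, negRoot_negRoot]
  exact i.2

lemma e_mem_neg_negRoot (i : D.I) : D.e i ∈ rootSpace H (-(negRoot (i : H.root)).1) := by
  have : (-(negRoot (i : H.root)).1 : H → ℂ) = (i : H.root).1 := by
    funext h
    exact neg_neg ((i : H.root).1 h)
  rw [this]
  exact D.e_mem i

lemma f_mem_negRoot (i : D.I) : D.f i ∈ rootSpace H (negRoot (i : H.root)).1 := D.f_mem i

lemma exists_I_of_oppBase (j : (oppBase D.base).support) : ∃ i : D.I, negRoot (i : H.root) = j :=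
  ⟨⟨negRoot j, (mem_oppBase_support _ _).1 j.2⟩, negRoot_negRoot _⟩

/-- The lowest weight vector `q` of weight `-λ` yields singular vectors. -/
lemma isHighestWeightVector_toEnd_e_pow {M : Type*} [AddCommGroup M] [Module ℂ M]
    [LieRingModule L M] [LieModule ℂ L M] {q : M}
    (hq : IsHighestWeightVector (oppBase D.base) (-Λ.weight) q) (i : D.I) :
    ∃ χ, IsHighestWeightVector (oppBase D.base) χ
      ((LieModule.toEnd ℂ L M (D.e i) ^ (Λ.label i + 1)) q) := by
  refine ⟨_, hq.singular ⟨negRoot (i : H.root), mem_oppBase_of_I i⟩ (sl2Triple i).symm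
    (f_mem_negRoot i) (e_mem_neg_negRoot i) (Λ.label i) ?_⟩
  rw [neg_lie, hq.mem, LinearMap.neg_apply, neg_smul, neg_neg, Λ.weight_simpleCoroot]

/-- For the opposite `sl₂`-triple, `e_i` is the lowering operator and `q` is primitive with
eigenvalue `Λ.label i`; finite dimension gives the vanishing. -/
lemma toEnd_e_pow_eq_zero {M : Type*} [AddCommGroup M] [Module ℂ M] [FiniteDimensional ℂ M]
    [LieRingModule L M] [LieModule ℂ L M] {q : M}
    (hq : IsHighestWeightVector (oppBase D.base) (-Λ.weight) q) (i : D.I) :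
    (LieModule.toEnd ℂ L M (D.e i) ^ (Λ.label i + 1)) q = 0 := by
  by_cases hq0 : q = 0
  · simp [hq0]
  have P : (sl2Triple i).symm.HasPrimitiveVectorWith q (Λ.label i : ℂ) := by
    refine ⟨hq0, ?_, hq.lie_pos _ (RootPairing.Base.isPos_of_mem_support (mem_oppBase_of_I i)) _
      (f_mem_negRoot i)⟩
    rw [neg_lie, hq.mem, LinearMap.neg_apply, neg_smul, neg_neg, Λ.weight_simpleCoroot]
  exact P.pow_toEnd_f_eq_zero_of_eq_nat rfl

lemma eRight_pow_coeff (hV : WeightsIn H D.X V) (i : D.I) (k : ℕ) (ξ : Dual ℂ V) (w : V) :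
    (D.eRight i ^ k) (coeff hV ξ w) =
      coeff hV ((-1 : ℂ) ^ k • (LieModule.toEnd ℂ L (V →ₗ[ℂ] ℂ) (D.e i) ^ k) ξ) w := by
  induction k generalizing ξ with
  | zero => simp
  | succ k ih =>
    have h1 : ξ ∘ₗ LieModule.toEnd ℂ L V (D.e i) = -⁅D.e i, ξ⁆ := by
      ext m
      rw [LinearMap.neg_apply, Module.Dual.lie_apply, neg_neg]
      rfl
    rw [pow_succ, Module.End.mul_apply, eRight, rightAct_coeff, ← eRight, ih]
    congr 1
    change (-1 : ℂ) ^ k • _ = _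
    change (-1 : ℂ) ^ k • (LieModule.toEnd ℂ L (V →ₗ[ℂ] ℂ) (D.e i) ^ k)
      (ξ ∘ₗ LieModule.toEnd ℂ L V (D.e i)) = _
    rw [h1, map_neg, pow_succ (LieModule.toEnd ℂ L (V →ₗ[ℂ] ℂ) (D.e i)), Module.End.mul_apply,
      pow_succ]
    simp

lemma HighestWeightRep.eRight_pow_psi (i : D.I) (w : V) :
    (D.eRight i ^ (Λ.label i + 1)) (R.psi w) = 0 := by
  rw [psi_eq, eRight_pow_coeff, toEnd_e_pow_eq_zero R.isHighestWeightVector_form, smul_zero]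
  rfl

/-- The transpose of `Ψ_λ`. -/
def HighestWeightRep.dualPsi : (TwistedCN D Λ.weight →ₗ[ℂ] ℂ) →ₗ⁅ℂ, L⁆ (V →ₗ[ℂ] ℂ) where
  toFun a := a ∘ₗ toTwisted Λ.weight ∘ₗ R.psi
  map_add' _ _ := rfl
  map_smul' _ _ := rfl
  map_lie' := by
    intro x a
    ext w
    change ⁅x, a⁆ (toTwisted Λ.weight (R.psi w)) = -a (toTwisted Λ.weight (R.psi ⁅x, w⁆))
    rw [R.psi_lie, Module.Dual.lie_apply, lie_toTwisted]

lemma HighestWeightRep.dualPsi_evalOne : R.dualPsi (D.evalOne Λ.weight) = R.form := by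
  ext w
  exact R.psi_apply_one w

lemma leftAct_eRight_pow (x : D.n) (i : D.I) (k : ℕ) (φ : D.CN) :
    D.leftAct x ((D.eRight i ^ k) φ) = (D.eRight i ^ k) (D.leftAct x φ) := by
  induction k generalizing φ with
  | zero => rfl
  | succ k ih =>
    rw [pow_succ, Module.End.mul_apply, ih, eRight, leftAct_rightAct_comm, Module.End.mul_apply]

/-- The module generated by a lowest weight vector `a` is spanned by words in `𝔫` applied to `a`.
These letters act by transposes of the left action up to sign, and the left action preserves `C`. -/
lemma apply_eq_zero_of_mem_lieSpan {χ χ' : Dual ℂ H} {a : TwistedCN D χ →ₗ[ℂ] ℂ}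
    (ha : IsHighestWeightVector (oppBase D.base) χ' a) (C : Set D.CN)
    (hC : ∀ x, ∀ φ ∈ C, D.leftAct x φ ∈ C) (haC : ∀ φ ∈ C, a (toTwisted χ φ) = 0)
    {a' : TwistedCN D χ →ₗ[ℂ] ℂ} (ha' : a' ∈ LieSubmodule.lieSpan ℂ L {a}) :
    ∀ φ ∈ C, a' (toTwisted χ φ) = 0 := by
  have h1 := ha.lieSpan_le ha'
  clear ha'
  induction h1 using Submodule.iSup_induction' with
  | mem n m hm =>
    induction hm using Submodule.span_induction with
    | mem m hm =>
      induction hm with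
      | base => exact haC
      | @step n m f α y hm hα hf hy ih =>
        intro φ hφ
        have hy' : y ∈ D.n := by
          rw [isPos_oppBase, ← isPos_negRoot] at hα
          exact mem_posRootSum (b := D.base) hα hy
        rw [Module.Dual.lie_apply, lie_n_toTwisted χ ⟨y, hy'⟩, ih _ (hC _ φ hφ), neg_zero]
    | zero => intro φ _; rfl
    | add m m' _ _ h h' =>
      intro φ hφ
      rw [LinearMap.add_apply, h φ hφ, h' φ hφ, add_zero]
    | smul c m _ h =>
      intro φ hφ
      rw [LinearMap.smul_apply, h φ hφ, smul_zero]
  | zero => intro φ _; rfl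
  | add m m' _ _ h h' =>
    intro φ hφ
    rw [LinearMap.add_apply, h φ hφ, h' φ hφ, add_zero]

/-- For the nontrivial direction a preimage is found in the bidual of `V`: evaluation at `φ`,
restricted to the module generated by `q`, is shown to factor through the transpose of `Ψ_λ`. -/
lemma HighestWeightRep.mem_range_psi (φ : D.CN) :
    φ ∈ LinearMap.range R.psi ↔ ∀ i, (D.eRight i ^ (Λ.label i + 1)) φ = 0 := by
  refine ⟨fun h i => ?_, fun hφ => ?_⟩
  · obtain ⟨w, rfl⟩ := h
    exact R.eRight_pow_psi i w
  -- The solution set is stable under the left action since `e_i^*` commutes with it. Thus the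
  -- singular vectors, and all of `K`, vanish on it.
  let C : Set D.CN := {φ | ∀ i, (D.eRight i ^ (Λ.label i + 1)) φ = 0}
  have hC : ∀ x, ∀ φ ∈ C, D.leftAct x φ ∈ C := fun x φ hφ i => by
    rw [← leftAct_eRight_pow, hφ i, map_zero]
  let q := D.evalOne Λ.weight
  have hq : IsHighestWeightVector (oppBase D.base) (-Λ.weight) q := isHighestWeightVector_evalOne _
  let s : D.I → TwistedCN D Λ.weight →ₗ[ℂ] ℂ := fun i =>
    (LieModule.toEnd ℂ L (TwistedCN D Λ.weight →ₗ[ℂ] ℂ) (D.e i) ^ (Λ.label i + 1)) q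
  let K : LieSubmodule ℂ L (TwistedCN D Λ.weight →ₗ[ℂ] ℂ) :=
    ⨆ i, LieSubmodule.lieSpan ℂ L {s i}
  let T := R.dualPsi
  have hTq : T q = R.form := R.dualPsi_evalOne
  have hsK : ∀ i, s i ∈ K := fun i =>
    (le_iSup (fun i => LieSubmodule.lieSpan ℂ L {s i}) i) (LieSubmodule.subset_lieSpan rfl)
  have hK : K ≤ T.ker := by
    refine iSup_le fun i => ?_
    rw [LieSubmodule.lieSpan_le, Set.singleton_subset_iff]
    change T (s i) = 0
    rw [map_toEnd_pow, hTq, toEnd_e_pow_eq_zero R.isHighestWeightVector_form]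
  have hKφ : ∀ a ∈ K, a (toTwisted _ φ) = 0 := by
    intro a haK
    have ha : a ∈ (⨆ i, LieSubmodule.lieSpan ℂ L {s i}).toSubmodule := haK
    rw [LieSubmodule.iSup_toSubmodule] at ha
    clear haK
    induction ha using Submodule.iSup_induction' with
    | mem i a ha =>
      obtain ⟨χ, hχ⟩ := isHighestWeightVector_toEnd_e_pow hq i
      refine apply_eq_zero_of_mem_lieSpan hχ C hC (fun φ hφ => ?_) ha φ hφ
      have := toEnd_pow_evalOne_apply Λ.weight (D.eN i) (Λ.label i + 1) φ
      refine this.trans ?_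
      have h2 : (D.rightAct (D.eN i) ^ (Λ.label i + 1)) φ = 0 := hφ i
      rw [h2]
      exact mul_zero _
    | zero => rfl
    | add a a' _ _ h h' => rw [LinearMap.add_apply, h, h', add_zero]
  -- The simple lowering operators for the opposite base are multiples of the `e_i`, and the powers
  -- `Λ.label i + 1` bring `q` into `K`.
  have hker := hq.lieSpan_inf_ker_le T (by
      rw [hTq]
      intro h
      have := R.form_vec
      rw [h] at this
      exact zero_ne_one this) K hK (fun j f hf => by
    obtain ⟨i, hi⟩ := exists_I_of_oppBase j
    rw [← hi] at hf
    obtain ⟨c, rfl⟩ := mem_span_singleton_of_mem_rootSpace (α := (i : H.root)) (D.e_mem i)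
      (sl2Triple i).e_ne_zero (by
        have : (-(negRoot (i : H.root)).1 : H → ℂ) = (i : H.root).1 := by
          funext h
          exact neg_neg ((i : H.root).1 h)
        rwa [this] at hf)
    refine ⟨Λ.label i + 1, ?_⟩
    rw [map_smul, smul_pow]
    exact K.smul_mem _ (hsK i))
  let S := (LieSubmodule.lieSpan ℂ L {q}).toSubmodule
  let TS : S →ₗ[ℂ] (V →ₗ[ℂ] ℂ) := (T : _ →ₗ[ℂ] _) ∘ₗ S.subtype
  have hTS : Function.Surjective TS := by
    intro ξ
    have h1 : LieSubmodule.lieSpan ℂ L {R.form} ≤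
        LieSubmodule.map T (LieSubmodule.lieSpan ℂ L {q}) := by
      rw [LieSubmodule.lieSpan_le, Set.singleton_subset_iff, ← hTq]
      exact LieSubmodule.mem_map_of_mem (LieSubmodule.subset_lieSpan rfl)
    rw [R.lieSpan_form] at h1
    obtain ⟨a, ha, h⟩ := (LieSubmodule.mem_map _).1 (h1 (LieSubmodule.mem_top ξ))
    exact ⟨⟨a, ha⟩, h⟩
  obtain ⟨σ, hσ⟩ := TS.exists_rightInverse_of_surjective (LinearMap.range_eq_top.2 hTS)
  -- The section `σ` is only linear. Its choice does not matter because two lifts of the same form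
  -- differ by an element of `K`, which vanishes at `φ`.
  let ℓ : Dual ℂ (Dual ℂ V) :=
    { toFun := fun ξ => (σ ξ).1 (toTwisted _ φ)
      map_add' := fun ξ ξ' => by rw [map_add]; rfl
      map_smul' := fun c ξ => by rw [map_smul]; rfl }
  have hℓ : ∀ a ∈ S, ℓ (T a) = a (toTwisted _ φ) := by
    intro a ha
    have h1 : (σ (T a)).1 - a ∈ K := by
      refine hker ⟨sub_mem (σ (T a)).2 ha, ?_⟩
      change T ((σ (T a)).1 - a) = 0
      rw [map_sub, sub_eq_zero]
      exact LinearMap.congr_fun hσ (T a)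
    have h2 := hKφ _ h1
    rw [LinearMap.sub_apply, sub_eq_zero] at h2
    exact h2
  let w := (Module.evalEquiv ℂ V).symm ℓ
  have hw : ∀ ξ : Dual ℂ V, ξ w = ℓ ξ := fun ξ => by
    have := LinearEquiv.apply_symm_apply (Module.evalEquiv ℂ V) ℓ
    exact LinearMap.congr_fun this ξ
  refine ⟨w, ?_⟩
  symm
  rw [← sub_eq_zero]
  -- The functions annihilated by the whole module generated by `q`: this space is stable under the
  -- left action, and its elements vanish at `1` because `q` is among the functionals.
  let I : Submodule ℂ D.CN :=
    { carrier := {θ | ∀ a ∈ S, a (toTwisted _ θ) = 0}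
      add_mem' := fun {θ θ'} h h' a ha => by
        change a (toTwisted _ (θ + θ')) = 0
        rw [map_add, map_add, h a ha, h' a ha, add_zero]
      zero_mem' := fun a _ => map_zero a
      smul_mem' := fun c θ h a ha => by
        change a (toTwisted _ (c • θ)) = 0
        rw [map_smul, map_smul, h a ha, smul_zero] }
  refine eq_zero_of_stable I (fun x θ hθ a ha => ?_) (fun θ hθ => ?_) (φ := φ - R.psi w) ?_
  · have h1 := hθ ⁅(x : L), a⁆ (LieSubmodule.lie_mem _ ha)
    rw [Module.Dual.lie_apply, lie_n_toTwisted, neg_eq_zero] at h1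
    exact h1
  · exact hθ q (LieSubmodule.subset_lieSpan rfl)
  · intro a ha
    rw [map_sub, map_sub, sub_eq_zero, ← hℓ a ha, ← hw]
    rfl

end Range

end SemisimpleGroup

/-! ### Weights of the torus -/

namespace SemisimpleGroup

attribute [local instance] LieRing.ofAssociativeRing

variable {L : Type u} [LieRing L] [LieAlgebra ℂ L] [FiniteDimensional ℂ L]
  [LieAlgebra.IsSemisimple ℂ L] {H : LieSubalgebra ℂ L} [H.IsCartanSubalgebra]
  {D : SemisimpleGroup H}

lemma matrix_exp_mulVec {d : ℕ} (A : Matrix (Fin d) (Fin d) ℂ) (v : Fin d → ℂ) (c : ℂ)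
    (h : A.mulVec v = c • v) : (NormedSpace.exp A).mulVec v = Complex.exp c • v := by
  -- With all columns equal to `v`, the eigenvector equation becomes a semiconjugation, which
  -- exponentiates.
  let B : Matrix (Fin d) (Fin d) ℂ := Matrix.of fun i _ => v i
  have h1 : A * B = c • B := by
    ext i j
    rw [Matrix.mul_apply]
    exact congrFun h i
  have h2 : SemiconjBy B (c • 1) A := by
    rw [SemiconjBy, h1]
    simp
  have h3 := matrix_exp_semiconj _ _ _ h2
  have h4 : NormedSpace.exp (c • (1 : Matrix (Fin d) (Fin d) ℂ)) = Complex.exp c • 1 := by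
    rw [← Matrix.diagonal_one, ← Matrix.diagonal_smul, Matrix.exp_diagonal,
      ← Matrix.diagonal_smul]
    congr 1; funext i
    rw [Pi.coe_exp]
    simp [Complex.exp_eq_exp_ℂ]
  rw [h4, mul_smul_comm, mul_one] at h3
  ext i
  have h5 := congrFun (congrFun h3 i) i
  rw [Matrix.mul_apply] at h5
  exact h5.symm

/-- The derivative at `0` along the line through `h` recovers `γ h` from the character. -/
lemma exp_apply_injective :
    Function.Injective fun (γ : Dual ℂ H) (h : H) => Complex.exp (γ h) := by
  intro γ γ' hγ
  ext h
  have hd : ∀ a : ℂ, HasDerivAt (fun t : ℂ => Complex.exp (t * a)) a 0 := by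
    intro a
    have := ((hasDerivAt_id (0 : ℂ)).mul_const a).cexp
    simpa using this
  have h1 : (fun t : ℂ => Complex.exp (t * γ h)) = fun t : ℂ => Complex.exp (t * γ' h) := by
    funext t
    have := congrFun hγ (t • h)
    simpa using this
  have h2 := hd (γ h)
  rw [h1] at h2
  exact h2.unique (hd _)

lemma eq_of_mem_weightCN {δ δ' : Dual ℂ H} {φ : D.CN} (hφ : φ ≠ 0) (h : φ ∈ D.weightCN δ)
    (h' : φ ∈ D.weightCN δ') : δ = δ' := by
  have : ∃ g, φ.1 g ≠ 0 := by
    by_contra! h0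
    exact hφ (CN.ext h0)
  obtain ⟨g, hg⟩ := this
  refine exp_apply_injective (funext fun x => ?_)
  exact mul_right_cancel₀ hg ((h x g).symm.trans (h' x g))

/-- The weight spaces of `ℂ[N]` are independent. -/
lemma mem_weightCN_of_sum_mem {Γ : Type*} (γ : Γ → Dual ℂ H) (hγ : Function.Injective γ)
    {δ : Dual ℂ H} (s : Finset Γ) (w : Γ → D.CN) (hw : ∀ i ∈ s, w i ∈ D.weightCN (γ i))
    (hs : ∑ i ∈ s, w i ∈ D.weightCN δ) : ∀ i ∈ s, w i ∈ D.weightCN δ := by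
  -- The torus is made to act on all functions on `N`, so no stability of the coordinate ring has to
  -- be checked.
  have h := mem_of_sum_mem_of_eigen
    (T := fun h : H => LinearMap.funLeft ℂ ℂ (D.torusConj h))
    (c := fun i h => Complex.exp (γ i h)) (fun i j hij => hγ (exp_apply_injective hij))
    ((D.weightCN δ).map D.coordRing.val.toLinearMap)
    (by
      rintro h _ ⟨φ, hφ, rfl⟩
      refine ⟨Complex.exp (δ h) • φ, Submodule.smul_mem _ _ hφ, ?_⟩
      funext g
      exact (hφ h g).symm)
    s (fun i => (w i).1) (fun i hi h => funext fun g => hw i hi h g)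
    ⟨_, hs, by rw [map_sum]; rfl⟩
  intro i hi
  obtain ⟨φ, hφ, h⟩ := h i hi
  rwa [← show φ = w i from Subtype.ext h]

section Rep

variable {V : Type v} [AddCommGroup V] [Module ℂ V] [FiniteDimensional ℂ V]
  [LieRingModule L V] [LieModule ℂ L V] (hV : WeightsIn H D.X V)

/-- The action of the torus on a representation. -/
def actTorus (h : H) : Module.End ℂ V :=
  Matrix.toLin (finBasis ℂ V) (finBasis ℂ V) (NormedSpace.exp ((toMatrixRep hV).hom (h : L)))

lemma actTorus_apply {χ : Dual ℂ H} {w : V} (hw : w ∈ eigenWeightSpace H V χ) (h : H) :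
    actTorus hV h w = Complex.exp (χ h) • w := by
  apply (finBasis ℂ V).repr.injective
  refine DFunLike.coe_injective ?_
  have h1 : ((toMatrixRep hV).hom (h : L)).mulVec ((finBasis ℂ V).repr w) =
      χ h • ((finBasis ℂ V).repr w : Fin (finrank ℂ V) → ℂ) := by
    refine (LinearMap.toMatrix_mulVec_repr (finBasis ℂ V) (finBasis ℂ V)
      (LieModule.toEnd ℂ L V h) w).trans ?_
    rw [LieModule.toEnd_apply_apply, hw h, map_smul]
    rfl
  rw [actTorus, Matrix.repr_toLin, map_smul]
  exact matrix_exp_mulVec _ _ _ h1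

lemma actTorus_comp_act (h : H) (g : D.N) :
    actTorus hV h ∘ₗ D.act hV (D.torusConj h g) = D.act hV g ∘ₗ actTorus hV h := by
  rw [act, act, actTorus, ← Matrix.toLin_mul, ← Matrix.toLin_mul]
  congr 1
  change (expG D.X (h : L) (toMatrixRep hV)).1 *
    ((expG D.X (h : L))⁻¹ * (g : Ambient H D.X) * expG D.X (h : L)) (toMatrixRep hV) =
    (g : Ambient H D.X) (toMatrixRep hV) * (expG D.X (h : L) (toMatrixRep hV)).1
  simp only [Pi.mul_apply, Pi.inv_apply, Units.val_mul]
  rw [mul_assoc, Units.mul_inv_cancel_left]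

variable {Λ : D.DominantWeight} (R : D.HighestWeightRep V Λ)

lemma HighestWeightRep.form_actTorus (h : H) (w : V) :
    R.form (actTorus R.weightsIn h w) = Complex.exp (Λ.weight h) * R.form w := by
  have hw : w ∈ ⨆ χ, eigenWeightSpace H V χ := R.iSup_eigenWeightSpace ▸ Submodule.mem_top
  induction hw using Submodule.iSup_induction' with
  | mem χ w hw =>
    rw [actTorus_apply _ hw, map_smul, smul_eq_mul]
    by_cases hχ : χ = Λ.weight
    · rw [hχ]
    · rw [R.form_eq_zero' hχ hw, mul_zero, mul_zero]
  | zero => simp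
  | add x y _ _ hx hy => rw [map_add, map_add, hx, hy, map_add, mul_add]

lemma HighestWeightRep.psi_mem_weightCN {χ : Dual ℂ H} {w : V}
    (hw : w ∈ eigenWeightSpace H V χ) : R.psi w ∈ D.weightCN (χ - Λ.weight) := by
  intro h g
  have h1 := R.form_actTorus h (D.act R.weightsIn (D.torusConj h g) w)
  have h2 := LinearMap.congr_fun (actTorus_comp_act R.weightsIn h g) w
  rw [LinearMap.comp_apply, LinearMap.comp_apply, actTorus_apply _ hw] at h2
  rw [h2, map_smul, map_smul, smul_eq_mul] at h1
  change R.form (D.act R.weightsIn (D.torusConj h g) w) = _ * R.form (D.act R.weightsIn g w)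
  rw [LinearMap.sub_apply, Complex.exp_sub, div_mul_eq_mul_div, h1,
    mul_div_cancel_left₀ _ (Complex.exp_ne_zero _)]

/-- By injectivity, every nonzero weight component of `w` has a nonzero image, which then lies in
the single weight space `δ`. -/
lemma HighestWeightRep.mem_of_psi_mem_weightCN {δ : Dual ℂ H} {w : V}
    (hw : R.psi w ∈ D.weightCN δ) : w ∈ eigenWeightSpace H V (δ + Λ.weight) := by
  classical
  have h1 : w ∈ ⨆ χ, eigenWeightSpace H V χ := R.iSup_eigenWeightSpace ▸ Submodule.mem_top
  obtain ⟨c, hc, hs⟩ := (Submodule.mem_iSup_iff_exists_finsupp _ _).1 h1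
  have h2 := mem_weightCN_of_sum_mem (D := D) (fun χ : Dual ℂ H => χ - Λ.weight)
    sub_left_injective (δ := δ) c.support (fun χ => R.psi (c χ))
    (fun χ _ => R.psi_mem_weightCN (hc χ)) (by
      rw [← map_sum]
      change R.psi (c.sum fun _ x => x) ∈ _
      rwa [hs])
  rw [← hs]
  refine sum_mem fun χ hχ => ?_
  have h3 : c χ ≠ 0 := Finsupp.mem_support_iff.1 hχ
  have h4 := eq_of_mem_weightCN ((map_ne_zero_iff _ R.psi_injective).2 h3) (h2 χ hχ)
    (R.psi_mem_weightCN (hc χ))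
  rw [h4, sub_add_cancel]
  exact hc χ

end Rep

end SemisimpleGroup

/-! ### Tensor products as spaces of linear maps -/

section Contr

open scoped TensorProduct

variable {L : Type u} [LieRing L] [LieAlgebra ℂ L]
  {U V W : Type*} [AddCommGroup U] [Module ℂ U] [LieRingModule L U] [LieModule ℂ L U]
  [AddCommGroup V] [Module ℂ V] [FiniteDimensional ℂ V] [LieRingModule L V] [LieModule ℂ L V]
  [AddCommGroup W] [Module ℂ W] [LieRingModule L W] [LieModule ℂ L W]

/-- The contraction of a tensor with a linear form on the second factor. -/
def contr (ξ : Dual ℂ V) : U ⊗[ℂ] V →ₗ[ℂ] U :=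
  (TensorProduct.rid ℂ U).toLinearMap ∘ₗ LinearMap.lTensor U ξ

lemma contr_tmul (ξ : Dual ℂ V) (x : U) (y : V) : contr ξ (x ⊗ₜ[ℂ] y) = ξ y • x := by
  simp [contr]

lemma contr_add (ξ ξ' : Dual ℂ V) (t : U ⊗[ℂ] V) : contr (ξ + ξ') t = contr ξ t + contr ξ' t := by
  simp [contr, LinearMap.lTensor_add]

lemma contr_smul (c : ℂ) (ξ : Dual ℂ V) (t : U ⊗[ℂ] V) : contr (c • ξ) t = c • contr ξ t := by
  simp [contr, LinearMap.lTensor_smul]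

/-- The linear map from the dual space of the second factor that is defined by a tensor. -/
def contrHom (t : U ⊗[ℂ] V) : Dual ℂ V →ₗ[ℂ] U where
  toFun ξ := contr ξ t
  map_add' ξ ξ' := contr_add ξ ξ' t
  map_smul' c ξ := contr_smul c ξ t

lemma sum_contr_tmul (t : U ⊗[ℂ] V) :
    ∑ i, contr ((finBasis ℂ V).coord i) t ⊗ₜ[ℂ] finBasis ℂ V i = t := by
  induction t with
  | zero => simp
  | tmul x y =>
    simp only [contr_tmul, TensorProduct.smul_tmul, ← TensorProduct.tmul_sum]
    congr 1
    exact (finBasis ℂ V).sum_repr y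
  | add t t' h h' =>
    simp only [map_add, TensorProduct.add_tmul, Finset.sum_add_distrib]
    rw [h, h']

lemma eq_zero_of_contrHom_eq_zero {t : U ⊗[ℂ] V} (h : ∀ ξ, contr ξ t = 0) : t = 0 := by
  rw [← sum_contr_tmul t]
  simp [h]

lemma exists_contrHom_eq (F : Dual ℂ V →ₗ[ℂ] U) : ∃ t : U ⊗[ℂ] V, ∀ ξ, contr ξ t = F ξ := by
  refine ⟨∑ i, F ((finBasis ℂ V).coord i) ⊗ₜ[ℂ] finBasis ℂ V i, fun ξ => ?_⟩
  rw [map_sum]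
  simp only [contr_tmul, ← map_smul, ← map_sum]
  congr 1
  refine (finBasis ℂ V).ext fun j => ?_
  simp

lemma contr_lie (x : L) (ξ : V →ₗ[ℂ] ℂ) (t : U ⊗[ℂ] V) :
    contr ξ ⁅x, t⁆ = ⁅x, contr ξ t⁆ - contr ⁅x, ξ⁆ t := by
  induction t with
  | zero => simp
  | tmul y z =>
    rw [TensorProduct.LieModule.lie_tmul_right, map_add, contr_tmul, contr_tmul, contr_tmul,
      contr_tmul, Module.Dual.lie_apply, lie_smul, neg_smul, sub_neg_eq_add]
  | add t t' h h' =>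
    rw [lie_add, map_add, h, h', map_add, lie_add, map_add]
    abel

/-- The product of two modules over a Lie algebra. -/
instance prodLieRingModule : LieRingModule L (U × W) where
  bracket x m := (⁅x, m.1⁆, ⁅x, m.2⁆)
  add_lie x y m := Prod.ext (add_lie x y m.1) (add_lie x y m.2)
  lie_add x m m' := Prod.ext (lie_add x m.1 m'.1) (lie_add x m.2 m'.2)
  leibniz_lie x y m := Prod.ext (leibniz_lie x y m.1) (leibniz_lie x y m.2)

instance prodLieModule : LieModule ℂ L (U × W) where
  smul_lie c x m := Prod.ext (smul_lie c x m.1) (smul_lie c x m.2)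
  lie_smul c x m := Prod.ext (lie_smul c x m.1) (lie_smul c x m.2)

/-- The first projection. -/
def fstLie (L : Type u) [LieRing L] [LieAlgebra ℂ L] (U W : Type*) [AddCommGroup U] [Module ℂ U]
    [LieRingModule L U] [LieModule ℂ L U] [AddCommGroup W] [Module ℂ W] [LieRingModule L W]
    [LieModule ℂ L W] : U × W →ₗ⁅ℂ, L⁆ U :=
  { LinearMap.fst ℂ U W with map_lie' := rfl }

end Contr

/-! ### Homomorphisms into a tensor product and the image of `κ`. -/

namespace SemisimpleGroup

attribute [local instance] LieRing.ofAssociativeRing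

open scoped TensorProduct

variable {L : Type u} [LieRing L] [LieAlgebra ℂ L] [FiniteDimensional ℂ L]
  [LieAlgebra.IsSemisimple ℂ L] {H : LieSubalgebra ℂ L} [H.IsCartanSubalgebra]
  {D : SemisimpleGroup H}
  {U V W : Type v}
  [AddCommGroup U] [Module ℂ U] [FiniteDimensional ℂ U] [LieRingModule L U] [LieModule ℂ L U]
  [AddCommGroup V] [Module ℂ V] [FiniteDimensional ℂ V] [LieRingModule L V] [LieModule ℂ L V]
  [AddCommGroup W] [Module ℂ W] [FiniteDimensional ℂ W] [LieRingModule L W] [LieModule ℂ L W]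
  {lam mu nu : D.DominantWeight}

/-- A homomorphism from `V(ν)` to a finite-dimensional module is given by a highest weight
vector. -/
lemma HighestWeightRep.exists_hom (RW : D.HighestWeightRep W nu) {t : U}
    (ht : IsHighestWeightVector D.base nu.weight t) : ∃ φ : W →ₗ⁅ℂ, L⁆ U, φ RW.vec = t := by
  -- The submodule generated by this pair projects isomorphically to `W`: it meets the kernel
  -- trivially by `lieSpan_inf_ker_le` with `K = ⊥`. So it is the graph of the required
  -- homomorphism.
  let q : W × U := (RW.vec, t)
  have hq : IsHighestWeightVector D.base nu.weight q := by
    refine ⟨fun h => ?_, fun α hα x hx => ?_⟩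
    · exact Prod.ext (RW.isHighestWeightVector.mem h) (ht.mem h)
    · exact Prod.ext (RW.isHighestWeightVector.lie_pos α hα x hx) (ht.lie_pos α hα x hx)
  let T := fstLie L W U
  have hker := hq.lieSpan_inf_ker_le T (by exact RW.vec_ne_zero) ⊥ bot_le (fun i f hf => by
    obtain ⟨k, hk⟩ := isNilpotent_toEnd_of_mem_neg_rootSpace (M := W × U) hf
    exact ⟨k, by rw [hk]; simp⟩)
  let S := (LieSubmodule.lieSpan ℂ L {q}).toSubmodule
  have hS : ∀ a ∈ S, T a = 0 → a = 0 := fun a ha h => by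
    have : a ∈ (⊥ : LieSubmodule ℂ L (W × U)) := hker ⟨ha, h⟩
    simpa using this
  let TS : S →ₗ[ℂ] W := (T : _ →ₗ[ℂ] _) ∘ₗ S.subtype
  have hTS : Function.Surjective TS := by
    intro w
    have h1 : LieSubmodule.lieSpan ℂ L {RW.vec} ≤
        LieSubmodule.map T (LieSubmodule.lieSpan ℂ L {q}) := by
      rw [LieSubmodule.lieSpan_le, Set.singleton_subset_iff]
      exact LieSubmodule.mem_map_of_mem (f := T) (m := q) (LieSubmodule.subset_lieSpan rfl)
    rw [RW.lieSpan_vec] at h1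
    obtain ⟨a, ha, h⟩ := (LieSubmodule.mem_map _).1 (h1 (LieSubmodule.mem_top w))
    exact ⟨⟨a, ha⟩, h⟩
  obtain ⟨σ, hσ⟩ := TS.exists_rightInverse_of_surjective (LinearMap.range_eq_top.2 hTS)
  have hσ' : ∀ a ∈ S, (σ (T a)).1 = a := by
    intro a ha
    rw [← sub_eq_zero]
    refine hS _ (sub_mem (σ (T a)).2 ha) ?_
    rw [map_sub, sub_eq_zero]
    exact LinearMap.congr_fun hσ (T a)
  have hTσ : ∀ w, T (σ w).1 = w := LinearMap.congr_fun hσ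
  refine ⟨{ LinearMap.snd ℂ W U ∘ₗ S.subtype ∘ₗ σ with map_lie' := ?_ }, ?_⟩
  · intro x w
    have h1 : ⁅x, (σ w).1⁆ ∈ S := LieSubmodule.lie_mem _ (σ w).2
    have h2 := hσ' _ h1
    rw [T.map_lie, hTσ] at h2
    exact congrArg Prod.snd h2
  · have h2 := hσ' q (LieSubmodule.subset_lieSpan rfl)
    exact congrArg Prod.snd h2

lemma mem_n_of_oppBase {α : H.root} (hα : (oppBase D.base).IsPos α) {y : L}
    (hy : y ∈ rootSpace H (-α.1)) : y ∈ D.n := by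
  rw [isPos_oppBase, ← isPos_negRoot] at hα
  exact mem_posRootSum (b := D.base) hα hy

/-- An `𝔫`-invariant tensor is determined by its contraction with `v_μ^*`. -/
lemma HighestWeightRep.eq_zero_of_contr_form_eq_zero (RV : D.HighestWeightRep V mu)
    {t : U ⊗[ℂ] V} (ht : ∀ x : D.n, ⁅(x : L), t⁆ = 0) (h : contr RV.form t = 0) : t = 0 := by
  refine eq_zero_of_contrHom_eq_zero fun ξ => ?_
  have hξ : ξ ∈ ⨆ n, loweringSpan (oppBase D.base) RV.form n := by
    refine RV.isHighestWeightVector_form.lieSpan_le ?_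
    rw [RV.lieSpan_form]
    trivial
  induction hξ using Submodule.iSup_induction' with
  | mem n m hm =>
    induction hm using Submodule.span_induction with
    | mem m hm =>
      induction hm with
      | base => exact h
      | @step n m f α y hm hα hf hy ih =>
        have h1 := contr_lie y m t
        rw [ht ⟨y, mem_n_of_oppBase hα hy⟩, map_zero, ih, lie_zero, zero_sub, eq_comm,
          neg_eq_zero] at h1
        exact h1
    | zero => exact map_zero (contrHom t)
    | add m m' _ _ h h' => rw [contr_add, h, h', add_zero]
    | smul c m _ h => rw [contr_smul, h, smul_zero]
  | zero => exact map_zero (contrHom t)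
  | add m m' _ _ h h' => rw [contr_add, h, h', add_zero]

lemma contraction_apply (RV : D.HighestWeightRep V mu) (RW : D.HighestWeightRep W nu)
    (φ : W →ₗ⁅ℂ, L⁆ U ⊗[ℂ] V) : contraction RV RW φ = contr RV.form (φ RW.vec) := rfl

lemma HighestWeightRep.map_isHighestWeightVector (RW : D.HighestWeightRep W nu)
    (φ : W →ₗ⁅ℂ, L⁆ U) : IsHighestWeightVector D.base nu.weight (φ RW.vec) := by
  refine ⟨fun h => ?_, fun α hα x hx => ?_⟩
  · rw [← φ.map_lie, RW.isHighestWeightVector.mem h, map_smul]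
  · rw [← φ.map_lie, RW.isHighestWeightVector.lie_pos α hα x hx, map_zero]

lemma lie_n_eq_zero {χ : Dual ℂ H} {t : U} (ht : IsHighestWeightVector D.base χ t) (x : D.n) :
    ⁅(x : L), t⁆ = 0 :=
  posRootSum_induction (b := D.base) (p := fun x => ⁅x, t⁆ = 0) ht.lie_pos (zero_lie t)
    (fun x y hx hy => by rw [add_lie, hx, hy, add_zero]) x.2

lemma contraction_injective (RV : D.HighestWeightRep V mu) (RW : D.HighestWeightRep W nu) :
    Function.Injective (contraction (U := U) RV RW) := by
  rw [← LinearMap.ker_eq_bot, LinearMap.ker_eq_bot']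
  intro φ hφ
  have h1 := RV.eq_zero_of_contr_form_eq_zero (lie_n_eq_zero (RW.map_isHighestWeightVector φ)) hφ
  have h2 : LieSubmodule.lieSpan ℂ L {RW.vec} ≤ φ.ker := by
    rw [LieSubmodule.lieSpan_le, Set.singleton_subset_iff]
    exact h1
  rw [RW.lieSpan_vec] at h2
  ext w
  exact h2 (LieSubmodule.mem_top w)

/-- The weights of the dual are negatives of weights of `U`; this puts its matrix coefficients into
`ℂ[N]`. -/
lemma HighestWeightRep.weightsIn_dual (RU : D.HighestWeightRep U lam) :
    WeightsIn H D.X (U →ₗ[ℂ] ℂ) := by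
  intro χ ξ hξ h
  have : ∃ (γ : Dual ℂ H) (m : U), m ∈ eigenWeightSpace H U γ ∧ ξ m ≠ 0 := by
    by_contra! hcon
    refine hξ (LinearMap.ext fun m => ?_)
    have hm : m ∈ ⨆ χ, eigenWeightSpace H U χ := RU.iSup_eigenWeightSpace ▸ Submodule.mem_top
    induction hm using Submodule.iSup_induction' with
    | mem γ m hm => exact hcon γ m hm
    | zero => simp
    | add x y _ _ hx hy => rw [map_add, hx, hy]; simp
  obtain ⟨γ, m, hm, hξm⟩ := this
  have hγ : γ ∈ D.X := RU.weightsIn γ m (by rintro rfl; simp at hξm) hm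
  have : χ = -γ := by
    ext x
    have h1 := LinearMap.congr_fun (h x) m
    rw [Module.Dual.lie_apply, hm x, map_smul, LinearMap.smul_apply, smul_eq_mul,
      smul_eq_mul, ← neg_mul] at h1
    exact (mul_right_cancel₀ hξm h1).symm
  rw [this]
  exact neg_mem hγ

/-- The `𝔫`-equivariant map on the dual space of `V(μ)` with a given value at `v_μ^*`. -/
lemma HighestWeightRep.exists_equivariant (RU : D.HighestWeightRep U lam)
    (RV : D.HighestWeightRep V mu) {a : U}
    (ha : ∀ i, (LieModule.toEnd ℂ L U (D.e i) ^ (mu.label i + 1)) a = 0) :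
    ∃ F : (V →ₗ[ℂ] ℂ) →ₗ[ℂ] U, F RV.form = a ∧ ∀ (x : D.n) ξ, F ⁅(x : L), ξ⁆ = ⁅(x : L), F ξ⁆ := by
  have hd := RU.weightsIn_dual
  -- The functions `g ↦ (g ξ)(a)` are matrix coefficients of the dual of `U`. The operators `e_i^*`
  -- move onto `a`, up to sign, so `ha` places these coefficients in the image of `Ψ_μ`.
  let ev : Dual ℂ (U →ₗ[ℂ] ℂ) := Dual.eval ℂ U a
  have hev : ∀ (x : L) (m : U) k, (LieModule.toEnd ℂ L ((U →ₗ[ℂ] ℂ) →ₗ[ℂ] ℂ) x ^ k)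
      (Dual.eval ℂ U m) = Dual.eval ℂ U ((LieModule.toEnd ℂ L U x ^ k) m) := by
    intro x m k
    induction k with
    | zero => rfl
    | succ k ih =>
      rw [pow_succ', pow_succ', Module.End.mul_apply, Module.End.mul_apply, ih]
      ext ξ
      rw [LieModule.toEnd_apply_apply, Module.Dual.lie_apply, LieModule.toEnd_apply_apply]
      exact neg_neg _
  have hr : ∀ ξ, coeff hd ev ξ ∈ LinearMap.range RV.psi := by
    intro ξ
    rw [RV.mem_range_psi]
    intro i
    rw [eRight_pow_coeff, hev, ha, map_zero, smul_zero]
    rfl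
  let Ψ := LinearEquiv.ofInjective RV.psi RV.psi_injective
  let c : (U →ₗ[ℂ] ℂ) →ₗ[ℂ] V :=
    Ψ.symm.toLinearMap ∘ₗ LinearMap.codRestrict _ (coeffLin hd ev) hr
  have hc : ∀ ξ, RV.psi (c ξ) = coeff hd ev ξ := fun ξ =>
    congrArg Subtype.val (Ψ.apply_symm_apply ⟨_, hr ξ⟩)
  have hcx : ∀ (x : D.n) ξ, c ⁅(x : L), ξ⁆ = ⁅(x : L), c ξ⁆ := by
    intro x ξ
    apply RV.psi_injective
    rw [hc, ← RV.leftAct_psi, hc, leftAct_coeff]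
  -- This is the transpose of `c`; its value at `v_μ^*` is `a` because `v_μ^*` corresponds to
  -- evaluating `Ψ_μ` at `1`.
  let F : (V →ₗ[ℂ] ℂ) →ₗ[ℂ] U := (evalEquiv ℂ U).symm.toLinearMap ∘ₗ c.dualMap
  have hF : ∀ (ζ : V →ₗ[ℂ] ℂ) (ξ : U →ₗ[ℂ] ℂ), ξ (F ζ) = ζ (c ξ) := fun ζ ξ =>
    LinearMap.congr_fun ((evalEquiv ℂ U).apply_symm_apply (c.dualMap ζ)) ξ
  refine ⟨F, ?_, fun x ζ => ?_⟩
  · rw [← sub_eq_zero, ← Module.forall_dual_apply_eq_zero_iff ℂ]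
    intro ξ
    rw [map_sub, hF, ← RV.psi_apply_one, hc, coeff_apply_one, sub_eq_zero]
    rfl
  · rw [← sub_eq_zero, ← Module.forall_dual_apply_eq_zero_iff ℂ]
    intro ξ
    rw [map_sub, hF, Module.Dual.lie_apply, ← hcx, ← hF, Module.Dual.lie_apply (f := ξ)]
    ring

/-- An `𝔫`-invariant tensor is an `𝔫`-equivariant map on the dual of `V(μ)`, so its value at `v_μ^*`
inherits the relations of `v_μ^*`. Conversely `exists_equivariant` realizes every admissible value.
-/
lemma mem_range_contraction (RU : D.HighestWeightRep U lam) (RV : D.HighestWeightRep V mu)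
    (RW : D.HighestWeightRep W nu) (a : U) :
    a ∈ LinearMap.range (contraction (U := U) RV RW) ↔
      a ∈ eigenWeightSpace H U (nu.weight - mu.weight) ∧
      ∀ i, (LieModule.toEnd ℂ L U (D.e i) ^ (mu.label i + 1)) a = 0 := by
  constructor
  · rintro ⟨φ, rfl⟩
    rw [contraction_apply]
    have ht := RW.map_isHighestWeightVector φ
    generalize φ RW.vec = t at ht
    constructor
    · intro h
      have h1 := contr_lie (h : L) RV.form t
      rw [ht.mem h, RV.isHighestWeightVector_form.mem h, contr_smul, map_smul,
        LinearMap.neg_apply] at h1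
      rw [LinearMap.sub_apply, sub_smul, h1, neg_smul]
      abel
    · intro i
      have h1 : ∀ k, (LieModule.toEnd ℂ L U (D.e i) ^ k) (contr RV.form t) =
          contr ((LieModule.toEnd ℂ L (V →ₗ[ℂ] ℂ) (D.e i) ^ k) RV.form) t := by
        intro k
        induction k with
        | zero => rfl
        | succ k ih =>
          rw [pow_succ', pow_succ', Module.End.mul_apply, Module.End.mul_apply, ih,
            LieModule.toEnd_apply_apply, LieModule.toEnd_apply_apply]
          have h2 := contr_lie (D.e i) ((LieModule.toEnd ℂ L (V →ₗ[ℂ] ℂ) (D.e i) ^ k) RV.form) t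
          have h3 : ⁅D.e i, t⁆ = 0 := lie_n_eq_zero ht (D.eN i)
          rw [h3, map_zero, eq_comm, sub_eq_zero] at h2
          exact h2
      rw [h1, toEnd_e_pow_eq_zero RV.isHighestWeightVector_form]
      exact map_zero (contrHom t)
  · rintro ⟨ha, he⟩
    obtain ⟨F, hFa, hF⟩ := RU.exists_equivariant RV he
    obtain ⟨t, ht⟩ := exists_contrHom_eq F
    have htn : ∀ x : D.n, ⁅(x : L), t⁆ = 0 := fun x => by
      refine eq_zero_of_contrHom_eq_zero fun ξ => ?_
      rw [contr_lie, ht, ht, hF, sub_self]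
    have htw : IsHighestWeightVector D.base nu.weight t := by
      refine ⟨fun h => ?_, fun α hα x hx => htn ⟨x, mem_posRootSum (b := D.base) hα hx⟩⟩
      rw [← sub_eq_zero]
      -- The defect `⁅h, t⁆ - ν(h) t` is again `𝔫`-invariant, so the weight of `t` can be read off
      -- from its contraction with `v_μ^*`.
      refine RV.eq_zero_of_contr_form_eq_zero (fun x => ?_) ?_
      · have hxh : ⁅(x : L), (h : L)⁆ ∈ D.n := by
          rw [← lie_skew]
          exact neg_mem (cartan_lie_mem_posRootSum (b := D.base) h x.2)
        rw [lie_sub, leibniz_lie, lie_smul, htn, lie_zero, smul_zero, htn ⟨_, hxh⟩]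
        simp
      · rw [map_sub, contr_lie, map_smul, RV.isHighestWeightVector_form.mem h, contr_smul, ht, hFa,
          ha h, LinearMap.sub_apply, LinearMap.neg_apply, neg_smul, sub_smul]
        abel
    obtain ⟨φ, hφ⟩ := RW.exists_hom htw
    exact ⟨φ, by rw [contraction_apply, hφ, ht, hFa]⟩

end SemisimpleGroup

/-! ### Compatible subspaces -/

section Compatible

variable {M : Type*} [AddCommGroup M] [Module ℂ M] {B : Set M}

/-- The basis with a given set of elements. -/
def setBasis (hli : LinearIndependent ℂ (fun b : B => (b : M)))
    (hsp : Submodule.span ℂ B = ⊤) : Basis B ℂ M :=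
  Basis.mk hli (by rw [Subtype.range_coe, hsp])

lemma setBasis_apply (hli : LinearIndependent ℂ (fun b : B => (b : M)))
    (hsp : Submodule.span ℂ B = ⊤) (b : B) : setBasis hli hsp b = b := by
  rw [setBasis, Basis.mk_apply]

variable (hli : LinearIndependent ℂ (fun b : B => (b : M))) (hsp : Submodule.span ℂ B = ⊤)

/-- Since `s` is arbitrary, several compatibility conditions can be imposed at once: membership is
tested on each basis element of the expansion. -/
lemma mem_span_iff_support (s : Set M) (v : M) :
    v ∈ Submodule.span ℂ (B ∩ s) ↔ ∀ b ∈ ((setBasis hli hsp).repr v).support, (b : M) ∈ s := by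
  have h1 : B ∩ s = setBasis hli hsp '' {b : B | (b : M) ∈ s} := by
    ext x
    constructor
    · rintro ⟨hx, hxs⟩
      exact ⟨⟨x, hx⟩, hxs, setBasis_apply hli hsp _⟩
    · rintro ⟨b, hb, rfl⟩
      rw [setBasis_apply]
      exact ⟨b.2, hb⟩
  rw [h1, Basis.mem_span_image]
  rfl

lemma sum_repr_setBasis (v : M) :
    ∑ b ∈ ((setBasis hli hsp).repr v).support, (setBasis hli hsp).repr v b • (b : M) = v := by
  have h := (setBasis hli hsp).linearCombination_repr v
  rw [Finsupp.linearCombination_apply, Finsupp.sum] at h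
  simpa only [setBasis_apply] using h

/-- A basis of a space that is mapped isomorphically to the span of a set of independent vectors. -/
lemma exists_basis_of_injective {E : Type*} [AddCommGroup E] [Module ℂ E] (F : E →ₗ[ℂ] M)
    (hF : Function.Injective F) {S : Set M} (hS : LinearIndependent ℂ (fun b : S => (b : M)))
    (hr : Submodule.span ℂ S = LinearMap.range F) :
    ∃ β : Basis S ℂ E, ∀ b, F (β b) = b := by
  let e1 := LinearEquiv.ofEq _ _ (show Submodule.span ℂ (Set.range fun b : S => (b : M)) =
    LinearMap.range F by rw [Subtype.range_coe, hr])
  let e2 := LinearEquiv.ofInjective F hF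
  refine ⟨(Basis.span hS).map (e1.trans e2.symm), fun b => ?_⟩
  rw [Basis.map_apply, LinearEquiv.trans_apply]
  have h1 : F (e2.symm (e1 (Basis.span hS b))) = (e1 (Basis.span hS b)).1 :=
    congrArg Subtype.val (e2.apply_symm_apply _)
  rw [h1]
  exact congrArg Subtype.val (Basis.span_apply hS b)

end Compatible

/-! ### Transfer of biperfect bases to `V(λ)` and to the spaces of homomorphisms. -/

namespace SemisimpleGroup

attribute [local instance] LieRing.ofAssociativeRing

open scoped TensorProduct

variable {L : Type u} [LieRing L] [LieAlgebra ℂ L] [FiniteDimensional ℂ L]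
  [LieAlgebra.IsSemisimple ℂ L] {H : LieSubalgebra ℂ L} [H.IsCartanSubalgebra]
  {D : SemisimpleGroup H} {B : Set D.CN}

lemma eps_le_iff (i : D.I) (b : D.CN) (n : ℕ) : D.eps i b ≤ n ↔ (D.eLeft i ^ (n + 1)) b = 0 :=
  nilpotenceDegree_le_iff (exists_eLeft_pow_eq_zero i b) n

lemma epsStar_le_iff (i : D.I) (b : D.CN) (n : ℕ) :
    D.epsStar i b ≤ n ↔ (D.eRight i ^ (n + 1)) b = 0 :=
  nilpotenceDegree_le_iff (exists_eRight_pow_eq_zero i b) n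

/-- The basis of `ℂ[N]` defined by a biperfect basis. -/
abbrev IsBiperfect.basis (hB : D.IsBiperfect B) : Basis B ℂ D.CN :=
  setBasis hB.left.linearIndependent hB.left.span_eq_top

lemma IsBiperfect.mem_ker_eLeft (hB : D.IsBiperfect B) {i : D.I} {n : ℕ} {v : D.CN}
    (hv : (D.eLeft i ^ n) v = 0) {b : B} (hb : b ∈ (hB.basis.repr v).support) :
    (D.eLeft i ^ n) (b : D.CN) = 0 := by
  have h1 : v ∈ LinearMap.ker (D.eLeft i ^ n) := hv
  rw [hB.left.compatible] at h1
  exact (mem_span_iff_support _ _ _ v).1 h1 b hb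

lemma IsBiperfect.mem_ker_eRight (hB : D.IsBiperfect B) {i : D.I} {n : ℕ} {v : D.CN}
    (hv : (D.eRight i ^ n) v = 0) {b : B} (hb : b ∈ (hB.basis.repr v).support) :
    (D.eRight i ^ n) (b : D.CN) = 0 := by
  have h1 : v ∈ LinearMap.ker (D.eRight i ^ n) := hv
  rw [hB.right.compatible] at h1
  exact (mem_span_iff_support _ _ _ v).1 h1 b hb

/-- The expansion is grouped by weights. The group containing `b` is nonzero by linear independence
and must have weight `δ`, because weight spaces are independent. -/
lemma IsBiperfect.mem_weightCN (hB : D.IsBiperfect B) {δ : Dual ℂ H} {v : D.CN}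
    (hv : v ∈ D.weightCN δ) {b : B} (hb : b ∈ (hB.basis.repr v).support) :
    (b : D.CN) ∈ D.weightCN δ := by
  classical
  choose wt hwt using fun b : B => hB.left.exists_weight b b.2
  set c := hB.basis.repr v with hc
  have hs : ∑ b ∈ c.support, c b • (b : D.CN) = v := sum_repr_setBasis _ _ v
  rw [← Finset.sum_fiberwise_of_maps_to (t := c.support.image wt) (g := wt)
    (fun b hb => Finset.mem_image_of_mem _ hb)] at hs
  have hw : ∀ γ, ∑ b ∈ c.support with wt b = γ, c b • (b : D.CN) ∈ D.weightCN γ := fun γ =>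
    sum_mem fun b hb => by
      rw [← (Finset.mem_filter.1 hb).2]
      exact Submodule.smul_mem _ _ (hwt b)
  have h1 := mem_weightCN_of_sum_mem (D := D) id Function.injective_id (δ := δ)
    (c.support.image wt) _ (fun γ _ => hw γ) (by rw [hs]; exact hv) (wt b)
    (Finset.mem_image_of_mem _ hb)
  have h2 : ∑ b' ∈ c.support with wt b' = wt b, c b' • (b' : D.CN) ≠ 0 := by
    intro h0
    have h3 := linearIndependent_iff'.1 hB.left.linearIndependent _ _ h0 b
      (Finset.mem_filter.2 ⟨hb, rfl⟩)
    exact Finsupp.mem_support_iff.1 hb h3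
  rw [← eq_of_mem_weightCN h2 (hw _) h1]
  exact hwt b

section Rep

variable {V : Type v} [AddCommGroup V] [Module ℂ V] [FiniteDimensional ℂ V]
  [LieRingModule L V] [LieModule ℂ L V] {Λ : D.DominantWeight} (R : D.HighestWeightRep V Λ)

lemma HighestWeightRep.eLeft_pow_psi (i : D.I) (k : ℕ) (w : V) :
    (D.eLeft i ^ k) (R.psi w) = R.psi ((D.eRep V i ^ k) w) := by
  induction k with
  | zero => rfl
  | succ k ih =>
    rw [pow_succ', pow_succ', Module.End.mul_apply, Module.End.mul_apply, ih, eLeft, leftAct_psi]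
    rfl

lemma HighestWeightRep.eLeft_pow_psi_eq_zero_iff (i : D.I) (k : ℕ) (w : V) :
    (D.eLeft i ^ k) (R.psi w) = 0 ↔ (D.eRep V i ^ k) w = 0 := by
  rw [eLeft_pow_psi, map_eq_zero_iff _ R.psi_injective]

lemma HighestWeightRep.nilpotenceDegree_psi (i : D.I) (w : V) :
    nilpotenceDegree (D.eLeft i) (R.psi w) = nilpotenceDegree (D.eRep V i) w := by
  simp only [nilpotenceDegree, ne_eq, R.eLeft_pow_psi_eq_zero_iff]

/-- The image of `Ψ_λ` is an intersection of kernels, each compatible with the basis, and the bound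
on `ε_i^*` says exactly that a basis element lies in it. -/
lemma IsBiperfect.span_eq_range_psi (hB : D.IsBiperfect B) :
    Submodule.span ℂ {b : D.CN | b ∈ B ∧ ∀ i : D.I, D.epsStar i b ≤ Λ.label i} =
      LinearMap.range R.psi := by
  have h1 : {b : D.CN | b ∈ B ∧ ∀ i : D.I, D.epsStar i b ≤ Λ.label i} =
      B ∩ {b | ∀ i : D.I, (D.eRight i ^ (Λ.label i + 1)) b = 0} := by
    ext b
    simp only [epsStar_le_iff]
    rfl
  ext v
  rw [h1, mem_span_iff_support hB.left.linearIndependent hB.left.span_eq_top, R.mem_range_psi]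
  constructor
  · intro h i
    rw [← sum_repr_setBasis hB.left.linearIndependent hB.left.span_eq_top v, map_sum]
    refine Finset.sum_eq_zero fun b hb => ?_
    rw [map_smul, h b hb i, smul_zero]
  · intro h b hb i
    exact hB.mem_ker_eRight (h i) hb

/-- The preimage of a biperfect basis in `V(λ)`. -/
lemma IsBiperfect.exists_perfect (hB : D.IsBiperfect B) :
    ∃ β : Module.Basis {b : D.CN // b ∈ B ∧ ∀ i : D.I, D.epsStar i b ≤ Λ.label i} ℂ V,
      (∀ b, R.psi (β b) = b) ∧
      IsPerfectBasis (D.weightRep V) (D.eRep V) (Set.range β) := by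
  obtain ⟨β, hβ⟩ := exists_basis_of_injective R.psi R.psi_injective
    (S := {b : D.CN | b ∈ B ∧ ∀ i : D.I, D.epsStar i b ≤ Λ.label i})
    (LinearIndepOn.mono (v := id) hB.left.linearIndependent fun b hb => hb.1)
    (hB.span_eq_range_psi R)
  refine ⟨β, hβ, β.linearIndependent.linearIndepOn_id, β.span_eq, ?_, ?_, ?_⟩
  · rintro _ ⟨b, rfl⟩
    obtain ⟨γ, hγ⟩ := hB.left.exists_weight b b.2.1
    refine ⟨γ + Λ.weight, ?_⟩
    rw [weightRep_eq]
    exact R.mem_of_psi_mem_weightCN (by rw [hβ]; exact hγ)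
  · intro i n
    refine le_antisymm (fun w hw => ?_) (Submodule.span_le.2 Set.inter_subset_right)
    have h1 : (D.eLeft i ^ n) (R.psi w) = 0 := (R.eLeft_pow_psi_eq_zero_iff i n w).2 hw
    -- Every basis element in the expansion of `Ψ(w)` satisfies both the equations of the image and
    -- `e_i^n b = 0`, so it comes from some `β` in the kernel.
    have h2 : R.psi w ∈ Submodule.span ℂ (B ∩ R.psi '' (Set.range β ∩
        LinearMap.ker (D.eRep V i ^ n))) := by
      rw [mem_span_iff_support hB.left.linearIndependent hB.left.span_eq_top]
      intro b hb
      have hbS : b.1 ∈ B ∧ ∀ i : D.I, D.epsStar i b.1 ≤ Λ.label i :=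
        ⟨b.2, fun j => by
          rw [epsStar_le_iff]
          exact hB.mem_ker_eRight (R.eRight_pow_psi j w) hb⟩
      refine ⟨β ⟨b, hbS⟩, ⟨⟨_, rfl⟩, ?_⟩, hβ _⟩
      refine (R.eLeft_pow_psi_eq_zero_iff i n _).1 ?_
      rw [hβ]
      exact hB.mem_ker_eLeft h1 hb
    have h3 := Submodule.span_mono Set.inter_subset_right h2
    rw [← Submodule.map_span] at h3
    obtain ⟨w', hw', h⟩ := h3
    rwa [← R.psi_injective h]
  · rintro i _ ⟨b, rfl⟩
    rw [← R.nilpotenceDegree_psi, hβ]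
    have hpsi : R.psi (D.eRep V i (β b)) = D.eLeft i b := by
      have := R.eLeft_pow_psi i 1 (β b)
      rw [pow_one, pow_one, hβ] at this
      exact this.symm
    rw [or_iff_not_imp_left]
    intro h0
    have h0' : D.eLeft i b ≠ 0 := by
      rw [← hpsi]
      exact (map_ne_zero_iff _ R.psi_injective).2 h0
    obtain ⟨b', hb', h⟩ := (hB.left.perfect i b b.2.1).resolve_left h0'
    change D.eLeft i b.1 - (D.eps i b.1 : ℂ) • b' ∈
      LinearMap.ker (D.eLeft i ^ (D.eps i b.1 - 1)) at h
    change ∃ b' ∈ Set.range β, D.eRep V i (β b) - (D.eps i b.1 : ℂ) • b' ∈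
      LinearMap.ker (D.eRep V i ^ (D.eps i b.1 - 1))
    -- As `e_i b ≠ 0`, the degree is positive and the truncated subtraction in `ε - 1` is a genuine
    -- one.
    have hε : ∃ m, D.eps i b.1 = m + 1 := by
      refine Nat.exists_eq_succ_of_ne_zero fun hε => h0' ?_
      have := (eps_le_iff i b.1 0).1 hε.le
      simpa using this
    obtain ⟨m, hm⟩ := hε
    have hne : (D.eLeft i ^ (m + 1)) b.1 ≠ 0 := by
      intro h1
      have := (eps_le_iff i b.1 m).2 h1
      omega
    rw [hm, Nat.add_sub_cancel] at h ⊢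
    have hb'm : (D.eLeft i ^ m) b' ≠ 0 := by
      intro h1
      have h2 : (D.eLeft i ^ m) (D.eLeft i b.1 - ((m + 1 : ℕ) : ℂ) • b') = 0 := h
      rw [map_sub, map_smul, h1, smul_zero, sub_zero, ← Module.End.mul_apply, ← pow_succ] at h2
      exact hne h2
    -- The difference `e_i b - ε b'` is killed by `e_i^m` but `b'` is not, so compatibility keeps
    -- `b'` out of its expansion. Hence `b'` has coefficient `ε ≠ 0` in `e_i b`, which lies in the
    -- image of `Ψ`; so `b'` satisfies the same bounds on `ε_j^*`.
    have hsupp : (⟨b', hb'⟩ : B) ∈ (hB.basis.repr (D.eLeft i b.1)).support := by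
      have h1 : (⟨b', hb'⟩ : B) ∉
          (hB.basis.repr (D.eLeft i b.1 - ((m + 1 : ℕ) : ℂ) • b')).support := fun h2 =>
        hb'm (hB.mem_ker_eLeft h h2)
      rw [Finsupp.notMem_support_iff, map_sub, map_smul] at h1
      have h2 : hB.basis.repr b' = Finsupp.single ⟨b', hb'⟩ 1 := by
        rw [← hB.basis.repr_self, setBasis_apply]
      rw [h2, Finsupp.sub_apply, sub_eq_zero] at h1
      rw [Finsupp.mem_support_iff, h1]
      simp only [Finsupp.smul_apply, Finsupp.single_eq_same, smul_eq_mul, mul_one, ne_eq,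
        Nat.cast_eq_zero]
      omega
    have hbS : b' ∈ B ∧ ∀ i : D.I, D.epsStar i b' ≤ Λ.label i :=
      ⟨hb', fun j => by
        rw [epsStar_le_iff]
        refine hB.mem_ker_eRight (b := ⟨b', hb'⟩) ?_ hsupp
        rw [← hpsi]
        exact R.eRight_pow_psi j _⟩
    refine ⟨β ⟨b', hbS⟩, ⟨_, rfl⟩, ?_⟩
    refine (R.eLeft_pow_psi_eq_zero_iff i m _).1 ?_
    rw [map_sub, map_smul, hpsi, hβ]
    exact h

end Rep

section Tensor

variable {U V W : Type v}
  [AddCommGroup U] [Module ℂ U] [FiniteDimensional ℂ U] [LieRingModule L U] [LieModule ℂ L U]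
  [AddCommGroup V] [Module ℂ V] [FiniteDimensional ℂ V] [LieRingModule L V] [LieModule ℂ L V]
  [AddCommGroup W] [Module ℂ W] [FiniteDimensional ℂ W] [LieRingModule L W] [LieModule ℂ L W]
  {lam mu nu : D.DominantWeight}

/-- The map `Ψ_λ` intertwines the operators `e_i` and shifts weights by `-λ`, so the conditions
describing the image of `κ` carry over verbatim to `ℂ[N]`. -/
lemma mem_range_psi_comp_contraction (RU : D.HighestWeightRep U lam)
    (RV : D.HighestWeightRep V mu) (RW : D.HighestWeightRep W nu) (φ : D.CN) :
    φ ∈ LinearMap.range (RU.psi ∘ₗ contraction (U := U) RV RW) ↔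
      φ ∈ D.weightCN (nu.weight - mu.weight - lam.weight) ∧
      ∀ i, (D.eLeft i ^ (mu.label i + 1)) φ = 0 ∧ (D.eRight i ^ (lam.label i + 1)) φ = 0 := by
  constructor
  · rintro ⟨f, rfl⟩
    obtain ⟨h1, h2⟩ := (mem_range_contraction RU RV RW (contraction RV RW f)).1 ⟨f, rfl⟩
    exact ⟨RU.psi_mem_weightCN h1, fun i =>
      ⟨(RU.eLeft_pow_psi_eq_zero_iff i _ _).2 (h2 i), RU.eRight_pow_psi i _⟩⟩
  · rintro ⟨h1, h2⟩
    obtain ⟨a, rfl⟩ := (RU.mem_range_psi φ).2 fun i => (h2 i).2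
    have h3 := RU.mem_of_psi_mem_weightCN h1
    rw [sub_add_cancel] at h3
    obtain ⟨f, rfl⟩ := (mem_range_contraction RU RV RW a).2
      ⟨h3, fun i => (RU.eLeft_pow_psi_eq_zero_iff i _ _).1 (h2 i).1⟩
    exact ⟨f, rfl⟩

/-- The preimage of a biperfect basis in `Hom(V(ν), V(λ) ⊗ V(μ))`. -/
lemma IsBiperfect.exists_basis_hom (hB : D.IsBiperfect B) (RU : D.HighestWeightRep U lam)
    (RV : D.HighestWeightRep V mu) (RW : D.HighestWeightRep W nu) :
    ∃ β : Module.Basis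
        {b : D.CN // b ∈ B ∧ b ∈ D.weightCN (nu.weight - mu.weight - lam.weight) ∧
          ∀ i : D.I, D.eps i b ≤ mu.label i ∧ D.epsStar i b ≤ lam.label i}
        ℂ (W →ₗ⁅ℂ, L⁆ U ⊗[ℂ] V),
      ∀ b, RU.psi (contraction RV RW (β b)) = b := by
  refine exists_basis_of_injective (RU.psi ∘ₗ contraction (U := U) RV RW)
    (RU.psi_injective.comp (contraction_injective RV RW))
    (S := {b : D.CN | b ∈ B ∧ b ∈ D.weightCN (nu.weight - mu.weight - lam.weight) ∧
          ∀ i : D.I, D.eps i b ≤ mu.label i ∧ D.epsStar i b ≤ lam.label i})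
    (LinearIndepOn.mono (v := id) hB.left.linearIndependent fun b hb => hb.1) ?_
  have h1 : {b : D.CN | b ∈ B ∧ b ∈ D.weightCN (nu.weight - mu.weight - lam.weight) ∧
      ∀ i : D.I, D.eps i b ≤ mu.label i ∧ D.epsStar i b ≤ lam.label i} =
      B ∩ {b | b ∈ D.weightCN (nu.weight - mu.weight - lam.weight) ∧
        ∀ i, (D.eLeft i ^ (mu.label i + 1)) b = 0 ∧ (D.eRight i ^ (lam.label i + 1)) b = 0} := by
    ext b
    simp only [epsStar_le_iff, eps_le_iff]
    rfl
  ext v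
  rw [h1, mem_span_iff_support hB.left.linearIndependent hB.left.span_eq_top,
    mem_range_psi_comp_contraction]
  constructor
  · intro h
    rw [← sum_repr_setBasis hB.left.linearIndependent hB.left.span_eq_top v]
    refine ⟨sum_mem fun b hb => Submodule.smul_mem _ _ (h b hb).1, fun i => ?_⟩
    rw [map_sum, map_sum]
    refine ⟨Finset.sum_eq_zero fun b hb => ?_, Finset.sum_eq_zero fun b hb => ?_⟩
    · rw [map_smul, ((h b hb).2 i).1, smul_zero]
    · rw [map_smul, ((h b hb).2 i).2, smul_zero]
  · intro h b hb
    exact ⟨hB.mem_weightCN h.1 hb, fun i =>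
      ⟨hB.mem_ker_eLeft (h.2 i).1 hb, hB.mem_ker_eRight (h.2 i).2 hb⟩⟩

end Tensor

end SemisimpleGroup

end

open scoped TensorProduct in
theorem corollary1p4 {L : Type u} [LieRing L] [LieAlgebra ℂ L] [FiniteDimensional ℂ L]
    [LieAlgebra.IsSemisimple ℂ L] (H : LieSubalgebra ℂ L) [H.IsCartanSubalgebra]
    (G : SemisimpleGroup H) (B : Set G.CN) (hB : G.IsBiperfect B) :
    (∀ (lam : G.DominantWeight) (V : Type v) [AddCommGroup V] [Module ℂ V] [FiniteDimensional ℂ V]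
      [LieRingModule L V] [LieModule ℂ L V] (R : G.HighestWeightRep V lam),
      ∃ β : Module.Basis {b : G.CN // b ∈ B ∧ ∀ i : G.I, G.epsStar i b ≤ lam.label i} ℂ V,
        (∀ b, R.psi (β b) = b) ∧
        IsPerfectBasis (G.weightRep V) (G.eRep V) (Set.range β)) ∧
    (∀ (lam mu nu : G.DominantWeight) (U V W : Type v)
      [AddCommGroup U] [Module ℂ U] [FiniteDimensional ℂ U] [LieRingModule L U] [LieModule ℂ L U]
      [AddCommGroup V] [Module ℂ V] [FiniteDimensional ℂ V] [LieRingModule L V] [LieModule ℂ L V]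
      [AddCommGroup W] [Module ℂ W] [FiniteDimensional ℂ W] [LieRingModule L W] [LieModule ℂ L W]
      (RU : G.HighestWeightRep U lam) (RV : G.HighestWeightRep V mu) (RW : G.HighestWeightRep W nu),
      ∃ β : Module.Basis
          {b : G.CN // b ∈ B ∧ b ∈ G.weightCN (nu.weight - mu.weight - lam.weight) ∧
            ∀ i : G.I, G.eps i b ≤ mu.label i ∧ G.epsStar i b ≤ lam.label i}
          ℂ (W →ₗ⁅ℂ, L⁆ U ⊗[ℂ] V),
        ∀ b, RU.psi (SemisimpleGroup.contraction RV RW (β b)) = b) := by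
  exact ⟨fun lam V _ _ _ _ _ R => hB.exists_perfect R,
    fun lam mu nu U V W _ _ _ _ _ _ _ _ _ _ _ _ _ _ _ RU RV RW => hB.exists_basis_hom RU RV RW⟩
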